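/- Let $k$ be an algebraically closed field, let $X$ and $Y$ be irreducible smooth projective curves over $k$, and let $f:X\to Y$ be a dominant, generically smooth $k$-morphism of degree $r=[k(X):k(Y)]$; if $\operatorname{char}(k)\neq 0$, assume $\operatorname{char}(k)>r$. For a closed point $x\in X$ let $m_x\ge 1$ be the multiplicity (ramification index) of $f$ at $x$, and let $\Delta=f(\{x : m_x\ge 2\})\subset Y$ be the branch locus. The sheaf $f_*\mathcal O_X$ is a vector bundle of rank $r$ on $Y$, and it carries the following natural parabolic structure with parabolic divisor $\Delta$. For $y\in\Delta$, $x\in f^{-1}(y)$ and $0\le j\le m_x$, let $\mathbf F(x,j)$ be the image of the fiber at $y$ of $f_*\mathcal O_X\bigl(-jx-\sum_{z\in f^{-1}(y),\,z\ne x}m_z z\bigr)$ in the fiber $(f_*\mathcal O_X)_y$. The parabolic weights at $y$ are the numbers $j/m_x$ with $x\in f^{-1}(y)$ and $0\le j<m_x$; the subspace of $(f_*\mathcal O_X)_y$ of weight at least $\lambda$ is the sum of the $\mathbf F(x,j)$ with $x\in f^{-1}(y)$, $0\le j<m_x$ and $j/m_x\ge\lambda$. If $\alpha_{y,1}<\dots<\alpha_{y,n_y}$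 are the distinct weights at $y$, the filtration $(f_*\mathcal O_X)_y=V_y^1\supsetneq V_y^2\supsetneq\dots\supsetneq V_y^{n_y}\supsetneq V_y^{n_y+1}=0$ is given by the subspaces $V_y^i$ of weight at least $\alpha_{y,i}$, $1\le i\le n_y$. These data form a parabolic vector bundle $(f_*\mathcal O_X)_*$ of rank $r$. Then the parabolic degree of $(f_*\mathcal O_X)_*$ is zero: $$\text{par-deg}\bigl((f_*\mathcal O_X)_*\bigr):=\deg(f_*\mathcal O_X)+\sum_{y\in\Delta}\sum_{i=1}^{n_y}\alpha_{y,i}\,\dim_k\bigl(V_y^i/V_y^{i+1}\bigr)=0 .$$ -/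

import Mathlib

open AlgebraicGeometry CategoryTheory
open scoped TensorProduct

universe u

noncomputable section

/-- A smooth projective (irreducible) curve over a field `k`: an integral scheme that is smooth of
relative dimension one and proper over `k`.  (Proper curves over a field are projective.) -/
structure SmoothProjectiveCurve (k : Type u) [Field k] where
  /-- the underlying scheme -/
  X : Scheme.{u}
  /-- the structure morphism -/
  str : X ⟶ Spec (.of k)
  [integral : IsIntegral X]
  [smooth : SmoothOfRelativeDimension 1 str]
  [proper : IsProper str]

namespace SmoothProjectiveCurve

attribute [instance] integral smooth proper

instance {k : Type u} [Field k] (C : SmoothProjectiveCurve k) : IsLocallyNoetherian C.X :=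
  LocallyOfFiniteType.isLocallyNoetherian C.str

end SmoothProjectiveCurve

namespace CurveBundle

/-! ### Stalks, vector bundles, fibres -/

section Bundles

variable {Y : Scheme.{u}}

/-- The stalk `M_y` of a sheaf of modules `M` at a point `y`. -/
def Stalk (M : Y.Modules) (y : Y) : Type u :=
  ↑(TopCat.Presheaf.stalk M.presheaf y)

instance (M : Y.Modules) (y : Y) : AddCommGroup (Stalk M y) :=
  inferInstanceAs (AddCommGroup ↑(TopCat.Presheaf.stalk M.presheaf y))

/-- The module structure on stalks, for presheaves of modules. -/
abbrev presheafStalkModule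
    (M : PresheafOfModules.{u} (Y.presheaf ⋙ forget₂ CommRingCat RingCat)) (y : Y) :
    Module (Y.presheaf.stalk y) ↑(TopCat.Presheaf.stalk M.presheaf y) :=
  inferInstance

/-- The stalk `M_y` is a module over the local ring `𝒪_(Y,y)`. -/
instance (M : Y.Modules) (y : Y) : Module (Y.presheaf.stalk y) (Stalk M y) :=
  presheafStalkModule M.val y

/-- The germ at `y` of a section of `M` over an open neighbourhood of `y`. -/
def germ (M : Y.Modules) {V : Y.Opens} (y : Y) (hy : y ∈ V) (s : Γ(M, V)) : Stalk M y :=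
  TopCat.Presheaf.germ M.presheaf V y hy s

/-- The localisation map from the stalk at `y` to the stalk at the generic point. -/
def toGeneric [IrreducibleSpace Y] (M : Y.Modules) (y : Y) :
    Stalk M y → Stalk M (genericPoint Y) :=
  TopCat.Presheaf.stalkSpecializes M.presheaf ((genericPoint_spec Y).specializes trivial)

/-- `M` is a vector bundle of rank `r`: locally there are `r` sections which form a basis of every
stalk, i.e. which define an isomorphism `𝒪_V ^ r ≅ M|_V`. -/
def IsVectorBundle (M : Y.Modules) (r : ℕ) : Prop :=
  ∀ y : Y, ∃ (V : Y.Opens) (_ : y ∈ V) (s : Fin r → Γ(M, V)),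
    ∀ (z : Y) (hz : z ∈ V),
      LinearIndependent (Y.presheaf.stalk z) (fun i => germ M z hz (s i)) ∧
      Submodule.span (Y.presheaf.stalk z) (Set.range fun i => germ M z hz (s i)) = ⊤

/-- The residue field `κ(y)`. -/
abbrev Kappa (Y : Scheme.{u}) (y : Y) : Type u := IsLocalRing.ResidueField (Y.presheaf.stalk y)

/-- The fibre `κ(y) ⊗ M_y` of `M` at `y`. -/
abbrev Fiber (M : Y.Modules) (y : Y) : Type u := Kappa Y y ⊗[Y.presheaf.stalk y] Stalk M y

end Bundles

/-! ### The degree of a vector bundle on a curve -/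

section Degree

variable {Y : Scheme.{u}} [IsIntegral Y] [IsLocallyNoetherian Y]

/-- The order at `y` of the rational section `b₁ ∧ ⋯ ∧ bₙ` of `det M`, where `b` is a basis of the
generic stalk of `M`: if `e` is a basis of the stalk `M_y`, then
`e₁ ∧ ⋯ ∧ eₙ = det_b(e) • b₁ ∧ ⋯ ∧ bₙ`, so the order is that of `det_b(e)⁻¹`.
It does not depend on the choice of `e`. -/
def detOrder (M : Y.Modules) {n : ℕ}
    (b : Module.Basis (Fin n) Y.functionField (Stalk M (genericPoint Y))) (y : Y) : ℤ :=
  open Classical in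
  if h : Nonempty (Module.Basis (Fin n) (Y.presheaf.stalk y) (Stalk M y)) then
    - Scheme.ord (b.det fun i => toGeneric M y (h.some i)) y
  else 0

/-- The degree of a vector bundle `M` on a projective curve over an algebraically closed field: the
degree of its determinant line bundle, i.e. the number of zeros minus the number of poles of a
nonzero rational section `b₁ ∧ ⋯ ∧ bₙ` of `det M`.  (It does not depend on the choice of `b`.) -/
def degree (M : Y.Modules) : ℤ :=
  open Classical in
  if h : Nonempty (Module.Basis (Fin (Module.finrank Y.functionField (Stalk M (genericPoint Y))))
      Y.functionField (Stalk M (genericPoint Y))) then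
    ∑ᶠ y ∈ closedPoints Y, detOrder M h.some y
  else 0

end Degree

/-! ### Parabolic bundles -/

/-- The dimension of `A / B`, for subspaces `B ⊆ A` of a vector space. -/
def quotientDim {K W : Type*} [Field K] [AddCommGroup W] [Module K W] (A B : Submodule K W) : ℕ :=
  Module.finrank K (A ⧸ B.submoduleOf A)

/-- The data of a parabolic bundle: a sheaf of modules `V`, a set `D` of points, and for each
`y ∈ D` a chain of subspaces `V_y = V¹ ⊋ V² ⊋ ⋯ ⊋ Vⁿ ⊋ Vⁿ⁺¹ = 0` of the fibre with weights
`0 ≤ α₁ < ⋯ < αₙ < 1`.  Indices are shifted by one: `flag y j` is `V^(j+1)`, `weight y j` is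
`α_(j+1)`.  The conditions are in `ParabolicData.IsParabolicBundle`. (Values at points outside `D`
are irrelevant.) -/
structure ParabolicData (Y : Scheme.{u}) where
  /-- the underlying sheaf of modules -/
  V : Y.Modules
  /-- the parabolic divisor -/
  D : Set Y
  /-- the length of the filtration at `y` -/
  n : Y → ℕ
  /-- the filtration at `y` -/
  flag : (y : Y) → Fin (n y + 1) → Submodule (Kappa Y y) (Fiber V y)
  /-- the parabolic weights at `y` -/
  weight : (y : Y) → Fin (n y) → ℚ

namespace ParabolicData

variable {Y : Scheme.{u}}

/-- The given data form a parabolic vector bundle of rank `r`. -/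
structure IsParabolicBundle (P : ParabolicData Y) (r : ℕ) : Prop where
  isVectorBundle : IsVectorBundle P.V r
  finite_divisor : P.D.Finite
  closed_points : P.D ⊆ closedPoints Y
  flag_first : ∀ y ∈ P.D, P.flag y 0 = ⊤
  flag_last : ∀ y ∈ P.D, P.flag y (Fin.last (P.n y)) = ⊥
  flag_strictAnti : ∀ y ∈ P.D, StrictAnti (P.flag y)
  weight_nonneg : ∀ y ∈ P.D, ∀ j, 0 ≤ P.weight y j
  weight_lt_one : ∀ y ∈ P.D, ∀ j, P.weight y j < 1
  weight_strictMono : ∀ y ∈ P.D, StrictMono (P.weight y)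

/-- The multiplicity `dim V^j / V^(j+1)` of the `j`-th weight at `y`. -/
def multiplicity (P : ParabolicData Y) (y : Y) (j : Fin (P.n y)) : ℕ :=
  quotientDim (P.flag y j.castSucc) (P.flag y j.succ)

/-- The parabolic degree: the degree of `V` plus the sum of all weights, counted with
multiplicity. -/
def parDeg [IsIntegral Y] [IsLocallyNoetherian Y] (P : ParabolicData Y) : ℚ :=
  (degree P.V : ℚ) + ∑ᶠ y ∈ P.D, ∑ j : Fin (P.n y), P.weight y j * (P.multiplicity y j : ℚ)

end ParabolicData

/-! ### The direct image of the structure sheaf -/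

section DirectImage

variable {X Y : Scheme.{u}} (f : X ⟶ Y)

/-- The degree of a dominant morphism of integral schemes: the degree of the extension of function
fields.  (For dominant `f` the point `f (genericPoint X)` is the generic point of `Y`.) -/
def mapDegree [IrreducibleSpace X] : ℕ :=
  letI := (f.stalkMap (genericPoint X)).hom.toAlgebra
  Module.finrank (Y.presheaf.stalk (f (genericPoint X))) X.functionField

/-- The multiplicity `m_x` of `f` at `x`: the largest `m` with
`𝔪_(f x) 𝒪_(X,x) ⊆ 𝔪_x ^ m`. -/
def mult (x : X) : ℕ :=
  letI := (f.stalkMap x).hom.toAlgebra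
  Ideal.ramificationIdx' (IsLocalRing.maximalIdeal (Y.presheaf.stalk (f x)))
    (IsLocalRing.maximalIdeal (X.presheaf.stalk x))

/-- The ramification locus of `f`. -/
def ramificationLocus : Set X := {x | x ∈ closedPoints X ∧ 2 ≤ mult f x}

/-- The branch locus of `f`. -/
def branchLocus : Set Y := f '' ramificationLocus f

/-- The sheaf of modules `f_* 𝒪_X`. -/
def directImage : Y.Modules :=
  (Scheme.Modules.pushforward f).obj (SheafOfModules.unit X.ringCatSheaf)

/-- The sections over `U` of the ideal sheaf `𝒪_X(-∑ D(z) z)`, for an effective divisor `D`: the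
functions on `U` that vanish to order at least `D(z)` at every `z ∈ U`. -/
def idealSections (D : X → ℕ) (U : X.Opens) : Ideal Γ(X, U) :=
  ⨅ z : U, (IsLocalRing.maximalIdeal (X.presheaf.stalk z.1) ^ D z.1).comap
    (X.presheaf.germ U z.1 z.2).hom

/-- The image in the stalk `(f_* 𝒪_X)_y` of the stalk of the subsheaf `f_* 𝒪_X(-D)`. -/
def stalkImage (D : X → ℕ) (y : Y) :
    Submodule (Y.presheaf.stalk y) (Stalk (directImage f) y) :=
  Submodule.span _ {t | ∃ (V : Y.Opens) (hy : y ∈ V) (s : Γ(X, f ⁻¹ᵁ V)),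
    s ∈ idealSections D (f ⁻¹ᵁ V) ∧ germ (directImage f) y hy s = t}

/-- The divisor `j x + ∑ m_z z`, the sum being over the points `z ≠ x` of the fibre of `f` at
`y`. -/
def fiberDivisor (y : Y) (x : X) (j : ℕ) : X → ℕ := fun z =>
  open Classical in if z = x then j else if f z = y then mult f z else 0

/-- The subspace `𝐅(x, j)` of the fibre of `f_* 𝒪_X` at `y`: the image of the fibre at `y` of
`f_* 𝒪_X(-j x - ∑ m_z z)`. -/
def fiberSubspace (y : Y) (x : X) (j : ℕ) : Submodule (Kappa Y y) (Fiber (directImage f) y) :=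
  (stalkImage f (fiberDivisor f y x j) y).baseChange (Kappa Y y)

/-- The subspace of the fibre of `f_* 𝒪_X` at `y` of parabolic weight at least `a`: the sum over
`x ∈ f⁻¹(y)` of the subspaces `𝐅(x, j)` whose weight `j / m_x` is at least `a`
(here `0 ≤ j < m_x`). -/
def weightSubspace (y : Y) (a : ℚ) : Submodule (Kappa Y y) (Fiber (directImage f) y) :=
  ⨆ (x : X) (_ : f x = y) (j : ℕ) (_ : j < mult f x) (_ : a ≤ (j : ℚ) / mult f x),
    fiberSubspace f y x j

/-- The parabolic weights at `y`: the numbers `j / m_x` for `x ∈ f⁻¹(y)` and `0 ≤ j < m_x`. -/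
def weightSet (y : Y) : Set ℚ :=
  {a | ∃ (x : X) (j : ℕ), f x = y ∧ j < mult f x ∧ a = (j : ℚ) / mult f x}

/-- The weights at `y` as a finite set (the set is finite as the fibre of `f` is). -/
def weightFinset (y : Y) : Finset ℚ :=
  open Classical in if h : (weightSet f y).Finite then h.toFinset else ∅

/-- The natural parabolic structure on `f_* 𝒪_X`: the parabolic divisor is the branch locus, the
weights `α₁ < ⋯ < αₙ` at `y` are the numbers `j / m_x` in increasing order, and the subspace with
weight `αᵢ` is the subspace of weight at least `αᵢ`. -/
def directImageParabolic : ParabolicData Y where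
  V := directImage f
  D := branchLocus f
  n y := (weightFinset f y).card
  flag y := Fin.lastCases ⊥ fun j =>
    weightSubspace f y ((weightFinset f y).orderEmbOfFin rfl j)
  weight y j := (weightFinset f y).orderEmbOfFin rfl j

end DirectImage

end CurveBundle

end

open IsLocalRing

/-!
Measure everything by the discriminant of the trace form of `k(X)` over `k(Y)`.  As the
multiplicities are invertible in `k`, the discriminant of a basis of the stalk of `f_* 𝒪_X` at `y`
has order `∑ (m_x - 1)` at `y`, the sum being over the points `x` above `y`.  The discriminant of a
basis of the generic stalk is a rational function on `Y`, hence has as many zeros as poles;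
expressing the local bases through the generic one changes it by the squares of the determinants
that compute the degree, so `2 deg (f_* 𝒪_X) = -∑ (m_x - 1)`.  On the other hand a basis of the
fibre adapted to all the `𝐅(x, j)` shows that `x` contributes `∑ j / m_x = (m_x - 1) / 2` to the sum
of the weights.

That a rational function `g` has as many zeros as poles is seen from `k(g) ⊆ k(X)` if `dg ≠ 0`:
both numbers are then the degree of this separable extension.  If `dg = 0`, apply this to `t` and
`g t` for some `t` with `dt ≠ 0`.
-/

section DedekindDomain

variable {B ι : Type*} [CommRing B] [IsDedekindDomain B] {P : ι → Ideal B}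

theorem mul_notMem_pow_of_prime {Q : Ideal B} (hQ : Prime Q) {x y : B} {m n : ℕ}
    (hx : x ∈ Q ^ m) (hx' : x ∉ Q ^ (m + 1)) (hy : y ∈ Q ^ n) (hy' : y ∉ Q ^ (n + 1)) :
    x * y ∉ Q ^ (m + n + 1) := by
  simp only [← Ideal.dvd_span_singleton, ← Ideal.span_singleton_mul_span_singleton] at *
  exact fun h => (succ_dvd_or_succ_dvd_of_succ_sum_dvd_mul hQ hx hy h).elim hx' hy'

theorem mem_prod_pow_iff_of_prime [Fintype ι] (hP : ∀ i, Prime (P i)) (hinj : Function.Injective P)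
    (n : ι → ℕ) (x : B) : x ∈ ∏ i, P i ^ n i ↔ ∀ i, x ∈ P i ^ n i := by
  rw [← IsDedekindDomain.inf_pow_eq_prod_of_prime Finset.univ P n (fun i _ => hP i)
    fun i _ j _ hij hP => hij (hinj hP)]
  simp [Submodule.mem_finsetInf]

variable [Finite ι]

theorem exists_forall_sub_mem_pow_of_prime (hP : ∀ i, Prime (P i)) (hinj : Function.Injective P)
    (n : ι → ℕ) (x : ι → B) : ∃ y, ∀ i, y - x i ∈ P i ^ n i := by
  have := Fintype.ofFinite ι
  obtain ⟨y, hy⟩ := IsDedekindDomain.exists_forall_sub_mem_ideal (s := Finset.univ) P n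
    (fun i _ => hP i) (fun i _ j _ hij => hinj.ne hij) fun i => x i
  exact ⟨y, fun i => hy i (Finset.mem_univ i)⟩

theorem exists_mem_pow_notMem_pow_succ_of_prime (hP : ∀ i, Prime (P i))
    (hinj : Function.Injective P) (i : ι) (j : ℕ) (n : ι → ℕ) :
    ∃ y, y ∈ P i ^ j ∧ y ∉ P i ^ (j + 1) ∧ ∀ l, l ≠ i → y ∈ P l ^ n l := by
  classical
  obtain ⟨z, hz, hz'⟩ := (P i).exists_mem_pow_notMem_pow_succ (hP i).ne_zero
    (Ideal.isPrime_of_prime (hP i)).ne_top j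
  obtain ⟨y, hy⟩ := exists_forall_sub_mem_pow_of_prime hP hinj (Function.update n i (j + 1))
    (Pi.single i z)
  have hyi : y - z ∈ P i ^ (j + 1) := by simpa using hy i
  refine ⟨y, ?_, fun h => hz' ?_, fun l hl => by simpa [hl] using hy l⟩
  · simpa using add_mem (Ideal.pow_le_pow_right j.le_succ hyi) hz
  · simpa using sub_mem h hyi

end DedekindDomain

theorem mem_span_image_sup_smul_top_iff {R M κ : Type*} [CommRing R] [AddCommGroup M]
    [Module R M] [Finite κ] (b : Module.Basis κ R M) (I : Ideal R) (s : Set κ) (x : M) :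
    x ∈ Submodule.span R (b '' s) ⊔ I • (⊤ : Submodule R M) ↔ ∀ p ∉ s, b.repr x p ∈ I := by
  have := Fintype.ofFinite κ
  constructor
  · intro hx p hp
    suffices h : Submodule.span R (b '' s) ⊔ I • (⊤ : Submodule R M) ≤
        Submodule.comap (b.coord p) I from h hx
    refine sup_le (Submodule.span_le.mpr ?_) (Submodule.smul_le.mpr fun a ha y _ => ?_)
    · rintro _ ⟨q, hq, rfl⟩
      have hqp : p ≠ q := fun h => hp (h ▸ hq)
      simp [Finsupp.single_eq_of_ne hqp]
    · simpa using I.mul_mem_right _ ha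
  · intro hx
    rw [← b.sum_repr x]
    refine sum_mem fun p _ => ?_
    by_cases hp : p ∈ s
    · exact Submodule.mem_sup_left (Submodule.smul_mem _ _
        (Submodule.subset_span (Set.mem_image_of_mem _ hp)))
    · exact Submodule.mem_sup_right (Submodule.smul_mem_smul (hx p hp) trivial)

theorem isUnit_det_of_forall_vecMul_mem {A n : Type*} [CommRing A] [IsLocalRing A] [Fintype n]
    [DecidableEq n] (M : Matrix n n A)
    (hM : ∀ c : n → A, (∀ q, Matrix.vecMul c M q ∈ maximalIdeal A) → ∀ p, c p ∈ maximalIdeal A) :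
    IsUnit M.det := by
  by_contra hdet
  have hdet' : ((residue A).mapMatrix M).det = 0 := by
    rwa [← RingHom.map_det, residue_eq_zero_iff, mem_maximalIdeal]
  obtain ⟨v, hv, hvM⟩ := Matrix.exists_vecMul_eq_zero_iff.mpr hdet'
  choose c hc using fun p => residue_surjective (v p)
  obtain rfl : residue A ∘ c = v := funext hc
  refine hv (funext fun p => (residue_eq_zero_iff _).mpr (hM c (fun q => ?_) p))
  rw [← residue_eq_zero_iff, RingHom.map_vecMul]
  exact congrFun hvM q

/-- A factorization `𝔪_A B = ∏ P i ^ e i` of the extension of the maximal ideal of a local ring `A`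
into powers of distinct nonzero primes of `B` with trivial residue extensions. -/
structure IsSplitFactorization (A : Type*) {B ι : Type*} [CommRing A] [IsLocalRing A] [CommRing B]
    [Algebra A B] [Fintype ι] (P : ι → Ideal B) (e : ι → ℕ) : Prop where
  prime : ∀ i, Prime (P i)
  injective : Function.Injective P
  pos : ∀ i, 0 < e i
  map_eq : (maximalIdeal A).map (algebraMap A B) = ∏ i, P i ^ e i
  residue : ∀ i b, ∃ a, b - algebraMap A B a ∈ P i

/-- Elements `b (i, j)`, for `j < e i`, of order exactly `j` at `P i` and of order at least `e l` at
the other primes `P l`. -/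
structure IsAdaptedSystem {B ι : Type*} [CommRing B] (P : ι → Ideal B) (e : ι → ℕ)
    (b : (Σ i, Fin (e i)) → B) : Prop where
  mem : ∀ p, b p ∈ P p.1 ^ (p.2 : ℕ)
  mem_other : ∀ p l, l ≠ p.1 → b p ∈ P l ^ e l
  notMem : ∀ p, b p ∉ P p.1 ^ (p.2 + 1 : ℕ)

/-- Scaling an adapted basis `b` by these factors, `t` on the `b (i, 0)` and `1` on the other
vectors, turns it into a basis of the radical `⋂ P i`, for `t` a uniformizer. -/
def radicalFactor {A ι : Type*} [One A] (e : ι → ℕ) (t : A) (p : Σ i, Fin (e i)) : A :=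
  if (p.2 : ℕ) = 0 then t else 1

namespace IsSplitFactorization

section LocalRing

variable {A B ι : Type*} [CommRing A] [IsLocalRing A] [CommRing B] [IsDedekindDomain B]
  [Algebra A B] [Fintype ι] {P : ι → Ideal B} {e : ι → ℕ} {b : (Σ i, Fin (e i)) → B}

theorem isPrime (h : IsSplitFactorization A P e) (i : ι) : (P i).IsPrime :=
  Ideal.isPrime_of_prime (h.prime i)

theorem mem_map_iff (h : IsSplitFactorization A P e) (x : B) :
    x ∈ (maximalIdeal A).map (algebraMap A B) ↔ ∀ i, x ∈ P i ^ e i := by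
  rw [h.map_eq, mem_prod_pow_iff_of_prime h.prime h.injective]

theorem algebraMap_mem_pow (h : IsSplitFactorization A P e) (i : ι) {a : A}
    (ha : a ∈ maximalIdeal A) : algebraMap A B a ∈ P i ^ e i :=
  (h.mem_map_iff _).mp (Ideal.mem_map_of_mem _ ha) i

theorem comap_eq (h : IsSplitFactorization A P e) (i : ι) :
    (P i).comap (algebraMap A B) = maximalIdeal A :=
  ((maximalIdeal.isMaximal A).eq_of_le ((h.isPrime i).comap _).ne_top fun _ ha =>
    Ideal.mem_comap.mpr (Ideal.pow_le_self (h.pos i).ne' (h.algebraMap_mem_pow i ha))).symm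

theorem exists_eq_mul (h : IsSplitFactorization A P e) {t : A}
    (ht : maximalIdeal A = Ideal.span {t}) (n : ι → ℕ) {x : B}
    (hx : ∀ i, x ∈ P i ^ (e i + n i)) : ∃ y, x = algebraMap A B t * y ∧ ∀ i, y ∈ P i ^ n i := by
  have hx' : x ∈ (maximalIdeal A).map (algebraMap A B) * ∏ i, P i ^ n i := by
    simp_rw [h.map_eq, ← Finset.prod_mul_distrib, ← pow_add]
    rwa [mem_prod_pow_iff_of_prime h.prime h.injective]
  rw [ht, Ideal.map_span, Set.image_singleton, Ideal.mem_span_singleton_mul] at hx'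
  obtain ⟨y, hy, rfl⟩ := hx'
  exact ⟨y, rfl, (mem_prod_pow_iff_of_prime h.prime h.injective n y).mp hy⟩

theorem exists_adaptedSystem (h : IsSplitFactorization A P e) :
    ∃ b : (Σ i, Fin (e i)) → B, IsAdaptedSystem P e b := by
  choose b hmem hnotMem hother using fun p : Σ i, Fin (e i) =>
    exists_mem_pow_notMem_pow_succ_of_prime h.prime h.injective p.1 p.2 e
  exact ⟨b, hmem, hother, hnotMem⟩

theorem exists_sub_smul_mem (h : IsSplitFactorization A P e) (hb : IsAdaptedSystem P e b)
    (p : Σ i, Fin (e i)) {x : B} (hx : x ∈ P p.1 ^ (p.2 : ℕ))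
    (hx' : ∀ l, l ≠ p.1 → x ∈ P l ^ e l) :
    ∃ a : A, x - a • b p ∈ P p.1 ^ (p.2 + 1 : ℕ) ∧ ∀ l, l ≠ p.1 → x - a • b p ∈ P l ^ e l := by
  have := h.isPrime p.1
  obtain ⟨d, z, hz, rfl⟩ := Ideal.exists_mul_add_mem_pow_succ (h.prime p.1).ne_zero (b p) x
    (hb.mem p) (hb.notMem p) hx
  obtain ⟨a, ha⟩ := h.residue p.1 d
  refine ⟨a, ?_, fun l hl => ?_⟩
  · have hsub : b p * d + z - a • b p = b p * (d - algebraMap A B a) + z := by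
      rw [Algebra.smul_def]; ring
    rw [hsub, pow_succ]
    exact add_mem (Ideal.mul_mem_mul (hb.mem p) ha) (pow_succ (P p.1) _ ▸ hz)
  · exact sub_mem (hx' l hl) (Submodule.smul_of_tower_mem _ a (hb.mem_other p l hl))

theorem mem_span_range_sup (h : IsSplitFactorization A P e) (hb : IsAdaptedSystem P e b) (i : ι)
    {j : ℕ} (hj : j ≤ e i) {x : B} (hx : x ∈ P i ^ j) (hx' : ∀ l, l ≠ i → x ∈ P l ^ e l) :
    x ∈ Submodule.span A (Set.range b) ⊔ maximalIdeal A • (⊤ : Submodule A B) := by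
  induction hj using Nat.decreasingInduction generalizing x with
  | self =>
    refine Submodule.mem_sup_right ?_
    rw [Ideal.smul_top_eq_map, Submodule.restrictScalars_mem, h.mem_map_iff]
    intro l
    obtain rfl | hl := eq_or_ne l i
    exacts [hx, hx' l hl]
  | of_succ j hj ih =>
    obtain ⟨a, ha, ha'⟩ := h.exists_sub_smul_mem hb ⟨i, j, hj⟩ hx hx'
    rw [← sub_add_cancel x (a • b ⟨i, j, hj⟩)]
    exact add_mem (ih ha ha') (Submodule.mem_sup_left (Submodule.smul_mem _ _
      (Submodule.subset_span (Set.mem_range_self _))))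

theorem coeff_mem_of_sum_mem_pow (h : IsSplitFactorization A P e) (hb : IsAdaptedSystem P e b)
    (c : (Σ i, Fin (e i)) → A) (p : Σ i, Fin (e i))
    (hc : ∑ q, c q • b q ∈ P p.1 ^ (p.2 + 1 : ℕ)) : c p ∈ maximalIdeal A := by
  classical
  obtain ⟨i, j, hj⟩ := p
  induction j using Nat.strong_induction_on with
  | _ j ih =>
    have hother : ∑ q ∈ Finset.univ.erase ⟨i, j, hj⟩, c q • b q ∈ P i ^ (j + 1) := by
      refine sum_mem fun ⟨l, m, hm⟩ hq => ?_
      obtain rfl | hl := eq_or_ne l i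
      · rcases lt_trichotomy m j with hmj | rfl | hmj
        · rw [Algebra.smul_def]
          exact Ideal.mul_mem_right _ _ (Ideal.pow_le_pow_right hj (h.algebraMap_mem_pow l
            (ih m hmj hm (Ideal.pow_le_pow_right (Nat.succ_le_succ hmj.le) hc))))
        · simp at hq
        · exact Submodule.smul_of_tower_mem _ _ (Ideal.pow_le_pow_right hmj (hb.mem ⟨l, m, hm⟩))
      · exact Submodule.smul_of_tower_mem _ _
          (Ideal.pow_le_pow_right hj (hb.mem_other ⟨l, m, hm⟩ i hl.symm))
    have hterm : algebraMap A B (c ⟨i, j, hj⟩) * b ⟨i, j, hj⟩ ∈ P i ^ (j + 1) := by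
      rw [← Finset.add_sum_erase _ _ (Finset.mem_univ ⟨i, j, hj⟩)] at hc
      simpa [Algebra.smul_def] using (Ideal.add_mem_iff_left _ hother).mp hc
    rw [← h.comap_eq i, Ideal.mem_comap]
    by_contra hunit
    have hnotMem := mul_notMem_pow_of_prime (h.prime i) (m := 0) (by simp) (by simpa using hunit)
      (hb.mem ⟨i, j, hj⟩) (hb.notMem ⟨i, j, hj⟩)
    rw [zero_add] at hnotMem
    exact hnotMem hterm

theorem radicalFactor_smul_mem (h : IsSplitFactorization A P e) (hb : IsAdaptedSystem P e b)
    {t : A} (ht : t ∈ maximalIdeal A) (q : Σ i, Fin (e i)) (i : ι) :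
    radicalFactor e t q • b q ∈ P i := by
  obtain hq | hq := eq_or_ne (q.2 : ℕ) 0
  · simpa [radicalFactor, hq, Algebra.smul_def] using Ideal.mul_mem_right (b q) _
      (Ideal.pow_le_self (h.pos i).ne' (h.algebraMap_mem_pow i ht))
  · obtain rfl | hi := eq_or_ne i q.1
    · simpa [radicalFactor, hq] using Ideal.pow_le_self hq (hb.mem q)
    · simpa [radicalFactor, hq] using Ideal.pow_le_self (h.pos i).ne' (hb.mem_other q i hi)

end LocalRing

section Basis

variable {A B ι : Type*} [CommRing A] [IsDomain A] [IsDiscreteValuationRing A] [CommRing B]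
  [IsDedekindDomain B] [Algebra A B] [Fintype ι] {P : ι → Ideal B} {e : ι → ℕ}
  {b : (Σ i, Fin (e i)) → B}

theorem linearIndependent [FaithfulSMul A B] (h : IsSplitFactorization A P e)
    (hb : IsAdaptedSystem P e b) : LinearIndependent A b := by
  obtain ⟨t, ht⟩ := IsDiscreteValuationRing.exists_irreducible A
  have hmem (n : ℕ) : ∀ c : (Σ i, Fin (e i)) → A, ∑ p, c p • b p = 0 →
      ∀ p, c p ∈ maximalIdeal A ^ n := by
    induction n with
    | zero => simp
    | succ n ih =>
      intro c hc
      have hdvd (p) : ∃ d, c p = t * d := by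
        have hp := h.coeff_mem_of_sum_mem_pow hb c p (hc ▸ zero_mem _)
        rwa [ht.maximalIdeal_eq, Ideal.mem_span_singleton] at hp
      choose d hd using hdvd
      have hsum : t • ∑ p, d p • b p = 0 := by
        simpa only [Finset.smul_sum, smul_smul, ← hd] using hc
      have hd0 := (smul_eq_zero.mp hsum).resolve_left ht.ne_zero
      intro p
      rw [hd, mul_comm, pow_succ]
      exact Ideal.mul_mem_mul (ih d hd0 p) ((mem_maximalIdeal t).mpr ht.not_isUnit)
  refine Fintype.linearIndependent_iff.mpr fun c hc p => ?_
  rw [← Ideal.mem_bot, ← Ideal.iInf_pow_eq_bot_of_isLocalRing _ (maximalIdeal.isMaximal A).ne_top]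
  exact (Submodule.mem_iInf _).mpr fun n => hmem n c hc p

theorem span_range_eq_top [Module.Finite A B] (h : IsSplitFactorization A P e)
    (hb : IsAdaptedSystem P e b) : Submodule.span A (Set.range b) = ⊤ := by
  classical
  refine top_le_iff.mp (Submodule.le_of_le_smul_of_le_jacobson_bot Module.Finite.fg_top
    (maximalIdeal_le_jacobson _) fun x _ => ?_)
  choose y hy using fun i =>
    exists_forall_sub_mem_pow_of_prime h.prime h.injective e (Pi.single i x)
  have hy' (i l : ι) (hl : l ≠ i) : y i ∈ P l ^ e l := by simpa [hl] using hy i l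
  have hsub : x - ∑ i, y i ∈ (maximalIdeal A).map (algebraMap A B) := by
    refine (h.mem_map_iff _).mpr fun l => ?_
    rw [← Finset.add_sum_erase _ _ (Finset.mem_univ l), ← sub_sub]
    refine sub_mem ?_ (sum_mem fun i hi => hy' i l (Finset.ne_of_mem_erase hi).symm)
    rw [← neg_mem_iff, neg_sub]
    simpa using hy l l
  rw [← sub_add_cancel x (∑ i, y i)]
  refine add_mem (Submodule.mem_sup_right ?_)
    (sum_mem fun i _ => h.mem_span_range_sup hb i (Nat.zero_le _) (by simp) (hy' i))
  rwa [Ideal.smul_top_eq_map, Submodule.restrictScalars_mem]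

variable [Module.Finite A B] [FaithfulSMul A B]

/-- The basis of `B` over `A` given by an adapted system: it reduces to a basis of `B / 𝔪_A B`
compatible with the orders at all the `P i`. -/
noncomputable def basis (h : IsSplitFactorization A P e) (hb : IsAdaptedSystem P e b) :
    Module.Basis (Σ i, Fin (e i)) A B :=
  Module.Basis.mk (h.linearIndependent hb) (h.span_range_eq_top hb).ge

@[simp]
theorem coe_basis (h : IsSplitFactorization A P e) (hb : IsAdaptedSystem P e b) :
    ⇑(h.basis hb) = b :=
  Module.Basis.coe_mk _ _

theorem repr_mem_maximalIdeal (h : IsSplitFactorization A P e) (hb : IsAdaptedSystem P e b)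
    {x : B} {p : Σ i, Fin (e i)} (hx : x ∈ P p.1 ^ (p.2 + 1 : ℕ)) :
    (h.basis hb).repr x p ∈ maximalIdeal A := by
  have hsum := (h.basis hb).sum_repr x
  rw [coe_basis] at hsum
  exact h.coeff_mem_of_sum_mem_pow hb _ p (by rwa [hsum])

theorem mem_pow_iff_mem_span_sup (h : IsSplitFactorization A P e) (hb : IsAdaptedSystem P e b)
    (i : ι) (j : ℕ) (hj : j ≤ e i) (x : B) :
    (x ∈ P i ^ j ∧ ∀ l, l ≠ i → x ∈ P l ^ e l) ↔
      x ∈ Submodule.span A (h.basis hb '' {p | p.1 = i ∧ j ≤ p.2}) ⊔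
        maximalIdeal A • (⊤ : Submodule A B) := by
  rw [mem_span_image_sup_smul_top_iff]
  constructor
  · rintro ⟨hx, hx'⟩ ⟨l, m⟩ hp
    refine h.repr_mem_maximalIdeal hb ?_
    obtain rfl | hl := eq_or_ne l i
    · exact Ideal.pow_le_pow_right (by simpa using hp) hx
    · exact Ideal.pow_le_pow_right m.2 (hx' l hl)
  · intro hx
    have hterm (l : ι) (p : Σ i, Fin (e i)) (hp : p.1 = i ∧ j ≤ p.2 → b p ∈ P l ^ e l) :
        (h.basis hb).repr x p • b p ∈ P l ^ e l := by
      by_cases hp' : p.1 = i ∧ j ≤ p.2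
      · exact Submodule.smul_of_tower_mem _ _ (hp hp')
      · rw [Algebra.smul_def]
        exact Ideal.mul_mem_right _ _ (h.algebraMap_mem_pow l (hx p hp'))
    rw [← (h.basis hb).sum_repr x, coe_basis]
    refine ⟨sum_mem fun p _ => ?_, fun l hl => sum_mem fun p _ =>
      hterm l p fun hp => hb.mem_other p l (hp.1 ▸ hl)⟩
    by_cases hp : p.1 = i ∧ j ≤ p.2
    · obtain ⟨rfl, hjp⟩ := hp
      exact Submodule.smul_of_tower_mem _ _ (Ideal.pow_le_pow_right hjp (hb.mem p))
    · exact Ideal.pow_le_pow_right hj (hterm i p fun h => absurd h hp)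

theorem trace_sub_sum_mem (h : IsSplitFactorization A P e) (x : B) (a : ι → A)
    (ha : ∀ i, x - algebraMap A B (a i) ∈ P i) :
    Algebra.trace A B x - ∑ i, e i • a i ∈ maximalIdeal A := by
  classical
  obtain ⟨b, hb⟩ := h.exists_adaptedSystem
  have hsum : ∑ i, e i • a i = ∑ p : Σ i, Fin (e i), a p.1 := by simp [Fintype.sum_sigma]
  rw [Algebra.trace_eq_matrix_trace (h.basis hb), Matrix.trace, hsum, ← Finset.sum_sub_distrib]
  refine sum_mem fun p _ => ?_
  have hdiag : (h.basis hb).repr ((x - algebraMap A B (a p.1)) * h.basis hb p) p ∈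
      maximalIdeal A := by
    refine h.repr_mem_maximalIdeal hb ?_
    rw [pow_succ', coe_basis]
    exact Ideal.mul_mem_mul (ha p.1) (hb.mem p)
  rw [Matrix.diag_apply, Algebra.leftMulMatrix_eq_repr_mul]
  simpa [sub_mul, ← Algebra.smul_def, -coe_basis] using hdiag

theorem trace_mem_maximalIdeal (h : IsSplitFactorization A P e) {x : B} (hx : ∀ i, x ∈ P i) :
    Algebra.trace A B x ∈ maximalIdeal A := by
  simpa using h.trace_sub_sum_mem x 0 (by simpa using hx)

theorem isUnit_trace (h : IsSplitFactorization A P e) {x : B} (i : ι)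
    (hi : IsUnit (e i : A)) (hx : x ∉ P i) (hx' : ∀ l, l ≠ i → x ∈ P l) :
    IsUnit (Algebra.trace A B x) := by
  classical
  obtain ⟨a, ha⟩ := h.residue i x
  have ha' : IsUnit a := by
    rw [← notMem_maximalIdeal, ← h.comap_eq i, Ideal.mem_comap]
    exact fun hm => hx (by simpa using add_mem ha hm)
  have htrace := h.trace_sub_sum_mem x (Pi.single i a) fun l => by
    obtain rfl | hl := eq_or_ne l i
    · simpa using ha
    · simpa [hl] using hx' l hl
  have hsum : ∑ l, e l • (Pi.single i a : ι → A) l = e i * a := by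
    rw [Finset.sum_eq_single i] <;> simp +contextual
  rw [hsum] at htrace
  rw [← notMem_maximalIdeal]
  exact fun hm => notMem_maximalIdeal.mpr (hi.mul ha') (by simpa using sub_mem hm htrace)

end Basis

section Discriminant

variable {A B ι : Type*} [CommRing A] [IsDomain A] [IsDiscreteValuationRing A] [CommRing B]
  [IsDedekindDomain B] [Algebra A B] [Module.Finite A B] [FaithfulSMul A B] [Fintype ι]
  {P : ι → Ideal B} {e : ι → ℕ} {b : (Σ i, Fin (e i)) → B} {t : A}

theorem exists_eq_sum_radicalFactor_smul (h : IsSplitFactorization A P e)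
    (hb : IsAdaptedSystem P e b) (ht : maximalIdeal A = Ideal.span {t}) {y : B}
    (hy : ∀ i, y ∈ P i) : ∃ g : (Σ i, Fin (e i)) → A, y = ∑ q, g q • radicalFactor e t q • b q := by
  have hdvd (q) : ∃ g, (h.basis hb).repr y q = g * radicalFactor e t q := by
    by_cases hq : (q.2 : ℕ) = 0
    · have := h.repr_mem_maximalIdeal hb (x := y) (p := q) (by simpa [hq] using hy q.1)
      rw [ht, Ideal.mem_span_singleton'] at this
      simpa [radicalFactor, hq, eq_comm] using this
    · exact ⟨_, by simp [radicalFactor, hq]; rfl⟩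
  choose g hg using hdvd
  refine ⟨g, ?_⟩
  conv_lhs => rw [← (h.basis hb).sum_repr y]
  simp only [hg, mul_smul, coe_basis]

theorem exists_trace_mul_eq (h : IsSplitFactorization A P e) (he : ∀ i, IsUnit (e i : A))
    (ht : maximalIdeal A = Ideal.span {t}) {x : B}
    (hx : x ∉ (maximalIdeal A).map (algebraMap A B)) :
    ∃ y, (∀ i, y ∈ P i) ∧ ∃ u, IsUnit u ∧ Algebra.trace A B (x * y) = t * u := by
  classical
  obtain ⟨i, hi⟩ : ∃ i, x ∉ P i ^ e i := by simpa [h.mem_map_iff] using hx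
  obtain ⟨v, hv, hxv⟩ : ∃ v, x ∈ P i ^ v ∧ x ∉ P i ^ (v + 1) := by
    simpa using Nat.exists_not_and_succ_of_not_zero_of_exists (p := fun n => x ∉ P i ^ n) (by simp)
      ⟨e i, hi⟩
  have hve : v < e i := lt_of_not_ge fun hle => hi (Ideal.pow_le_pow_right hle hv)
  obtain ⟨y, hy, hyv, hyl⟩ := exists_mem_pow_notMem_pow_succ_of_prime h.prime h.injective i
    (e i - v) (e + 1)
  have hxy : x * y ∉ P i ^ (e i + 1) := by
    simpa [Nat.add_sub_cancel' hve.le] using mul_notMem_pow_of_prime (h.prime i) hv hxv hy hyv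
  obtain ⟨z, hz, hzP⟩ := h.exists_eq_mul ht (Function.update 1 i 0) (x := x * y) fun l => by
    obtain rfl | hl := eq_or_ne l i
    · simpa [← pow_add, Nat.add_sub_cancel' hve.le] using Ideal.mul_mem_mul hv hy
    · simpa [hl] using Ideal.mul_mem_left _ x (hyl l hl)
  refine ⟨y, fun l => ?_, Algebra.trace A B z, h.isUnit_trace i (he i) (fun hzi => hxy ?_)
    fun l hl => by simpa [hl] using hzP l, ?_⟩
  · obtain rfl | hl := eq_or_ne l i
    · exact Ideal.pow_le_self (Nat.sub_ne_zero_of_lt hve) hy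
    · exact Ideal.pow_le_self (Nat.succ_ne_zero _) (hyl l hl)
  · rw [hz, pow_succ]
    exact Ideal.mul_mem_mul (h.algebraMap_mem_pow i (ht ▸ Ideal.mem_span_singleton_self t)) hzi
  · rw [hz, ← Algebra.smul_def, map_smul, smul_eq_mul]

-- Divided by `t`, the trace form becomes a perfect pairing between `B` and the radical `⋂ P i`.
theorem exists_traceMatrix_mul_eq [DecidableEq ι] (h : IsSplitFactorization A P e)
    (hb : IsAdaptedSystem P e b)
    (he : ∀ i, IsUnit (e i : A)) (ht : maximalIdeal A = Ideal.span {t}) :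
    ∃ M : Matrix (Σ i, Fin (e i)) (Σ i, Fin (e i)) A, IsUnit M.det ∧
      Algebra.traceMatrix A (h.basis hb) * Matrix.diagonal (radicalFactor e t) = t • M := by
  have htm : t ∈ maximalIdeal A := ht ▸ Ideal.mem_span_singleton_self t
  have htrace (p q) : ∃ m, Algebra.trace A B (b p * radicalFactor e t q • b q) = t * m := by
    have := h.trace_mem_maximalIdeal fun i =>
      Ideal.mul_mem_left _ (b p) (h.radicalFactor_smul_mem hb htm q i)
    rw [ht, Ideal.mem_span_singleton] at this
    exact this
  choose M hM using htrace
  refine ⟨Matrix.of M, isUnit_det_of_forall_vecMul_mem _ fun c hc p => ?_, ?_⟩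
  · by_contra hcp
    obtain ⟨y, hy, u, hu, htr⟩ := h.exists_trace_mul_eq he ht (x := ∑ p, c p • b p) fun hx =>
      hcp (h.coeff_mem_of_sum_mem_pow hb c p
        (Ideal.pow_le_pow_right p.2.2 ((h.mem_map_iff _).mp hx p.1)))
    obtain ⟨g, rfl⟩ := h.exists_eq_sum_radicalFactor_smul hb ht hy
    have hu' : t * u = t * ∑ q, g q * Matrix.vecMul c (Matrix.of M) q := by
      rw [← htr, Finset.sum_mul_sum, Finset.sum_comm]
      simp only [smul_mul_smul_comm, map_sum, map_smul, hM, smul_eq_mul, Matrix.vecMul, dotProduct,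
        Finset.mul_sum, Matrix.of_apply]
      exact Finset.sum_congr rfl fun q _ => Finset.sum_congr rfl fun p _ => by ring
    have ht0 : t ≠ 0 := by
      rintro rfl
      exact IsDiscreteValuationRing.not_a_field A (by simpa using ht)
    refine notMem_maximalIdeal.mpr hu ?_
    rw [mul_left_cancel₀ ht0 hu']
    exact sum_mem fun q _ => Ideal.mul_mem_left _ _ (hc q)
  · ext p q
    simp [Algebra.traceMatrix_apply, Algebra.traceForm_apply, Matrix.mul_diagonal, ← hM, mul_comm]

theorem discr_basis_associated [DecidableEq ι] (h : IsSplitFactorization A P e)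
    (hb : IsAdaptedSystem P e b)
    (he : ∀ i, IsUnit (e i : A)) (ht : maximalIdeal A = Ideal.span {t}) :
    Associated (Algebra.discr A (h.basis hb)) (t ^ ∑ i, (e i - 1)) := by
  obtain ⟨M, hM, hMt⟩ := h.exists_traceMatrix_mul_eq hb he ht
  have ht0 : t ≠ 0 := by
    rintro rfl
    exact IsDiscreteValuationRing.not_a_field A (by simpa using ht)
  have hprod : ∏ q, radicalFactor e t q = t ^ Fintype.card ι := by
    rw [Fintype.prod_sigma, Fintype.card, ← Finset.prod_const]
    refine Finset.prod_congr rfl fun i _ => ?_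
    rw [Finset.prod_eq_single (⟨0, h.pos i⟩ : Fin (e i))] <;>
      simp +contextual [radicalFactor, Fin.ext_iff]
  have hcard : ∑ i, e i = ∑ i, (e i - 1) + Fintype.card ι := by
    rw [Fintype.card, Finset.card_eq_sum_ones, ← Finset.sum_add_distrib]
    exact Finset.sum_congr rfl fun i _ => (Nat.sub_add_cancel (h.pos i)).symm
  have hdet := congrArg Matrix.det hMt
  rw [Matrix.det_mul, Matrix.det_diagonal, Matrix.det_smul, hprod, Fintype.card_sigma] at hdet
  simp only [Fintype.card_fin, hcard, pow_add] at hdet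
  rw [mul_right_comm] at hdet
  rw [Algebra.discr_def, mul_right_cancel₀ (pow_ne_zero _ ht0) hdet]
  exact associated_mul_unit_left _ _ hM

theorem discr_associated (h : IsSplitFactorization A P e) (he : ∀ i, IsUnit (e i : A))
    (ht : maximalIdeal A = Ideal.span {t}) {κ : Type*} [Fintype κ] [DecidableEq κ]
    (c : Module.Basis κ A B) : Associated (Algebra.discr A c) (t ^ ∑ i, (e i - 1)) := by
  classical
  obtain ⟨b, hb⟩ := h.exists_adaptedSystem
  refine Associated.trans ?_ (h.discr_basis_associated hb he ht)
  let c' := c.reindex (c.indexEquiv (h.basis hb))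
  have hc : Algebra.discr A c = Algebra.discr A c' := by
    rw [Module.Basis.coe_reindex, Algebra.discr_reindex]
  rw [hc, ← Module.Basis.toMatrix_map_vecMul (h.basis hb) c', Algebra.discr_of_matrix_vecMul,
    ← Module.Basis.det_apply]
  exact associated_unit_mul_left _ _ (((h.basis hb).isUnit_det c').pow 2)

end Discriminant

end IsSplitFactorization
/-- The normalized order function on the fraction field of a discrete valuation ring, with values in
`ℤ` and the junk value `0` at `0`. -/
noncomputable def ordZ (O : Type*) {L : Type*} [CommRing O] [IsDomain O]
    [IsDiscreteValuationRing O] [Field L] [Algebra O L] [IsFractionRing O L] (x : L) : ℤ :=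
  Multiplicative.toAdd ((Ring.ordFrac O x).unzeroD 1)

section OrdZ

variable {O L : Type*} [CommRing O] [IsDomain O] [IsDiscreteValuationRing O] [Field L]
  [Algebra O L] [IsFractionRing O L]

theorem ordZ_eq_iff {x : L} (hx : x ≠ 0) {n : ℤ} :
    ordZ O x = n ↔ Ring.ordFrac O x = Multiplicative.ofAdd n := by
  rw [ordZ, WithZero.unzeroD_eq_unzero ((map_ne_zero _).mpr hx)]
  exact WithZero.toAdd_unzero_eq_iff _ _

theorem ordFrac_eq_ordZ {x : L} (hx : x ≠ 0) :
    Ring.ordFrac O x = Multiplicative.ofAdd (ordZ O x) :=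
  (ordZ_eq_iff hx).mp rfl

theorem ordZ_mul {x y : L} (hx : x ≠ 0) (hy : y ≠ 0) :
    ordZ O (x * y) = ordZ O x + ordZ O y := by
  rw [ordZ_eq_iff (mul_ne_zero hx hy), map_mul, ordFrac_eq_ordZ hx, ordFrac_eq_ordZ hy]
  rfl

@[simp]
theorem ordZ_one : ordZ O (1 : L) = 0 := by
  rw [ordZ_eq_iff one_ne_zero, map_one]
  rfl

theorem ordZ_inv {x : L} (hx : x ≠ 0) : ordZ O x⁻¹ = -ordZ O x := by
  have h := ordZ_mul (O := O) hx (inv_ne_zero hx)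
  rw [mul_inv_cancel₀ hx, ordZ_one] at h
  exact (neg_eq_of_add_eq_zero_right h.symm).symm

theorem ordZ_pow {x : L} (hx : x ≠ 0) (n : ℕ) : ordZ O (x ^ n) = n * ordZ O x := by
  induction n with
  | zero => simp
  | succ n ih =>
    rw [pow_succ, ordZ_mul (pow_ne_zero n hx) hx, ih]
    push_cast
    ring

theorem ordZ_zpow {x : L} (hx : x ≠ 0) (n : ℤ) : ordZ O (x ^ n) = n * ordZ O x := by
  cases n with
  | ofNat n => simpa using ordZ_pow hx n
  | negSucc n =>
    rw [zpow_negSucc, ordZ_inv (pow_ne_zero _ hx), ordZ_pow hx, Int.negSucc_eq]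
    push_cast
    ring

theorem ordZ_algebraMap_of_isUnit {u : O} (hu : IsUnit u) : ordZ O (algebraMap O L u) = 0 := by
  rw [ordZ_eq_iff ((hu.map _).ne_zero), Ring.ordFrac_of_isUnit hu]
  rfl

theorem ordZ_algebraMap_of_irreducible {t : O} (ht : Irreducible t) :
    ordZ O (algebraMap O L t) = 1 := by
  rw [ordZ_eq_iff (by simpa using ht.ne_zero), Ring.ordFrac_irreducible ht]
  rfl

theorem exists_eq_mul_zpow_ordZ {t : O} (ht : Irreducible t) {x : L} (hx : x ≠ 0) :
    ∃ u : Oˣ, x = algebraMap O L u * algebraMap O L t ^ ordZ O x := by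
  have ht' : algebraMap O L t ≠ 0 := by simpa using ht.ne_zero
  obtain ⟨n, u, rfl⟩ := IsDiscreteValuationRing.exists_units_eq_smul_zpow_of_irreducible ht hx
  refine ⟨u, ?_⟩
  rw [Units.smul_def, Algebra.smul_def, ordZ_mul (u.isUnit.map _).ne_zero (zpow_ne_zero _ ht'),
    ordZ_algebraMap_of_isUnit u.isUnit, ordZ_zpow ht', ordZ_algebraMap_of_irreducible ht, zero_add,
    mul_one]

theorem ordZ_algebraMap_of_associated {x t : O} (ht : Irreducible t) {n : ℕ}
    (h : Associated x (t ^ n)) : ordZ O (algebraMap O L x) = n := by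
  obtain ⟨u, rfl⟩ := h.symm
  have ht' : algebraMap O L t ≠ 0 := by simpa using ht.ne_zero
  rw [map_mul, map_pow, ordZ_mul (pow_ne_zero n ht') (u.isUnit.map _).ne_zero,
    ordZ_algebraMap_of_isUnit u.isUnit, ordZ_pow ht', ordZ_algebraMap_of_irreducible ht, mul_one,
    add_zero]

theorem natCast_le_ordZ_iff {x : L} (hx : x ≠ 0) {n : ℕ} :
    (n : ℤ) ≤ ordZ O x ↔ ∃ o ∈ maximalIdeal O ^ n, algebraMap O L o = x := by
  obtain ⟨t, ht⟩ := IsDiscreteValuationRing.exists_irreducible O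
  simp only [ht.maximalIdeal_eq, Ideal.span_singleton_pow, Ideal.mem_span_singleton]
  constructor
  · intro h
    obtain ⟨u, hu⟩ := exists_eq_mul_zpow_ordZ ht hx
    obtain ⟨m, hm⟩ := Int.eq_ofNat_of_zero_le ((Int.natCast_nonneg n).trans h)
    rw [hm] at hu h
    exact ⟨u * t ^ m, (pow_dvd_pow t (Int.ofNat_le.mp h)).mul_left _, by simp [hu]⟩
  · rintro ⟨o, ho, rfl⟩
    have ho0 : o ≠ 0 := by
      rintro rfl
      simp at hx
    obtain ⟨m, hm⟩ := IsDiscreteValuationRing.associated_pow_irreducible ho0 ht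
    rw [ordZ_algebraMap_of_associated ht hm, Nat.cast_le]
    exact (pow_dvd_pow_iff ht.ne_zero ht.not_isUnit).mp (ho.trans hm.dvd)

theorem ordZ_nonneg_iff {x : L} (hx : x ≠ 0) : 0 ≤ ordZ O x ↔ ∃ o, algebraMap O L o = x := by
  simpa using natCast_le_ordZ_iff (O := O) hx (n := 0)

theorem ordZ_eq_zero_iff {x : L} (hx : x ≠ 0) :
    ordZ O x = 0 ↔ ∃ o, IsUnit o ∧ algebraMap O L o = x := by
  refine ⟨fun h => ?_, fun ⟨o, ho, h⟩ => h ▸ ordZ_algebraMap_of_isUnit ho⟩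
  obtain ⟨t, ht⟩ := IsDiscreteValuationRing.exists_irreducible O
  obtain ⟨u, hu⟩ := exists_eq_mul_zpow_ordZ ht hx
  exact ⟨u, u.isUnit, by simpa [h] using hu.symm⟩

end OrdZ
/-- The ramification index of a local ring `O` over a local ring `A`, both mapping to `L`: the
largest `n` such that `𝔪_A` maps into `𝔪_O ^ n`. It is formulated inside `L` so that no map `A → O`
has to be chosen; the junk value is `0` when no largest `n` exists. -/
noncomputable def ramIdx (A O L : Type*) [CommRing A] [IsLocalRing A] [CommRing O] [IsLocalRing O]
    [CommRing L] [Algebra A L] [Algebra O L] : ℕ :=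
  sSup {n | ∀ a ∈ maximalIdeal A, ∃ o ∈ maximalIdeal O ^ n, algebraMap O L o = algebraMap A L a}

/-- The places of `L` over `A`: `O` lists, up to isomorphism and without repetition, the local rings
with image in `L` that dominate `A`, and every valuation ring of `L` dominating `A` occurs. -/
structure IsPlaceFamily (A L : Type*) [CommRing A] [IsLocalRing A] [Field L] [Algebra A L]
    {ι : Type*} (O : ι → Type*) [∀ i, CommRing (O i)] [∀ i, IsLocalRing (O i)]
    [∀ i, Algebra (O i) L] : Prop where
  dominates : ∀ i, ∃ g : A →+* O i, IsLocalHom g ∧ ∀ a, algebraMap (O i) L (g a) = algebraMap A L a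
  exhaustive : ∀ R : ValuationSubring L, (∀ a, algebraMap A L a ∈ R) →
    (∀ a ∈ maximalIdeal A, a ≠ 0 → (algebraMap A L a)⁻¹ ∉ R) →
    ∃ i, ∀ x, x ∈ R ↔ x ∈ (algebraMap (O i) L).range
  injective : ∀ i j, (algebraMap (O i) L).range = (algebraMap (O j) L).range → i = j

theorem exists_sub_mem_of_isAlgClosed {A B : Type*} [CommRing A] [IsLocalRing A]
    [IsAlgClosed (ResidueField A)] [CommRing B] [Algebra A B] [Algebra.IsIntegral A B]
    (P : Ideal B) [P.IsPrime] (hP : P.comap (algebraMap A B) = maximalIdeal A) (b : B) :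
    ∃ a, b - algebraMap A B a ∈ P := by
  let φ : ResidueField A →+* B ⧸ P := Ideal.quotientMap P (algebraMap A B) hP.ge
  have hφ : φ.IsIntegral := by
    refine RingHom.IsIntegral.tower_top (residue A) φ ?_
    change ((Ideal.Quotient.mk P).comp (algebraMap A B)).IsIntegral
    exact RingHom.IsIntegral.trans _ _ (algebraMap_isIntegral_iff.mpr inferInstance)
      (RingHom.IsIntegral.of_finite (RingHom.Finite.of_surjective _ Ideal.Quotient.mk_surjective))
  obtain ⟨r, hr⟩ := (IsAlgClosed.ringHom_bijective_of_isIntegral φ hφ).2 (Ideal.Quotient.mk _ b)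
  obtain ⟨a, rfl⟩ := IsLocalRing.residue_surjective r
  exact ⟨a, Ideal.Quotient.eq.mp hr.symm⟩

namespace IsPlaceFamily

open IsDedekindDomain

variable {A L : Type*} [CommRing A] [Field L] [Algebra A L] {ι : Type*} {O : ι → Type*}
  [∀ i, CommRing (O i)] [∀ i, IsDomain (O i)] [∀ i, IsDiscreteValuationRing (O i)]
  [∀ i, Algebra (O i) L] [∀ i, IsFractionRing (O i) L]

section Center

variable [IsLocalRing A]

theorem exists_of_isIntegral (h : IsPlaceFamily A L O) (i : ι) {x : L} (hx : IsIntegral A x) :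
    ∃ o, algebraMap (O i) L o = x := by
  obtain ⟨g, _, hg⟩ := h.dominates i
  let := g.toAlgebra
  have : IsScalarTower A (O i) L := .of_algebraMap_eq fun a => (hg a).symm
  exact IsIntegrallyClosed.isIntegral_iff.mp (hx.tower_top (A := O i))

/-- The embedding of the integral closure of `A` into the ring of a place, which exists because that
ring is integrally closed. -/
noncomputable def placeMap (h : IsPlaceFamily A L O) (i : ι) : integralClosure A L →+* O i :=
  (RingEquiv.ofLeftInverse
    (Function.leftInverse_invFun (IsFractionRing.injective (O i) L))).symm.toRingHom.comp
    ((integralClosure A L).val.toRingHom.codRestrict (algebraMap (O i) L).range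
      fun b => h.exists_of_isIntegral i b.2)

@[simp]
theorem algebraMap_placeMap (h : IsPlaceFamily A L O) (i : ι) (b : integralClosure A L) :
    algebraMap (O i) L (h.placeMap i b) = b :=
  Function.invFun_eq (h.exists_of_isIntegral i b.2)

theorem placeMap_eq_iff (h : IsPlaceFamily A L O) {i : ι} {b : integralClosure A L} {o : O i} :
    h.placeMap i b = o ↔ (b : L) = algebraMap (O i) L o := by
  rw [← (IsFractionRing.injective (O i) L).eq_iff, algebraMap_placeMap]

theorem placeMap_injective (h : IsPlaceFamily A L O) (i : ι) :
    Function.Injective (h.placeMap i) := fun x y hxy =>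
  Subtype.ext <| by rw [← h.algebraMap_placeMap i, hxy, algebraMap_placeMap]

/-- The centre of a place on the integral closure of `A`: the prime ideal of the elements vanishing
at that place. -/
noncomputable def center (h : IsPlaceFamily A L O) (i : ι) : Ideal (integralClosure A L) :=
  (maximalIdeal (O i)).comap (h.placeMap i)

theorem mem_center_iff (h : IsPlaceFamily A L O) {i : ι} {b : integralClosure A L} :
    b ∈ h.center i ↔ h.placeMap i b ∈ maximalIdeal (O i) :=
  Iff.rfl

theorem notMem_center_iff (h : IsPlaceFamily A L O) {i : ι} {b : integralClosure A L} :
    b ∉ h.center i ↔ IsUnit (h.placeMap i b) :=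
  notMem_maximalIdeal

instance center_isPrime (h : IsPlaceFamily A L O) (i : ι) : (h.center i).IsPrime :=
  Ideal.comap_isPrime _ _

theorem comap_center (h : IsPlaceFamily A L O) (i : ι) :
    (h.center i).comap (algebraMap A (integralClosure A L)) = maximalIdeal A := by
  ext a
  obtain ⟨g, _, hg⟩ := h.dominates i
  have hga : h.placeMap i (algebraMap A _ a) = g a := h.placeMap_eq_iff.mpr (hg a).symm
  rw [Ideal.mem_comap, mem_center_iff, hga, mem_maximalIdeal, mem_maximalIdeal, mem_nonunits_iff,
    mem_nonunits_iff, isUnit_map_iff]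

theorem ordZ_algebraMap_eq_ramIdx (h : IsPlaceFamily A L O) (i : ι) {t : A}
    (ht : maximalIdeal A = Ideal.span {t}) (ht0 : algebraMap A L t ≠ 0) :
    ordZ (O i) (algebraMap A L t) = ramIdx A (O i) L := by
  obtain ⟨g, -, hg⟩ := h.dominates i
  have hmem (n : ℕ) : (∀ a ∈ maximalIdeal A, ∃ o ∈ maximalIdeal (O i) ^ n,
      algebraMap (O i) L o = algebraMap A L a) ↔ (n : ℤ) ≤ ordZ (O i) (algebraMap A L t) := by
    rw [natCast_le_ordZ_iff ht0, ht]
    refine ⟨fun H => H t (Ideal.mem_span_singleton_self t), fun ⟨o, ho, hot⟩ a ha => ?_⟩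
    obtain ⟨c, rfl⟩ := Ideal.mem_span_singleton.mp ha
    exact ⟨o * g c, Ideal.mul_mem_right _ _ ho, by rw [map_mul, map_mul, hot, hg]⟩
  have hnonneg : 0 ≤ ordZ (O i) (algebraMap A L t) :=
    (ordZ_nonneg_iff ht0).mpr ⟨g t, hg t⟩
  obtain ⟨m, hm⟩ := Int.eq_ofNat_of_zero_le hnonneg
  simp only [hm, Int.ofNat_le] at hmem
  rw [ramIdx, hm, show {n : ℕ | _} = Set.Iic m from Set.ext hmem, csSup_Iic]

end Center

section Dedekind

variable [IsDomain A] [IsDiscreteValuationRing A] [FaithfulSMul A L]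

theorem center_ne_bot (h : IsPlaceFamily A L O) (i : ι) : h.center i ≠ ⊥ := by
  have : FaithfulSMul A (integralClosure A L) := FaithfulSMul.tower_bot A _ L
  intro h0
  apply IsDiscreteValuationRing.not_a_field A
  rw [← h.comap_center i, h0]
  exact Ideal.comap_bot_of_injective _ (FaithfulSMul.algebraMap_injective A _)

theorem isMaximal_center (h : IsPlaceFamily A L O) (i : ι) : (h.center i).IsMaximal :=
  (h.center_isPrime i).isMaximal (h.center_ne_bot i)

variable [IsDedekindDomain (integralClosure A L)]

theorem prime_center (h : IsPlaceFamily A L O) (i : ι) : Prime (h.center i) :=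
  Ideal.prime_of_isPrime (h.center_ne_bot i) (h.center_isPrime i)

variable [IsFractionRing (integralClosure A L) L]

theorem exists_mul_eq (h : IsPlaceFamily A L O) (i : ι) (o : O i) :
    ∃ a s : integralClosure A L, s ∉ h.center i ∧ o * h.placeMap i s = h.placeMap i a := by
  let v : HeightOneSpectrum (integralClosure A L) := ⟨h.center i, inferInstance, h.center_ne_bot i⟩
  obtain ⟨n, ⟨d, hd⟩, hnd⟩ := v.exists_primeCompl_mul_eq_or_mul_eq (algebraMap (O i) L o)
  have e : ∀ b, algebraMap (integralClosure A L) L b = algebraMap (O i) L (h.placeMap i b) :=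
    fun b => (h.algebraMap_placeMap i b).symm
  simp only [e, ← map_mul] at hnd
  rcases hnd with hnd | hnd
  · exact ⟨n, d, hd, IsFractionRing.injective _ L hnd⟩
  · refine ⟨d, n, fun hn => hd ?_, IsFractionRing.injective _ L hnd⟩
    rw [SetLike.mem_coe, mem_center_iff, ← IsFractionRing.injective _ L hnd]
    exact Ideal.mul_mem_left _ _ hn

theorem mem_center_pow_iff (h : IsPlaceFamily A L O) (i : ι) (n : ℕ) (b : integralClosure A L) :
    b ∈ h.center i ^ n ↔ h.placeMap i b ∈ maximalIdeal (O i) ^ n := by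
  refine ⟨fun hb => Ideal.le_comap_pow (h.placeMap i) n hb, fun hb => ?_⟩
  obtain ⟨t, ht⟩ := IsDiscreteValuationRing.exists_irreducible (O i)
  rw [ht.maximalIdeal_eq, Ideal.span_singleton_pow, Ideal.mem_span_singleton] at hb
  obtain ⟨c, hc⟩ := hb
  obtain ⟨a, s, hs, has⟩ := h.exists_mul_eq i t
  obtain ⟨a', s', hs', has'⟩ := h.exists_mul_eq i c
  have ha : a ∈ h.center i := by
    rw [mem_center_iff, ← has]
    exact Ideal.mul_mem_right _ _ ((mem_maximalIdeal _).mpr ht.not_isUnit)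
  have hmul : (s ^ n * s') * b = a ^ n * a' := by
    apply h.placeMap_injective i
    simp only [map_mul, map_pow, hc, ← has, ← has']
    ring
  have hss' : s ^ n * s' ∉ h.center i :=
    (h.center_isPrime i).mul_notMem (fun hm => hs ((h.center_isPrime i).mem_of_pow_mem n hm)) hs'
  rw [← Ideal.dvd_span_singleton]
  refine (h.prime_center i).pow_dvd_of_dvd_mul_left n
    (fun hd => hss' (Ideal.dvd_span_singleton.mp hd)) ?_
  rw [Ideal.span_singleton_mul_span_singleton, hmul, Ideal.dvd_span_singleton]
  exact Ideal.mul_mem_right _ _ (Ideal.pow_mem_pow ha n)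

theorem center_injective (h : IsPlaceFamily A L O) : Function.Injective h.center := by
  suffices key : ∀ i j, h.center i = h.center j →
      (algebraMap (O i) L).range ≤ (algebraMap (O j) L).range from
    fun i j hij => h.injective i j (le_antisymm (key i j hij) (key j i hij.symm))
  rintro i j hij _ ⟨o, rfl⟩
  obtain ⟨a, s, hs, has⟩ := h.exists_mul_eq i o
  obtain ⟨u, hu⟩ := h.notMem_center_iff.mp (hij ▸ hs)
  have hs0 : (s : L) ≠ 0 := by
    rw [← h.algebraMap_placeMap j, ← hu]
    exact (u.isUnit.map _).ne_zero
  refine ⟨h.placeMap j a * ↑u⁻¹, mul_right_cancel₀ hs0 ?_⟩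
  calc algebraMap (O j) L (h.placeMap j a * ↑u⁻¹) * s
      = algebraMap (O j) L (h.placeMap j a * ↑u⁻¹ * u) := by
        rw [map_mul _ _ (u : O j), hu, algebraMap_placeMap]
    _ = algebraMap (O i) L (h.placeMap i a) := by simp
    _ = algebraMap (O i) L o * s := by rw [← has, map_mul, algebraMap_placeMap]

theorem exists_center_eq (h : IsPlaceFamily A L O) (Q : Ideal (integralClosure A L))
    (hQ : Q.IsPrime) (hQ0 : Q ≠ ⊥) : ∃ i, h.center i = Q := by
  have : FaithfulSMul A (integralClosure A L) := FaithfulSMul.tower_bot A _ L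
  let v : HeightOneSpectrum (integralClosure A L) := ⟨Q, hQ, hQ0⟩
  have mem_iff (b : integralClosure A L) (hb : b ≠ 0) :
      b ∈ Q ↔ (b : L)⁻¹ ∉ (v.valuation L).valuationSubring := by
    have hbL : v.valuation L (b : L) ≠ 0 := by simpa using hb
    rw [Valuation.mem_valuationSubring_iff, map_inv₀, inv_le_one₀ (zero_lt_iff.mpr hbL), not_le]
    exact (v.valuation_lt_one_iff_mem (K := L) b).symm
  have : Q.IsMaximal := hQ.isMaximal hQ0
  have hQA : Q.comap (algebraMap A (integralClosure A L)) = maximalIdeal A :=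
    eq_maximalIdeal (Ideal.isMaximal_comap_of_isIntegral_of_isMaximal Q)
  obtain ⟨i, hi⟩ := h.exhaustive (v.valuation L).valuationSubring
    (fun a => v.valuation_le_one (algebraMap A (integralClosure A L) a))
    fun a ha ha0 => (mem_iff (algebraMap A _ a)
      (by rwa [Ne, FaithfulSMul.algebraMap_eq_zero_iff])).mp (by rwa [← hQA] at ha)
  refine ⟨i, ?_⟩
  ext b
  obtain rfl | hb := eq_or_ne b 0
  · simp
  have hbL : (b : L) ≠ 0 := by simpa using hb
  rw [mem_iff b hb, hi, ← not_iff_not, not_not, notMem_center_iff, isUnit_iff_exists_inv]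
  refine exists_congr fun o => ?_
  rw [← (IsFractionRing.injective (O i) L).eq_iff, map_mul, algebraMap_placeMap, map_one,
    mul_comm, mul_eq_one_iff_eq_inv₀ hbL]

theorem finite (h : IsPlaceFamily A L O) : Finite ι := by
  have : FaithfulSMul A (integralClosure A L) := FaithfulSMul.tower_bot A _ L
  refine Set.finite_univ_iff.mp (Set.Finite.of_finite_image
    ((IsDedekindDomain.primesOver_finite (maximalIdeal A) (integralClosure A L)).subset ?_)
    h.center_injective.injOn)
  rintro _ ⟨i, -, rfl⟩
  exact ⟨inferInstance, ⟨(h.comap_center i).symm⟩⟩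

theorem exists_eq_prod [Fintype ι] (h : IsPlaceFamily A L O) (I : Ideal (integralClosure A L))
    (hI : I ≠ ⊥) : ∃ n : ι → ℕ, I = ∏ i, h.center i ^ n i := by
  classical
  induction I using UniqueFactorizationMonoid.induction_on_prime with
  | h₁ => exact absurd rfl hI
  | h₂ I hu => exact ⟨0, by simp [Ideal.isUnit_iff.mp hu, ← Ideal.one_eq_top]⟩
  | h₃ I p hI0 hp ih =>
    obtain ⟨n, hn⟩ := ih hI0
    obtain ⟨i, rfl⟩ := h.exists_center_eq p (Ideal.isPrime_of_prime hp) hp.ne_zero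
    refine ⟨n + Pi.single i 1, ?_⟩
    simp only [Pi.add_apply, pow_add, Finset.prod_mul_distrib, ← hn, Pi.single_apply, pow_ite,
      pow_one, pow_zero, Finset.prod_ite_eq', Finset.mem_univ, if_true, mul_comm]

theorem le_center_pow_iff [Fintype ι] (h : IsPlaceFamily A L O) (n : ι → ℕ) (i : ι) (m : ℕ) :
    ∏ l, h.center l ^ n l ≤ h.center i ^ m ↔ m ≤ n i := by
  classical
  rw [← Ideal.dvd_iff_le, ← Finset.mul_prod_erase _ _ (Finset.mem_univ i)]
  refine ⟨fun hdvd => ?_, fun hm => (pow_dvd_pow _ hm).mul_right _⟩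
  have hi : ¬ h.center i ∣ ∏ l ∈ Finset.univ.erase i, h.center l ^ n l := by
    rw [(h.prime_center i).dvd_finsetProd_iff]
    rintro ⟨l, hl, hd⟩
    refine Finset.ne_of_mem_erase hl (h.center_injective ((h.isMaximal_center l).eq_of_le
      (h.center_isPrime i).ne_top ?_))
    exact Ideal.dvd_iff_le.mp ((h.prime_center i).dvd_of_dvd_pow hd)
  exact (pow_dvd_pow_iff (h.prime_center i).ne_zero (h.prime_center i).not_isUnit).mp
    ((h.prime_center i).pow_dvd_of_dvd_mul_right m hi hdvd)

theorem isSplitFactorization [Fintype ι] [IsAlgClosed (ResidueField A)]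
    (h : IsPlaceFamily A L O) :
    IsSplitFactorization A h.center fun i => ramIdx A (O i) L := by
  have : FaithfulSMul A (integralClosure A L) := FaithfulSMul.tower_bot A _ L
  obtain ⟨n, hn⟩ := h.exists_eq_prod
    ((maximalIdeal A).map (algebraMap A (integralClosure A L))) (by
      rw [Ne, Ideal.map_eq_bot_iff_of_injective (FaithfulSMul.algebraMap_injective A _)]
      exact IsDiscreteValuationRing.not_a_field A)
  have key (i : ι) (m : ℕ) : (∀ a ∈ maximalIdeal A, ∃ o ∈ maximalIdeal (O i) ^ m,
      algebraMap (O i) L o = algebraMap A L a) ↔ m ≤ n i := by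
    rw [← h.le_center_pow_iff, ← hn, Ideal.map_le_iff_le_comap]
    refine forall₂_congr fun a ha => ?_
    rw [Ideal.mem_comap, h.mem_center_pow_iff]
    refine ⟨?_, fun ha => ⟨_, ha, h.algebraMap_placeMap i _⟩⟩
    rintro ⟨o, ho, hoa⟩
    rwa [h.placeMap_eq_iff.mpr hoa.symm]
  have hram (i : ι) : ramIdx A (O i) L = n i := by
    rw [ramIdx]
    simp_rw [key]
    exact (isLUB_Iic (a := n i)).csSup_eq ⟨n i, Set.mem_Iic.mpr le_rfl⟩
  exact
    { prime := h.prime_center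
      injective := h.center_injective
      pos i := by
        rw [hram, Nat.pos_iff_ne_zero, ← Nat.one_le_iff_ne_zero, ← h.le_center_pow_iff, ← hn,
          pow_one, Ideal.map_le_iff_le_comap, comap_center]
      map_eq := by simpa only [hram] using hn
      residue i b := exists_sub_mem_of_isAlgClosed _ (h.comap_center i) b }

theorem mem_integralClosure_iff (h : IsPlaceFamily A L O) (x : L) :
    x ∈ integralClosure A L ↔ ∀ i, ∃ o, algebraMap (O i) L o = x := by
  refine ⟨fun hx i => h.exists_of_isIntegral i hx, fun hx => ?_⟩
  obtain ⟨b, rfl⟩ := HeightOneSpectrum.mem_integers_of_valuation_le_one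
    (R := integralClosure A L) L x fun v => by
    obtain ⟨i, hi⟩ := h.exists_center_eq v.asIdeal v.isPrime v.ne_bot
    obtain ⟨o, rfl⟩ := hx i
    obtain ⟨a, s, hs, has⟩ := h.exists_mul_eq i o
    have hs1 : v.valuation L (s : L) = 1 := v.valuation_eq_one_iff_notMem.mpr (hi ▸ hs)
    have hos : algebraMap (O i) L o * s = a := by
      rw [← h.algebraMap_placeMap i, ← map_mul, has, algebraMap_placeMap]
    calc v.valuation L (algebraMap (O i) L o)
        = v.valuation L (algebraMap (O i) L o * s) := by rw [map_mul, hs1, mul_one]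
      _ = v.valuation L (a : L) := by rw [hos]
      _ ≤ 1 := v.valuation_le_one a
  exact b.2

section FractionField

variable {K : Type*} [Field K] [Algebra A K] [IsFractionRing A K] [Algebra K L]
  [IsScalarTower A K L] [FiniteDimensional K L] [Module.Finite A (integralClosure A L)]
  [IsAlgClosed (ResidueField A)]

theorem ordZ_discr [Fintype ι] (h : IsPlaceFamily A L O)
    (he : ∀ i, IsUnit (ramIdx A (O i) L : A)) {κ : Type*} [Fintype κ] [DecidableEq κ]
    (c : Module.Basis κ A (integralClosure A L)) :
    ordZ A (Algebra.discr K fun p => (c p : L)) = ∑ i, ((ramIdx A (O i) L - 1 : ℕ) : ℤ) := by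
  have := IsIntegralClosure.isLocalization A K L (integralClosure A L)
  obtain ⟨t, ht⟩ := IsDiscreteValuationRing.exists_irreducible A
  have hord := ordZ_algebraMap_of_associated (L := K) ht
    (h.isSplitFactorization.discr_associated he ht.maximalIdeal_eq c)
  rw [← Algebra.discr_localizationLocalization A (nonZeroDivisors A) L c] at hord
  rw [← Nat.cast_sum, ← hord]
  congr 2
  ext p
  simp

theorem finrank_eq_sum_ramIdx [Fintype ι] (h : IsPlaceFamily A L O) :
    Module.finrank K L = ∑ i, ramIdx A (O i) L := by
  have := IsIntegralClosure.isLocalization A K L (integralClosure A L)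
  obtain ⟨b, hb⟩ := h.isSplitFactorization.exists_adaptedSystem
  rw [Module.finrank_eq_card_basis
    ((h.isSplitFactorization.basis hb).localizationLocalization K (nonZeroDivisors A) L)]
  simp

theorem sum_ordZ_algebraMap [Fintype ι] (h : IsPlaceFamily A L O) {t : A} (ht : Irreducible t) :
    ∑ i, ordZ (O i) (algebraMap A L t) = Module.finrank K L := by
  have ht0 : algebraMap A L t ≠ 0 :=
    (map_ne_zero_iff _ (FaithfulSMul.algebraMap_injective A L)).mpr ht.ne_zero
  rw [h.finrank_eq_sum_ramIdx (K := K), Nat.cast_sum]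
  exact Finset.sum_congr rfl fun i _ => h.ordZ_algebraMap_eq_ramIdx i ht.maximalIdeal_eq ht0

end FractionField

end Dedekind

end IsPlaceFamily

section Etale

open Polynomial Algebra

section PrincipalIdealRing

variable (R : Type*) {S : Type*} [CommRing R] [IsDomain R] [IsPrincipalIdealRing R] [CommRing S]
  [IsDomain S] [Algebra R S] [Algebra.Etale R S]

include R in
theorem isDiscreteValuationRing_localization_of_etale (q : Ideal S) [q.IsPrime] (hq : q ≠ ⊥)
    (T : Type*) [CommRing T] [Algebra S T] [IsLocalization.AtPrime T q] [IsDomain T] :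
    IsDiscreteValuationRing T := by
  have : IsNoetherianRing S := FiniteType.isNoetherianRing R S
  have : IsNoetherianRing (Localization.AtPrime q) :=
    IsLocalization.isNoetherianRing q.primeCompl _ inferInstance
  let := Localization.AtPrime.algebraOfLiesOver (q.under R) q
  have hunramified : IsUnramifiedAt R q := by
    have : FormallyUnramified S (Localization.AtPrime q) :=
      FormallyUnramified.of_isLocalization q.primeCompl
    exact FormallyUnramified.comp R S _
  have hprincipal : (maximalIdeal (Localization.AtPrime q)).IsPrincipal := by
    rw [← ((isUnramifiedAt_iff_map_eq R (q.under R) q).mp hunramified).2]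
    infer_instance
  have : IsDiscreteValuationRing (Localization.AtPrime q) :=
    ((IsDiscreteValuationRing.TFAE _
      (IsLocalization.AtPrime.not_isField S hq (Localization.AtPrime q))).out 4 0).mp hprincipal
  exact IsDiscreteValuationRing.RingEquivClass.isDiscreteValuationRing
    (IsLocalization.algEquiv q.primeCompl (Localization.AtPrime q) T)

include R in
theorem isMaximal_of_ne_bot_of_etale (q : Ideal S) [q.IsPrime] (hq : q ≠ ⊥) : q.IsMaximal := by
  obtain ⟨m, hm, hqm⟩ := Ideal.exists_le_maximal q (Ideal.IsPrime.ne_top ‹_›)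
  have : IsDiscreteValuationRing (Localization.AtPrime m) :=
    isDiscreteValuationRing_localization_of_etale R m (fun h => hq (le_bot_iff.mp (h ▸ hqm))) _
  have hdisj : Disjoint (m.primeCompl : Set S) q :=
    Set.disjoint_left.mpr fun x hx hxq => hx (hqm hxq)
  have hprime := IsLocalization.isPrime_of_isPrime_disjoint m.primeCompl
    (Localization.AtPrime m) q inferInstance hdisj
  have hne : q.map (algebraMap S (Localization.AtPrime m)) ≠ ⊥ := by
    rwa [Ne, Ideal.map_eq_bot_iff_of_injective
      (IsLocalization.injective _ m.primeCompl_le_nonZeroDivisors)]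
  rw [← IsLocalization.under_map_of_isPrime_disjoint m.primeCompl (Localization.AtPrime m)
    (I := q) inferInstance hdisj, eq_maximalIdeal (hprime.isMaximal hne),
    IsLocalization.AtPrime.under_maximalIdeal (Localization.AtPrime m) m]
  exact hm

end PrincipalIdealRing

theorem not_isField_of_etale_polynomial (k S : Type*) [Field k] [CommRing S] [IsDomain S]
    [Algebra k[X] S] [Algebra.Etale k[X] S] : ¬ IsField S := by
  intro hS
  let := hS.toField
  algebraize [(algebraMap k[X] S).comp C]
  have : IsScalarTower k k[X] S := .of_algebraMap_eq fun _ => rfl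
  have : Algebra.FiniteType k S := Algebra.FiniteType.trans (S := k[X]) inferInstance inferInstance
  have : Module.Finite k S := finite_of_finite_type_of_isJacobsonRing k S
  obtain ⟨p, hp, hpX⟩ : IsIntegral k (algebraMap k[X] S X) := Algebra.IsIntegral.isIntegral _
  have hp0 : algebraMap k[X] S (eval₂ C X p) = 0 := by
    rw [hom_eval₂, ← hpX]
    rfl
  rw [FaithfulSMul.algebraMap_eq_zero_iff, eval₂_C_X] at hp0
  exact hp.ne_zero hp0

section FractionField

variable (R S F L : Type*) [CommRing R] [CommRing S] [Algebra R S] [Algebra.Etale R S] [Field F]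
  [Field L] [Algebra R F] [Algebra S L] [IsFractionRing S L] [Algebra F L] [Algebra R L]
  [IsScalarTower R F L] [IsScalarTower R S L]

include R S in
theorem finiteDimensional_isSeparable_of_etale :
    FiniteDimensional F L ∧ Algebra.IsSeparable F L := by
  have : FormallyUnramified S L := FormallyUnramified.of_isLocalization (nonZeroDivisors S)
  have : FormallyUnramified R L := FormallyUnramified.comp R S L
  have : FormallyUnramified F L := FormallyUnramified.of_restrictScalars R F L
  have : EssFiniteType S L := EssFiniteType.of_isLocalization L (nonZeroDivisors S)
  have : EssFiniteType R L := EssFiniteType.comp R S L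
  have : EssFiniteType F L := EssFiniteType.of_comp R F L
  exact ⟨FormallyUnramified.finite_of_free F L, FormallyUnramified.isSeparable F L⟩

end FractionField

theorem exists_etale_polynomial_of_isStandardSmoothOfRelativeDimension_one {R S : Type*}
    [CommRing R] [CommRing S] {f : R →+* S} (hf : f.IsStandardSmoothOfRelativeDimension 1) :
    ∃ g : R[X] →+* S, g.comp C = f ∧ g.Etale := by
  obtain ⟨g, hg, hg'⟩ := hf.exists_etale_mvPolynomial
  let e := (MvPolynomial.uniqueAlgEquiv R (Fin 1)).symm
  have hetale : (g.comp e.toRingEquiv.toRingHom).Etale := by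
    have he : e.toRingEquiv.toRingHom.Etale := RingHom.Etale.of_bijective e.bijective
    algebraize [g, e.toRingEquiv.toRingHom, g.comp e.toRingEquiv.toRingHom]
    exact RingHom.etale_algebraMap.mpr (Algebra.Etale.comp R[X] (MvPolynomial (Fin 1) R) S)
  refine ⟨_, ?_, hetale⟩
  rw [← hg]
  ext a
  simp [e, MvPolynomial.uniqueAlgEquiv]

theorem isSeparable_of_formallySmooth (K L : Type*) [Field K] [Field L] [Algebra K L]
    [FiniteDimensional K L] [FormallySmooth K L] : Algebra.IsSeparable K L := by
  have : FinitePresentation K L := FinitePresentation.of_finiteType.mp inferInstance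
  obtain ⟨B, hBD, hspan, hB⟩ := exists_linearIndependent L (Set.range (KaehlerDifferential.D K L))
  rw [KaehlerDifferential.span_range_derivation] at hspan
  have : IsStandardSmooth K L := .of_basis_kaehlerDifferential
    (.mk hB (by rw [Subtype.range_coe, hspan])) (by rwa [Module.Basis.coe_mk, Subtype.range_coe])
  obtain ⟨n, g, hgC, hg⟩ :=
    ((RingHom.isStandardSmooth_algebraMap (R := K) (S := L)).mpr this).exists_etale_mvPolynomial
  algebraize [g]
  have : IsScalarTower K (MvPolynomial (Fin n) K) L := .of_algebraMap_eq fun a => congr($hgC.symm a)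
  have : IsEmpty (Fin n) := ⟨fun i => MvPolynomial.transcendental_X K i
    ((isAlgebraic_algebraMap_iff (FaithfulSMul.algebraMap_injective _ L)).mp
      (Algebra.IsAlgebraic.isAlgebraic _))⟩
  have : FormallyUnramified K (MvPolynomial (Fin n) K) :=
    .of_surjective (Algebra.ofId _ _) (MvPolynomial.C_surjective (Fin n))
  have : FormallyUnramified K L := .comp K (MvPolynomial (Fin n) K) L
  exact FormallyUnramified.isSeparable K L

end Etale

theorem primeIdealOf_eq_bot_iff {X : Scheme.{u}} [IsIntegral X] {U : X.Opens} (hU : IsAffineOpen U)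
    (x : U) : (hU.primeIdealOf x).asIdeal = ⊥ ↔ (x : X) = genericPoint X := by
  have : Nonempty U := ⟨x⟩
  have hgeneric : (hU.primeIdealOf ⟨genericPoint X,
      ((genericPoint_spec X).mem_open_set_iff U.isOpen).mpr ⟨x, trivial, x.2⟩⟩).asIdeal = ⊥ := by
    rw [hU.primeIdealOf_genericPoint, genericPoint_eq_bot_of_affine]
    rfl
  constructor
  · intro h
    have heq := congrArg hU.fromSpec (PrimeSpectrum.ext (h.trans hgeneric.symm))
    rwa [hU.fromSpec_primeIdealOf, hU.fromSpec_primeIdealOf] at heq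
  · intro h
    rw [← hgeneric]
    congr 2
    exact Subtype.ext h

theorem isClosed_singleton_of_isMaximal_primeIdealOf {X : Scheme.{u}} [JacobsonSpace X]
    {U : X.Opens} (hU : IsAffineOpen U) (x : U) (hx : (hU.primeIdealOf x).asIdeal.IsMaximal) :
    IsClosed {(x : X)} := by
  apply isClosed_singleton_of_isLocallyClosed_singleton
  have himage : hU.fromSpec '' {hU.primeIdealOf x} = {(x : X)} :=
    Set.image_singleton.trans (congrArg _ (hU.fromSpec_primeIdealOf x))
  rw [← himage]
  exact ((PrimeSpectrum.isClosed_singleton_iff_isMaximal _).mpr hx).isLocallyClosed.image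
    hU.fromSpec.isOpenEmbedding.isInducing hU.fromSpec.isOpenEmbedding.isOpen_range.isLocallyClosed

theorem specMap_specMap_fromSpecStalk_eq {X : Scheme.{u}} [IsIntegral X] {A M : Type u}
    [CommRing A] [CommRing M] [Algebra A M] (j : X.functionField →+* M) {x : X}
    (e : X.presheaf.stalk x →+* A) (he : ∀ o, algebraMap A M (e o) = j (algebraMap _ _ o)) :
    Spec.map (CommRingCat.ofHom (algebraMap A M)) ≫
        Spec.map (CommRingCat.ofHom e) ≫ X.fromSpecStalk x =
      Spec.map (CommRingCat.ofHom j) ≫ X.fromSpecStalk (genericPoint X) := by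
  rw [← Scheme.SpecMap_stalkSpecializes_fromSpecStalk
    ((genericPoint_spec X).specializes (Set.mem_univ x)), ← Category.assoc, ← Category.assoc,
    ← Spec.map_comp, ← Spec.map_comp]
  congr 2
  ext o
  exact he o

theorem specMap_fromSpecStalk_closedPoint {X : Scheme.{u}} {A : Type u} [CommRing A]
    [IsLocalRing A] {x : X} (e : X.presheaf.stalk x →+* A) [IsLocalHom e] :
    (Spec.map (CommRingCat.ofHom e) ≫ X.fromSpecStalk x) (closedPoint A) = x :=
  (congrArg (X.fromSpecStalk x) (IsLocalRing.comap_closedPoint e)).trans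
    Scheme.fromSpecStalk_closedPoint

theorem isDominant_specMap_of_injective {A B : Type u} [CommRing A] [CommRing B] (φ : A →+* B)
    (hφ : Function.Injective φ) : IsDominant (Spec.map (CommRingCat.ofHom φ)) := by
  refine ⟨(PrimeSpectrum.denseRange_comap_iff_ker_le_nilRadical φ).mpr ?_⟩
  rw [(RingHom.injective_iff_ker_eq_bot _).mp hφ]
  exact bot_le

namespace SmoothProjectiveCurve

variable {k : Type u} [Field k] (C : SmoothProjectiveCurve k)

/-- The structure map of the `k`-algebra of sections over an open set. -/
noncomputable def baseHom (U : C.X.Opens) : k →+* Γ(C.X, U) :=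
  ((Scheme.ΓSpecIso (.of k)).inv ≫ C.str.appLE ⊤ U (by simp)).hom

/-- The structure map of the `k`-algebra `𝒪_(C, x)`. -/
noncomputable def stalkHom (x : C.X) : k →+* C.X.presheaf.stalk x :=
  (C.X.presheaf.germ ⊤ x trivial).hom.comp (C.baseHom ⊤)

/-- The structure map of the `k`-algebra `K(C)`. -/
noncomputable def constHom : k →+* C.X.functionField :=
  C.stalkHom (genericPoint C.X)

theorem map_baseHom {U V : C.X.Opens} (h : U ≤ V) (a : k) :
    C.X.presheaf.map (homOfLE h).op (C.baseHom V a) = C.baseHom U a :=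
  congr(((Scheme.ΓSpecIso (.of k)).inv ≫
    $(Scheme.Hom.appLE_map C.str (U := ⊤) (V := V) (by simp) (homOfLE h).op)).hom a)

theorem germ_baseHom {U : C.X.Opens} {x : C.X} (hU : x ∈ U) (a : k) :
    C.X.presheaf.germ U x hU (C.baseHom U a) = C.stalkHom x a := by
  rw [← C.map_baseHom (le_top : U ≤ ⊤), C.X.presheaf.germ_res_apply]
  rfl

theorem algebraMap_stalkHom (x : C.X) (a : k) :
    algebraMap (C.X.presheaf.stalk x) C.X.functionField (C.stalkHom x a) = C.constHom a := by
  have : Nonempty (⊤ : C.X.Opens) := ⟨⟨x, trivial⟩⟩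
  exact Scheme.algebraMap_germ_eq_germToFunctionField (X := C.X) (U := ⊤) trivial (C.baseHom ⊤ a)

theorem ofHom_baseHom_top :
    CommRingCat.ofHom (C.baseHom ⊤) = (Scheme.ΓSpecIso (.of k)).inv ≫ C.str.appTop := by
  rw [Scheme.Hom.appTop, Scheme.Hom.app_eq_appLE]
  rfl

theorem str_eq : C.str = C.X.toSpecΓ ≫ Spec.map (CommRingCat.ofHom (C.baseHom ⊤)) := by
  rw [ofHom_baseHom_top, Spec.map_comp, ← reassoc_of% Scheme.toSpecΓ_naturality C.str,
    ← SpecMap_ΓSpecIso_hom, ← Spec.map_comp, Iso.inv_hom_id, Spec.map_id, Category.comp_id]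

theorem fromSpecStalk_str (x : C.X) :
    C.X.fromSpecStalk x ≫ C.str = Spec.map (CommRingCat.ofHom (C.stalkHom x)) := by
  conv_lhs => rw [C.str_eq]
  rw [← Category.assoc, Scheme.fromSpecStalk_toSpecΓ, ← Spec.map_comp]
  rfl

theorem exists_etale_polynomial (x : C.X) : ∃ (U : C.X.Opens) (_ : IsAffineOpen U) (_ : x ∈ U)
    (g : Polynomial k →+* Γ(C.X, U)), g.comp Polynomial.C = C.baseHom U ∧ g.Etale := by
  obtain ⟨V, hV, U, hU, hx, hUV, h⟩ :=
    SmoothOfRelativeDimension.exists_isStandardSmoothOfRelativeDimension (n := 1) (f := C.str) x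
  obtain rfl : V = ⊤ := eq_top_iff.mpr fun y _ => Subsingleton.elim (C.str x) y ▸ hUV hx
  refine ⟨U, hU, hx, exists_etale_polynomial_of_isStandardSmoothOfRelativeDimension_one ?_⟩
  rw [baseHom, CommRingCat.hom_comp]
  exact RingHom.isStandardSmoothOfRelativeDimension_respectsIso.2 _
    (Scheme.ΓSpecIso (.of k)).symm.commRingCatIsoToRingEquiv h

instance : JacobsonSpace C.X := LocallyOfFiniteType.jacobsonSpace C.str

theorem isDiscreteValuationRing_stalk_of_ne {x : C.X} (hx : x ≠ genericPoint C.X) :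
    IsDiscreteValuationRing (C.X.presheaf.stalk x) := by
  obtain ⟨U, hU, hxU, g, -, hg⟩ := C.exists_etale_polynomial x
  algebraize [g]
  have : Nonempty U := ⟨⟨x, hxU⟩⟩
  let := TopCat.Presheaf.algebra_section_stalk C.X.presheaf (⟨x, hxU⟩ : U)
  have := hU.isLocalization_stalk ⟨x, hxU⟩
  exact isDiscreteValuationRing_localization_of_etale (Polynomial k)
    (hU.primeIdealOf ⟨x, hxU⟩).asIdeal
    (fun h => hx ((primeIdealOf_eq_bot_iff hU ⟨x, hxU⟩).mp h)) _

theorem isClosed_singleton_of_ne {x : C.X} (hx : x ≠ genericPoint C.X) : IsClosed {x} := by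
  obtain ⟨U, hU, hxU, g, -, hg⟩ := C.exists_etale_polynomial x
  algebraize [g]
  have : Nonempty U := ⟨⟨x, hxU⟩⟩
  exact isClosed_singleton_of_isMaximal_primeIdealOf hU ⟨x, hxU⟩
    (isMaximal_of_ne_bot_of_etale (Polynomial k) _ fun h =>
      hx ((primeIdealOf_eq_bot_iff hU ⟨x, hxU⟩).mp h))

theorem not_isClosed_genericPoint : ¬ IsClosed {genericPoint C.X} := by
  intro h
  have hsingle (x : C.X) : x = genericPoint C.X :=
    ((genericPoint_spec C.X).specializes (Set.mem_univ x)).mem_closed h rfl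
  obtain ⟨U, hU, hxU, g, -, hg⟩ := C.exists_etale_polynomial (genericPoint C.X)
  algebraize [g]
  have : Nonempty U := ⟨⟨_, hxU⟩⟩
  refine not_isField_of_etale_polynomial k Γ(C.X, U) ?_
  by_contra hF
  obtain ⟨p, hp0, hp⟩ := Ring.not_isField_iff_exists_prime.mp hF
  exact hp0 (congrArg PrimeSpectrum.asIdeal (hU.fromSpec.isOpenEmbedding.injective
    ((hsingle (hU.fromSpec ⟨p, hp⟩)).trans (hsingle (hU.fromSpec ⟨⊥, Ideal.isPrime_bot⟩)).symm)))

theorem mem_closedPoints_iff {x : C.X} : x ∈ closedPoints C.X ↔ x ≠ genericPoint C.X :=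
  ⟨fun h hx => C.not_isClosed_genericPoint (hx ▸ h), C.isClosed_singleton_of_ne⟩

theorem coheight_eq_one {x : C.X} (hx : x ≠ genericPoint C.X) : Order.coheight x = 1 := by
  have := C.isDiscreteValuationRing_stalk_of_ne hx
  have h := ringKrullDim_stalk_eq_coheight x
  rw [IsPrincipalIdealRing.ringKrullDim_eq_one _ (IsDiscreteValuationRing.not_isField _)] at h
  exact_mod_cast h.symm

theorem ord_eq_ordZ {x : C.X} (hx : x ≠ genericPoint C.X)
    [IsDiscreteValuationRing (C.X.presheaf.stalk x)] (g : C.X.functionField) :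
    Scheme.ord g x = ordZ (C.X.presheaf.stalk x) g := by
  rw [Scheme.ord_eq_ordHom_of_coheight_eq_one (C.coheight_eq_one hx)]
  rfl

theorem exists_finite_isSeparable_ratFunc : ∃ _ : Algebra (RatFunc k) C.X.functionField,
    (∀ a, algebraMap (RatFunc k) C.X.functionField (RatFunc.C a) = C.constHom a) ∧
    FiniteDimensional (RatFunc k) C.X.functionField ∧
      Algebra.IsSeparable (RatFunc k) C.X.functionField := by
  obtain ⟨U, hU, hxU, g, hgC, hg⟩ := C.exists_etale_polynomial (genericPoint C.X)
  have : Nonempty U := ⟨⟨_, hxU⟩⟩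
  have := functionField_isFractionRing_of_isAffineOpen C.X U hU
  algebraize [g, (algebraMap Γ(C.X, U) C.X.functionField).comp g]
  have : FaithfulSMul (Polynomial k) C.X.functionField := .trans _ Γ(C.X, U) _
  let φ : RatFunc k →ₐ[Polynomial k] C.X.functionField :=
    IsFractionRing.liftAlgHom (g := Algebra.ofId (Polynomial k) C.X.functionField)
      (FaithfulSMul.algebraMap_injective (Polynomial k) C.X.functionField)
  let := φ.toRingHom.toAlgebra
  refine ⟨this, fun a => (φ.commutes (Polynomial.C a)).trans ?_, ?_⟩
  · change C.X.presheaf.germ U _ hxU ((g.comp Polynomial.C) a) = _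
    rw [hgC, C.germ_baseHom]
    rfl
  · have : IsScalarTower (Polynomial k) (RatFunc k) C.X.functionField :=
      .of_algebraMap_eq fun p => (φ.commutes p).symm
    exact finiteDimensional_isSeparable_of_etale (Polynomial k) Γ(C.X, U) _ _

instance isAlgClosed_residueField [IsAlgClosed k] (x : closedPoints C.X) :
    IsAlgClosed (ResidueField (C.X.presheaf.stalk x.1)) :=
  IsAlgClosed.of_ringEquiv k (C.X.residueField x.1)
    (residueFieldIsoBase C.str x.1 x.2).symm.commRingCatIsoToRingEquiv

theorem exists_isLocalHom_stalk (R : ValuationSubring C.X.functionField)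
    (hR : ∀ a, C.constHom a ∈ R) :
    ∃ (x : C.X) (g : C.X.presheaf.stalk x →+* R), IsLocalHom g ∧
      ∀ o, (g o : C.X.functionField) = algebraMap (C.X.presheaf.stalk x) C.X.functionField o := by
  let S : ValuativeCommSq C.str :=
    { R := R
      K := C.X.functionField
      i₁ := C.X.fromSpecStalk (genericPoint C.X)
      i₂ := Spec.map (CommRingCat.ofHom (C.constHom.codRestrict R hR))
      commSq := ⟨by
        rw [fromSpecStalk_str, ← Spec.map_comp]
        rfl⟩ }
  have hex : ValuativeCriterion.Existence C.str := by
    have : UniversallyClosed C.str := inferInstance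
    rw [UniversallyClosed.eq_valuativeCriterion] at this
    exact this.1
  obtain ⟨⟨l, hl, -⟩⟩ := (hex S).exists_lift
  let g := Scheme.stalkClosedPointTo (R := CommRingCat.of R) l
  refine ⟨l (closedPoint R), g.hom, inferInstance, fun o => ?_⟩
  have hgeneric : Spec.map (CommRingCat.ofHom (algebraMap R C.X.functionField)) ≫ l =
    C.X.fromSpecStalk (genericPoint C.X) := hl
  rw [← Scheme.Spec_stalkClosedPointTo_fromSpecStalk (R := CommRingCat.of R) l,
    ← Scheme.SpecMap_stalkSpecializes_fromSpecStalk
      ((genericPoint_spec C.X).specializes (Set.mem_univ (l (closedPoint R)))),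
    ← Category.assoc, ← Spec.map_comp, cancel_mono] at hgeneric
  exact congr($(Spec.map_injective hgeneric).hom o)

-- Two morphisms from `Spec A` to a separated scheme that agree on the generic point are equal;
-- compare where they send the closed point.
theorem eq_of_isLocalHom {A M : Type u} [CommRing A] [IsDomain A] [IsLocalRing A] [CommRing M]
    [Algebra A M] [FaithfulSMul A M] (j : C.X.functionField →+* M) {x y : C.X}
    (e : C.X.presheaf.stalk x →+* A) (e' : C.X.presheaf.stalk y →+* A) [IsLocalHom e]
    [IsLocalHom e'] (he : ∀ o, algebraMap A M (e o) = j (algebraMap _ _ o))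
    (he' : ∀ o, algebraMap A M (e' o) = j (algebraMap _ _ o)) : x = y := by
  have hinj := FaithfulSMul.algebraMap_injective A M
  let f := Spec.map (CommRingCat.ofHom e) ≫ C.X.fromSpecStalk x
  let g := Spec.map (CommRingCat.ofHom e') ≫ C.X.fromSpecStalk y
  have hstr : f ≫ C.str = g ≫ C.str := by
    simp only [f, g, Category.assoc, fromSpecStalk_str, ← Spec.map_comp, ← CommRingCat.ofHom_comp]
    congr 2
    ext a
    apply hinj
    simp [he, he', algebraMap_stalkHom]
  have := isDominant_specMap_of_injective (algebraMap A M) hinj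
  have hfg : f = g := ext_of_isDominant_of_isSeparated C.str hstr
    (Spec.map (CommRingCat.ofHom (algebraMap A M)))
    ((specMap_specMap_fromSpecStalk_eq j e he).trans
      (specMap_specMap_fromSpecStalk_eq j e' he').symm)
  rw [← specMap_fromSpecStalk_closedPoint e, ← specMap_fromSpecStalk_closedPoint e']
  exact congr($hfg (closedPoint A))

theorem eq_of_range_algebraMap_stalk_eq {x y : C.X}
    (h : (algebraMap (C.X.presheaf.stalk x) C.X.functionField).range =
      (algebraMap (C.X.presheaf.stalk y) C.X.functionField).range) : x = y := by
  set S := (algebraMap (C.X.presheaf.stalk y) C.X.functionField).range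
  have hlocal : ∀ z, (algebraMap (C.X.presheaf.stalk z) C.X.functionField).range = S →
      ∃ e : C.X.presheaf.stalk z ≃+* S, ∀ o, algebraMap S C.X.functionField (e o) =
        algebraMap (C.X.presheaf.stalk z) C.X.functionField o := by
    rintro z hz
    rw [← hz]
    exact ⟨.ofBijective (RingHom.rangeRestrict _) ⟨fun a b hab =>
      IsFractionRing.injective _ _ (congrArg Subtype.val hab), RingHom.rangeRestrict_surjective _⟩,
      fun _ => rfl⟩
  obtain ⟨e, he⟩ := hlocal x h
  obtain ⟨e', he'⟩ := hlocal y rfl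
  have : IsLocalRing S := e.isLocalRing
  have : IsLocalHom e.toRingHom := ⟨(isLocalHom_equiv e).map_nonunit⟩
  have : IsLocalHom e'.toRingHom := ⟨(isLocalHom_equiv e').map_nonunit⟩
  exact C.eq_of_isLocalHom (.id _) e.toRingHom e'.toRingHom he he'

end SmoothProjectiveCurve

instance essFiniteType_ratFunc {k : Type*} [Field k] : Algebra.EssFiniteType k (RatFunc k) :=
  have : Algebra.EssFiniteType (Polynomial k) (RatFunc k) :=
    .of_isLocalization _ (nonZeroDivisors (Polynomial k))
  .comp k (Polynomial k) (RatFunc k)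

theorem finiteDimensional_of_finiteDimensional_ratFunc {k K L : Type u} [Field k] [Field K]
    [Field L] [Algebra (RatFunc k) K] [Algebra (RatFunc k) L] [Algebra K L]
    [FiniteDimensional (RatFunc k) K] [FiniteDimensional (RatFunc k) L]
    (h : ∀ a : k, algebraMap K L (algebraMap (RatFunc k) K (RatFunc.C a)) =
      algebraMap (RatFunc k) L (RatFunc.C a)) : FiniteDimensional K L := by
  have htrdeg : Algebra.trdeg k (RatFunc k) = 1 := by
    have : Algebra.IsAlgebraic (Polynomial k) (RatFunc k) :=
      IsLocalization.isAlgebraic (RatFunc k) (nonZeroDivisors (Polynomial k))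
    rw [← trdeg_add_eq k (Polynomial k) (A := RatFunc k), Polynomial.trdeg_of_isDomain,
      trdeg_eq_zero, add_zero]
  let := ((algebraMap (RatFunc k) K).comp (algebraMap k (RatFunc k))).toAlgebra
  let := ((algebraMap (RatFunc k) L).comp (algebraMap k (RatFunc k))).toAlgebra
  have : IsScalarTower k (RatFunc k) K := .of_algebraMap_eq fun _ => rfl
  have : IsScalarTower k (RatFunc k) L := .of_algebraMap_eq fun _ => rfl
  have : IsScalarTower k K L := .of_algebraMap_eq fun a => (h a).symm
  have hK : Algebra.trdeg k K = 1 := by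
    rw [← trdeg_add_eq k (RatFunc k) (A := K), htrdeg, trdeg_eq_zero, add_zero]
  have hL : Algebra.trdeg k L = 1 := by
    rw [← trdeg_add_eq k (RatFunc k) (A := L), htrdeg, trdeg_eq_zero, add_zero]
  have hKL : Algebra.trdeg K L = 0 := Cardinal.eq_of_add_eq_add_left
    (by rw [trdeg_add_eq k K (A := L), hK, hL, add_zero]) (hK ▸ Cardinal.one_lt_aleph0)
  have : Algebra.IsAlgebraic K L := trdeg_eq_zero_iff.mp hKL
  have : Algebra.EssFiniteType k L := .comp k (RatFunc k) L
  have : Algebra.EssFiniteType K L := .of_comp k K L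
  exact Algebra.finite_of_essFiniteType_of_isAlgebraic

theorem mem_valuationSubring_iff_of_isLocalHom {O L : Type*} [CommRing O] [IsDomain O]
    [ValuationRing O] [Field L] [Algebra O L] [IsFractionRing O L] {R : ValuationSubring L}
    (g : O →+* R) [IsLocalHom g] (hg : ∀ o, (g o : L) = algebraMap O L o) (r : L) :
    r ∈ R ↔ r ∈ (algebraMap O L).range := by
  refine ⟨fun hr => ?_, fun ⟨o, ho⟩ => ho ▸ hg o ▸ (g o).2⟩
  obtain h | ⟨o, ho⟩ := ValuationRing.isInteger_or_isInteger O r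
  · exact h
  obtain rfl | hr0 := eq_or_ne r 0
  · exact zero_mem _
  have hunit : IsUnit o := by
    refine (isUnit_map_iff g o).mp (.of_mul_eq_one ⟨r, hr⟩ (Subtype.ext ?_))
    change (g o : L) * r = 1
    rw [hg, ho, inv_mul_cancel₀ hr0]
  obtain ⟨u, rfl⟩ := hunit
  refine ⟨(u⁻¹ : _ˣ), ?_⟩
  rw [← inv_inv r, ← ho]
  exact eq_inv_of_mul_eq_one_left (by rw [← map_mul, Units.inv_mul, map_one])

theorem isLocalHom_codRestrict_of_forall_inv_notMem {O L : Type*} [CommRing O] [Field L]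
    [Algebra O L] (R : ValuationSubring L) (hR : ∀ a, algebraMap O L a ∈ R)
    (hinv : ∀ a : O, ¬ IsUnit a → a ≠ 0 → (algebraMap O L a)⁻¹ ∉ R) :
    IsLocalHom ((algebraMap O L).codRestrict R hR) := by
  refine ⟨fun a ha => ?_⟩
  by_contra hna
  obtain ⟨u, hu⟩ := ha
  have hval : ((u : R) : L) = algebraMap O L a := congrArg Subtype.val hu
  refine hinv a hna ?_ ?_
  · rintro rfl
    exact u.ne_zero (Subtype.ext (hval.trans (map_zero _)))
  · rw [← hval, inv_eq_of_mul_eq_one_right (congrArg Subtype.val u.mul_inv)]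
    exact SetLike.coe_mem _

section LocalMap

variable {X Y : Scheme.{u}} {f : X ⟶ Y}

/-- The local homomorphism `𝒪_(Y, y) → 𝒪_(X, x)` induced by `f`, for `f x = y`.  It is `stalkMap`
with the point `y` freed from being syntactically `f x`. -/
noncomputable def localMap {x : X} {y : Y} (h : f x = y) :
    Y.presheaf.stalk y →+* X.presheaf.stalk x :=
  (Y.presheaf.stalkSpecializes (specializes_of_eq h) ≫ f.stalkMap x).hom

theorem localMap_rfl (x : X) : localMap (f := f) (x := x) rfl = (f.stalkMap x).hom := by
  rw [localMap, TopCat.Presheaf.stalkSpecializes_refl, Category.id_comp]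

instance {x : X} {y : Y} (h : f x = y) : IsLocalHom (localMap h) := by
  subst h
  rw [localMap_rfl]
  infer_instance

theorem formallySmooth_localMap [LocallyOfFinitePresentation f] {x : X} {y : Y} (h : f x = y)
    {U : X.Opens} (hx : x ∈ U) (hU : Smooth (U.ι ≫ f)) : (localMap h).FormallySmooth := by
  subst h
  have hmem : (⟨x, hx⟩ : U) ∈ U.ι ⁻¹ᵁ f.smoothLocus := by
    rw [Scheme.Hom.preimage_smoothLocus_eq, Scheme.Hom.smoothLocus_eq_top]
    trivial
  rw [localMap_rfl]
  exact hmem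

end LocalMap

section FunField

variable {X Y : Scheme.{u}} [IsIntegral X] (f : X ⟶ Y)

/-- The function field of `X`, as an extension of the function field and of the local rings of `Y`,
for a dominant morphism `f : X ⟶ Y`.  It is a type synonym because the latter algebra structures
depend on `f`. -/
def FunField (_f : X ⟶ Y) : Type u := X.functionField

noncomputable instance : Field (FunField f) := inferInstanceAs (Field X.functionField)

noncomputable instance (x : X) : Algebra (X.presheaf.stalk x) (FunField f) :=
  inferInstanceAs (Algebra (X.presheaf.stalk x) X.functionField)

instance (x : X) : IsFractionRing (X.presheaf.stalk x) (FunField f) :=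
  inferInstanceAs (IsFractionRing (X.presheaf.stalk x) X.functionField)

variable [IsIntegral Y] [IsDominant f]

theorem map_genericPoint : f (genericPoint X) = genericPoint Y := by
  refine ((genericPoint_spec X).image f.continuous).eq ?_
  rw [Set.image_univ, f.denseRange.closure_range]
  exact genericPoint_spec Y

theorem map_genericPoint_specializes (y : Y) : f (genericPoint X) ⤳ y := by
  rw [map_genericPoint]
  exact (genericPoint_spec Y).specializes (Set.mem_univ y)

noncomputable instance FunField.algebraBase (y : Y) : Algebra (Y.presheaf.stalk y) (FunField f) :=
  (Y.presheaf.stalkSpecializes (map_genericPoint_specializes f y) ≫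
    f.stalkMap (genericPoint X)).hom.toAlgebra

theorem FunField.algebraMap_base (y : Y) (o : Y.presheaf.stalk y) :
    algebraMap (Y.presheaf.stalk y) (FunField f) o = f.stalkMap (genericPoint X)
      (Y.presheaf.stalkSpecializes (map_genericPoint_specializes f y) o) := rfl

instance (y : Y) : IsScalarTower (Y.presheaf.stalk y) Y.functionField (FunField f) := by
  refine .of_algebraMap_eq fun o => ?_
  rw [FunField.algebraMap_base, FunField.algebraMap_base]
  congr 1
  change _ = (Y.presheaf.stalkSpecializes ((genericPoint_spec Y).specializes trivial) ≫
    Y.presheaf.stalkSpecializes (map_genericPoint_specializes f (genericPoint Y))) o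
  rw [TopCat.Presheaf.stalkSpecializes_comp]

theorem finrank_funField :
    Module.finrank Y.functionField (FunField f) = CurveBundle.mapDegree f := by
  let := (f.stalkMap (genericPoint X)).hom.toAlgebra
  let e : Y.functionField ≃+* Y.presheaf.stalk (f (genericPoint X)) :=
    (Y.presheaf.stalkCongr (.of_eq (map_genericPoint f).symm)).commRingCatIsoToRingEquiv
  exact Algebra.finrank_eq_of_equiv_equiv e (RingEquiv.refl X.functionField) (by ext; rfl)

theorem formallySmooth_funField [LocallyOfFinitePresentation f]
    (h : ∃ U : X.Opens, (U : Set X).Nonempty ∧ Smooth (U.ι ≫ f)) :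
    Algebra.FormallySmooth Y.functionField (FunField f) := by
  obtain ⟨U, hU, hsm⟩ := h
  have hη : genericPoint X ∈ U :=
    ((genericPoint_spec X).mem_open_set_iff U.isOpen).mpr (by simpa only [Set.univ_inter] using hU)
  exact formallySmooth_localMap (map_genericPoint f) hη hsm

variable {f}

theorem algebraMap_localMap {x : X} {y : Y} (h : f x = y) (o : Y.presheaf.stalk y) :
    algebraMap (X.presheaf.stalk x) (FunField f) (localMap h o) =
      algebraMap (Y.presheaf.stalk y) (FunField f) o := by
  subst h
  rw [localMap_rfl]
  exact (Scheme.Hom.stalkSpecializes_stalkMap_apply f _ _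
    ((genericPoint_spec X).specializes trivial) o).symm

theorem mult_eq_ramIdx {x : X} {y : Y} (h : f x = y) :
    CurveBundle.mult f x = ramIdx (Y.presheaf.stalk y) (X.presheaf.stalk x) (FunField f) := by
  subst h
  let := (f.stalkMap x).hom.toAlgebra
  rw [CurveBundle.mult, ramIdx, Ideal.ramificationIdx']
  congr 1
  ext n
  rw [Set.mem_ofPred_eq, Set.mem_ofPred_eq, Ideal.map_le_iff_le_comap]
  refine forall₂_congr fun a ha => ?_
  rw [Ideal.mem_comap, ← algebraMap_localMap rfl, localMap_rfl]
  exact ⟨fun h => ⟨_, h, rfl⟩, fun ⟨o, ho, ho'⟩ =>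
    IsFractionRing.injective (X.presheaf.stalk x) (FunField f) ho' ▸ ho⟩

end FunField

namespace SmoothProjectiveCurve

variable {k : Type u} [Field k] {X Y : SmoothProjectiveCurve k} {f : X.X ⟶ Y.X}

theorem localMap_stalkHom (hf : f ≫ Y.str = X.str) {x : X.X} {y : Y.X} (h : f x = y) (a : k) :
    localMap h (Y.stalkHom y a) = X.stalkHom x a := by
  have hbase : f.appTop (Y.baseHom ⊤ a) = X.baseHom ⊤ a := by
    have hX := X.ofHom_baseHom_top
    rw [← hf, Scheme.Hom.comp_appTop, ← Category.assoc, ← ofHom_baseHom_top] at hX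
    exact congr($(hX).hom a).symm
  subst h
  rw [localMap_rfl]
  exact (Scheme.Hom.germ_stalkMap_apply f ⊤ x trivial (Y.baseHom ⊤ a)).trans
    (congrArg (X.X.presheaf.germ ⊤ x trivial) hbase)

theorem isClosedMap (hf : f ≫ Y.str = X.str) : IsClosedMap f := by
  have : IsProper (f ≫ Y.str) := hf ▸ X.proper
  have := IsProper.of_comp f Y.str
  exact f.isClosedMap

variable [IsDominant f]

theorem algebraMap_constHom (hf : f ≫ Y.str = X.str) (a : k) :
    algebraMap Y.X.functionField (FunField f) (Y.constHom a) = X.constHom a :=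
  localMap_stalkHom hf (map_genericPoint f) a

variable (f) in
theorem ne_genericPoint_of_map_ne {x : X.X} (hx : f x ≠ genericPoint Y.X) :
    x ≠ genericPoint X.X :=
  fun h => hx (h ▸ map_genericPoint f)

theorem finiteDimensional_funField (hf : f ≫ Y.str = X.str) :
    FiniteDimensional Y.X.functionField (FunField f) := by
  obtain ⟨i, hi, hi', -⟩ := Y.exists_finite_isSeparable_ratFunc
  obtain ⟨j, hj, hj', -⟩ := X.exists_finite_isSeparable_ratFunc
  let : Algebra (RatFunc k) (FunField f) := j
  have : FiniteDimensional (RatFunc k) (FunField f) := hj'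
  refine finiteDimensional_of_finiteDimensional_ratFunc (k := k) fun a => ?_
  rw [hi, algebraMap_constHom hf]
  exact (hj a).symm

theorem isSeparable_funField (hf : f ≫ Y.str = X.str)
    (hsm : ∃ U : X.X.Opens, (U : Set X.X).Nonempty ∧ Smooth (U.ι ≫ f)) :
    Algebra.IsSeparable Y.X.functionField (FunField f) := by
  have : LocallyOfFiniteType (f ≫ Y.str) := hf ▸ inferInstance
  have := locallyOfFiniteType_of_comp f Y.str
  have : LocallyOfFinitePresentation f := inferInstance
  have := finiteDimensional_funField hf
  have := formallySmooth_funField f hsm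
  exact isSeparable_of_formallySmooth _ _

theorem isPlaceFamily (hf : f ≫ Y.str = X.str) {y : Y.X} (hy : y ≠ genericPoint Y.X) :
    IsPlaceFamily (Y.X.presheaf.stalk y) (FunField f)
      fun x : {x : X.X // f x = y} => X.X.presheaf.stalk x.1 where
  dominates x := ⟨localMap x.2, inferInstance, algebraMap_localMap x.2⟩
  injective x x' h := Subtype.ext (X.eq_of_range_algebraMap_stalk_eq h)
  exhaustive R hR hinv := by
    have hconst : ∀ a, (X.constHom a : FunField f) ∈ R := fun a => by
      rw [← algebraMap_constHom hf, ← Y.algebraMap_stalkHom y,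
        ← IsScalarTower.algebraMap_apply (Y.X.presheaf.stalk y)]
      exact hR _
    obtain ⟨x, g, hg, hgx⟩ : ∃ (x : X.X) (g : X.X.presheaf.stalk x →+* R), IsLocalHom g ∧
        ∀ o, (g o : FunField f) = algebraMap (X.X.presheaf.stalk x) (FunField f) o :=
      X.exists_isLocalHom_stalk R hconst
    have hxy : f x = y := by
      have := isLocalHom_codRestrict_of_forall_inv_notMem R hR hinv
      have : IsLocalHom (g.comp (f.stalkMap x).hom) := RingHom.isLocalHom_comp _ _
      refine Y.eq_of_isLocalHom (algebraMap Y.X.functionField (FunField f))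
        (g.comp (f.stalkMap x).hom) ((algebraMap _ (FunField f)).codRestrict R hR)
        (fun o => ?_) (fun o => ?_)
      · rw [← IsScalarTower.algebraMap_apply, ← algebraMap_localMap rfl, localMap_rfl]
        exact hgx _
      · rw [← IsScalarTower.algebraMap_apply]
        rfl
    have := X.isDiscreteValuationRing_stalk_of_ne (ne_genericPoint_of_map_ne f (hxy ▸ hy))
    exact ⟨⟨x, hxy⟩, mem_valuationSubring_iff_of_isLocalHom g hgx⟩

end SmoothProjectiveCurve

section Gluing

variable {X : Scheme.{u}} [IsIntegral X]

theorem algebraMap_germ {U : X.Opens} {x : X} (hx : x ∈ U) (s : Γ(X, U)) :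
    algebraMap (X.presheaf.stalk x) X.functionField (X.presheaf.germ U x hx s) =
      X.presheaf.germ U (genericPoint X)
        (((genericPoint_spec X).specializes trivial).mem_open U.isOpen hx) s :=
  congr($(TopCat.Presheaf.germ_stalkSpecializes X.presheaf hx
    ((genericPoint_spec X).specializes trivial)).hom s)

theorem exists_germ_genericPoint_eq (U : X.Opens) (hU : genericPoint X ∈ U)
    (g : X.functionField)
    (hg : ∀ x ∈ U, g ∈ (algebraMap (X.presheaf.stalk x) X.functionField).range) :
    ∃ s : Γ(X, U), X.presheaf.germ U (genericPoint X) hU s = g := by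
  have hlocal : ∀ x : U, ∃ (W : X.Opens) (_ : x.1 ∈ W) (_ : W ≤ U) (s : Γ(X, W)),
      ∀ h, X.presheaf.germ W (genericPoint X) h s = g := by
    rintro ⟨x, hx⟩
    obtain ⟨o, rfl⟩ := hg x hx
    obtain ⟨W, hxW, s, rfl⟩ := X.presheaf.exists_germ_eq o
    refine ⟨W ⊓ U, ⟨hxW, hx⟩, inf_le_right, X.presheaf.map (homOfLE inf_le_left).op s,
      fun h => ?_⟩
    rw [TopCat.Presheaf.germ_res_apply]
    exact (algebraMap_germ hxW s).symm
  choose W hxW hWU s hs using hlocal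
  have hη (x : U) : genericPoint X ∈ W x :=
    ((genericPoint_spec X).specializes trivial).mem_open (W x).isOpen (hxW x)
  obtain ⟨t, ht, -⟩ := X.sheaf.existsUnique_gluing' W U (fun x => homOfLE (hWU x))
    (fun x hx => TopologicalSpace.Opens.mem_iSup.mpr ⟨⟨x, hx⟩, hxW _⟩) s (fun i j => by
      refine germ_injective_of_isIntegral X (genericPoint X) (U := W i ⊓ W j) ⟨hη i, hη j⟩ ?_
      refine (TopCat.Presheaf.germ_res_apply _ _ _ _ _).trans ?_
      refine Eq.trans ?_ (TopCat.Presheaf.germ_res_apply _ _ _ _ _).symm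
      exact (hs i (hη i)).trans (hs j (hη j)).symm)
  refine ⟨t, ?_⟩
  rw [← hs ⟨_, hU⟩ (hη _), ← ht ⟨_, hU⟩]
  exact (TopCat.Presheaf.germ_res_apply _ _ _ _ _).symm

end Gluing

theorem exists_preimage_le_of_isClosedMap {X Y : Scheme.{u}} {f : X ⟶ Y} (hf : IsClosedMap f)
    {U : X.Opens} {y : Y} (h : ∀ x, f x = y → x ∈ U) :
    ∃ V : Y.Opens, y ∈ V ∧ f ⁻¹ᵁ V ≤ U := by
  refine ⟨⟨(f '' (U : Set X)ᶜ)ᶜ, (hf _ U.isOpen.isClosed_compl).isOpen_compl⟩, ?_,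
    fun x hx => ?_⟩
  · rintro ⟨x, hx, rfl⟩
    exact hx (h x rfl)
  · by_contra hxU
    exact hx ⟨x, hxU, rfl⟩

namespace CurveBundle

section Germ

variable {Y : Scheme.{u}} (M : Y.Modules)

theorem exists_germ_eq {y : Y} (t : Stalk M y) :
    ∃ (V : Y.Opens) (hy : y ∈ V) (s : Γ(M, V)), germ M y hy s = t :=
  TopCat.Presheaf.exists_germ_eq M.presheaf t

theorem germ_smul {V : Y.Opens} {y : Y} (hy : y ∈ V) (a : Γ(Y, V)) (s : Γ(M, V)) :
    germ M y hy (a • s) = Y.presheaf.germ V y hy a • germ M y hy s :=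
  PresheafOfModules.germ_smul M.val y V hy a s

theorem germ_res {V W : Y.Opens} (i : W ⟶ V) {y : Y} (hy : y ∈ W) (s : Γ(M, V)) :
    germ M y hy (M.presheaf.map i.op s) = germ M y (i.le hy) s :=
  TopCat.Presheaf.germ_res_apply M.presheaf i y hy s

theorem exists_germ_eq_and_germ_eq {y : Y} (o : Y.presheaf.stalk y) (t : Stalk M y) :
    ∃ (V : Y.Opens) (hy : y ∈ V) (a : Γ(Y, V)) (s : Γ(M, V)),
      Y.presheaf.germ V y hy a = o ∧ germ M y hy s = t := by
  obtain ⟨V, hyV, a, rfl⟩ := Y.presheaf.exists_germ_eq o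
  obtain ⟨W, hyW, s, rfl⟩ := exists_germ_eq M t
  exact ⟨V ⊓ W, ⟨hyV, hyW⟩, Y.presheaf.map (homOfLE inf_le_left).op a,
    M.presheaf.map (homOfLE inf_le_right).op s,
    TopCat.Presheaf.germ_res_apply Y.presheaf _ y _ _, germ_res M _ _ s⟩

theorem toGeneric_germ [IrreducibleSpace Y] {V : Y.Opens} {y : Y} (hy : y ∈ V) (s : Γ(M, V)) :
    toGeneric M y (germ M y hy s) = germ M (genericPoint Y)
      (((genericPoint_spec Y).specializes trivial).mem_open V.isOpen hy) s :=
  TopCat.Presheaf.germ_stalkSpecializes_apply _ _ _ _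

end Germ

section DirectImage

variable {X Y : Scheme.{u}} [IsIntegral X] [IsIntegral Y] (f : X ⟶ Y) [IsDominant f]

theorem genericPoint_mem_preimage {V : Y.Opens} {y : Y} (hy : y ∈ V) :
    genericPoint X ∈ f ⁻¹ᵁ V :=
  (map_genericPoint_specializes f y).mem_open V.isOpen hy

/-- The cocone sending a section of `f_* 𝒪_X` over `V ∋ y`, that is, a section of `𝒪_X` over
`f⁻¹(V)`, to the rational function it defines; it induces the map from the stalk of `f_* 𝒪_X` at
`y` to the function field of `X`. -/
noncomputable def stalkCocone (y : Y) : Limits.Cocone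
    ((TopologicalSpace.OpenNhds.inclusion y).op ⋙ (directImage f).presheaf) where
  pt := AddCommGrpCat.of (FunField f)
  ι :=
    { app V := AddCommGrpCat.ofHom (X.presheaf.germ (f ⁻¹ᵁ V.unop.1) (genericPoint X)
        (genericPoint_mem_preimage f V.unop.2)).hom.toAddMonoidHom
      naturality V W i := by
        ext s
        exact TopCat.Presheaf.germ_res_apply X.presheaf _ _ _ _ }

/-- The additive map underlying `stalkToField`. -/
noncomputable def stalkToFieldHom (y : Y) : Stalk (directImage f) y →+ FunField f :=
  AddCommGrpCat.Hom.hom (Limits.colimit.desc _ (stalkCocone f y))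

theorem stalkToFieldHom_germ {V : Y.Opens} {y : Y} (hy : y ∈ V) (s : Γ(X, f ⁻¹ᵁ V)) :
    stalkToFieldHom f y (germ (directImage f) y hy s) =
      X.presheaf.germ (f ⁻¹ᵁ V) (genericPoint X) (genericPoint_mem_preimage f hy) s :=
  congr($(Limits.colimit.ι_desc (stalkCocone f y) (Opposite.op ⟨V, hy⟩)).hom s)

theorem algebraMap_germ_base {V : Y.Opens} {y : Y} (hy : y ∈ V) (a : Γ(Y, V)) :
    algebraMap (Y.presheaf.stalk y) (FunField f) (Y.presheaf.germ V y hy a) =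
      X.presheaf.germ (f ⁻¹ᵁ V) (genericPoint X) (genericPoint_mem_preimage f hy) (f.app V a) := by
  rw [FunField.algebraMap_base]
  refine Eq.trans ?_
    (Scheme.Hom.germ_stalkMap_apply f _ _ (genericPoint_mem_preimage f hy) a)
  exact congrArg (f.stalkMap (genericPoint X))
    (TopCat.Presheaf.germ_stalkSpecializes_apply _ _ _ _)

theorem stalkToFieldHom_smul {y : Y} (o : Y.presheaf.stalk y) (t : Stalk (directImage f) y) :
    stalkToFieldHom f y (o • t) = o • stalkToFieldHom f y t := by
  obtain ⟨V, hy, a, s, rfl, rfl⟩ := exists_germ_eq_and_germ_eq _ o t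
  rw [← germ_smul, Algebra.smul_def, algebraMap_germ_base, stalkToFieldHom_germ f hy s]
  exact (stalkToFieldHom_germ f hy _).trans
    (map_mul (X.presheaf.germ _ _ (genericPoint_mem_preimage f hy)).hom (f.app _ a) s)

/-- The embedding of the stalk `(f_* 𝒪_X)_y` into the function field of `X`, as a map of modules
over `𝒪_{Y, y}`. -/
noncomputable def stalkToField (y : Y) :
    Stalk (directImage f) y →ₗ[Y.presheaf.stalk y] FunField f :=
  { stalkToFieldHom f y with map_smul' := stalkToFieldHom_smul f }

theorem stalkToField_germ {V : Y.Opens} {y : Y} (hy : y ∈ V) (s : Γ(X, f ⁻¹ᵁ V)) :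
    stalkToField f y (germ (directImage f) y hy s) =
      X.presheaf.germ (f ⁻¹ᵁ V) (genericPoint X) (genericPoint_mem_preimage f hy) s :=
  stalkToFieldHom_germ f hy s

theorem stalkToField_germ_eq_algebraMap {V : Y.Opens} {y : Y} (hy : y ∈ V) (s : Γ(X, f ⁻¹ᵁ V))
    {x : X} (hx : x ∈ f ⁻¹ᵁ V) : stalkToField f y (germ (directImage f) y hy s) =
      algebraMap (X.presheaf.stalk x) (FunField f) (X.presheaf.germ (f ⁻¹ᵁ V) x hx s) :=
  (stalkToField_germ f hy s).trans (algebraMap_germ hx s).symm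

theorem stalkToField_toGeneric {y : Y} (t : Stalk (directImage f) y) :
    stalkToField f (genericPoint Y) (toGeneric _ y t) = stalkToField f y t := by
  obtain ⟨V, hy, s, rfl⟩ := exists_germ_eq _ t
  rw [toGeneric_germ]
  exact (stalkToField_germ f _ s).trans (stalkToField_germ f _ s).symm

theorem stalkToField_injective (y : Y) : Function.Injective (stalkToField f y) := by
  rw [injective_iff_map_eq_zero]
  intro t ht
  obtain ⟨V, hy, s, rfl⟩ := exists_germ_eq _ t
  have hs : s = (0 : Γ(X, f ⁻¹ᵁ V)) := germ_injective_of_isIntegral X _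
    (genericPoint_mem_preimage f hy) (((stalkToField_germ f hy s).symm.trans ht).trans
      (map_zero (X.presheaf.germ _ _ (genericPoint_mem_preimage f hy)).hom).symm)
  rw [hs]
  exact map_zero (TopCat.Presheaf.germ (directImage f).presheaf V y hy).hom

theorem mem_range_stalkToField_iff (hf : IsClosedMap f) {y : Y} {g : FunField f} :
    g ∈ LinearMap.range (stalkToField f y) ↔
      ∀ x, f x = y → g ∈ (algebraMap (X.presheaf.stalk x) (FunField f)).range := by
  constructor
  · rintro ⟨t, rfl⟩ x rfl
    obtain ⟨V, hy, s, rfl⟩ := exists_germ_eq _ t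
    exact ⟨_, (stalkToField_germ_eq_algebraMap f hy s hy).symm⟩
  · intro h
    let U : X.Opens := ⟨{x | g ∈ (algebraMap (X.presheaf.stalk x) (FunField f)).range}, by
      rw [isOpen_iff_mem_nhds]
      rintro x ⟨o, ho⟩
      obtain ⟨W, hxW, s, rfl⟩ := X.presheaf.exists_germ_eq o
      refine Filter.mem_of_superset (W.isOpen.mem_nhds hxW) fun z hz => ?_
      exact ⟨X.presheaf.germ W z hz s, (algebraMap_germ hz s).trans
        ((algebraMap_germ hxW s).symm.trans ho)⟩⟩
    obtain ⟨V, hy, hV⟩ := exists_preimage_le_of_isClosedMap hf (U := U) h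
    obtain ⟨s, hs⟩ := exists_germ_genericPoint_eq (f ⁻¹ᵁ V) (genericPoint_mem_preimage f hy) g
      fun x hx => hV hx
    exact ⟨germ (directImage f) y hy s, (stalkToField_germ f hy s).trans hs⟩

theorem exists_mem_maximalIdeal_pow_of_mem_stalkImage {D : X → ℕ} {x : X}
    {t : Stalk (directImage f) (f x)} (ht : t ∈ stalkImage f D (f x)) :
    ∃ o ∈ maximalIdeal (X.presheaf.stalk x) ^ D x,
      algebraMap _ (FunField f) o = stalkToField f (f x) t := by
  refine Submodule.span_induction
    (p := fun t _ => ∃ o ∈ maximalIdeal (X.presheaf.stalk x) ^ D x,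
      algebraMap _ (FunField f) o = stalkToField f (f x) t) ?_ ?_ ?_ ?_ ht
  · rintro t ⟨V, hy, s, hs, rfl⟩
    exact ⟨_, Ideal.mem_comap.mp ((Submodule.mem_iInf _).mp hs ⟨x, hy⟩),
      (stalkToField_germ_eq_algebraMap f hy s hy).symm⟩
  · exact ⟨0, zero_mem _, by rw [map_zero, map_zero]⟩
  · rintro a b - - ⟨o, ho, hoa⟩ ⟨p, hp, hpb⟩
    exact ⟨o + p, add_mem ho hp, by rw [map_add, map_add, hoa, hpb]⟩
  · rintro a b - ⟨o, ho, hob⟩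
    refine ⟨localMap rfl a * o, Ideal.mul_mem_left _ _ ho, ?_⟩
    rw [map_mul, map_smul, Algebra.smul_def, algebraMap_localMap, hob]

theorem mem_stalkImage_iff {y : Y} (D : X → ℕ) (hD : ∀ x, f x ≠ y → D x = 0)
    (t : Stalk (directImage f) y) : t ∈ stalkImage f D y ↔ ∀ x, f x = y →
      ∃ o ∈ maximalIdeal (X.presheaf.stalk x) ^ D x,
        algebraMap _ (FunField f) o = stalkToField f y t := by
  constructor
  · rintro ht x rfl
    exact exists_mem_maximalIdeal_pow_of_mem_stalkImage f ht
  · intro h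
    obtain ⟨V, hy, s, rfl⟩ := exists_germ_eq _ t
    refine Submodule.subset_span ⟨V, hy, s, ?_, rfl⟩
    refine (Submodule.mem_iInf _).mpr fun ⟨x, hx⟩ => Ideal.mem_comap.mpr ?_
    by_cases hxy : f x = y
    · obtain ⟨o, ho, hos⟩ := h x hxy
      have hgerm := IsFractionRing.injective (X.presheaf.stalk x) (FunField f)
        (hos.trans (stalkToField_germ_eq_algebraMap f hy s hx))
      rwa [← hgerm]
    · rw [hD x hxy, pow_zero, Ideal.one_eq_top]
      exact Submodule.mem_top

end DirectImage

end CurveBundle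

theorem finrank_span_image_basis {K W ι : Type*} [DivisionRing K] [AddCommGroup W] [Module K W]
    (b : Module.Basis ι K W) (s : Set ι) :
    Module.finrank K (Submodule.span K (b '' s)) = s.ncard := by
  rw [Set.image_eq_range, Module.finrank_eq_nat_card_basis
    (Module.Basis.span (v := fun p : s => b p)
      (b.linearIndependent.comp _ Subtype.val_injective)),
    Nat.card_coe_set_eq]

theorem quotientDim_span_image_basis {K W ι : Type*} [Field K] [AddCommGroup W] [Module K W]
    [Finite ι] (b : Module.Basis ι K W) {s t : Set ι} (hts : t ⊆ s) :
    CurveBundle.quotientDim (Submodule.span K (b '' s)) (Submodule.span K (b '' t)) =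
      (s \ t).ncard := by
  have : Module.Finite K W := .of_basis b
  have hle : Submodule.span K (b '' t) ≤ Submodule.span K (b '' s) :=
    Submodule.span_mono (Set.image_mono hts)
  have hquot := Submodule.finrank_quotient_add_finrank
    ((Submodule.span K (b '' t)).submoduleOf (Submodule.span K (b '' s)))
  rw [(Submodule.submoduleOfEquivOfLe hle).finrank_eq, finrank_span_image_basis,
    finrank_span_image_basis, ← Set.ncard_sdiff_add_ncard_of_subset hts] at hquot
  exact Nat.add_right_cancel hquot

section WeightFlag

variable {K W ι R : Type*} [Field K] [AddCommGroup W] [Module K W] [LinearOrder R]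
  (b : Module.Basis ι K W) (w : ι → R) (S : Finset R)

/-- The decreasing chain of the subspaces spanned by the basis vectors of weight at least `a`, for
`a` running increasingly through a finite set `S` of weights, followed by zero.  It is the model of
the parabolic filtration of a fibre. -/
noncomputable def weightFlag : Fin (S.card + 1) → Submodule K W :=
  Fin.lastCases ⊥ fun j => Submodule.span K (b '' {p | S.orderEmbOfFin rfl j ≤ w p})

theorem weightFlag_castSucc (j : Fin S.card) : weightFlag b w S j.castSucc =
    Submodule.span K (b '' {p | S.orderEmbOfFin rfl j ≤ w p}) :=
  Fin.lastCases_castSucc ..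

theorem weightFlag_last : weightFlag b w S (Fin.last _) = ⊥ :=
  Fin.lastCases_last ..

variable {w S}

theorem exists_orderEmbOfFin_eq (hS : ∀ a, a ∈ S ↔ ∃ p, w p = a) (p : ι) :
    ∃ j, S.orderEmbOfFin rfl j = w p := by
  rw [← Set.mem_range, Finset.range_orderEmbOfFin]
  exact (hS _).mpr ⟨p, rfl⟩

theorem weightFlag_succ (hS : ∀ a, a ∈ S ↔ ∃ p, w p = a) (j : Fin S.card) :
    weightFlag b w S j.succ =
      Submodule.span K (b '' {p | S.orderEmbOfFin rfl j < w p}) := by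
  rcases Fin.eq_castSucc_or_eq_last j.succ with ⟨l, hl⟩ | hl
  · rw [hl, weightFlag_castSucc]
    congr 2
    ext p
    obtain ⟨q, hq⟩ := exists_orderEmbOfFin_eq hS p
    have hval := congrArg Fin.val hl
    rw [Set.mem_ofPred_eq, Set.mem_ofPred_eq, ← hq, OrderEmbedding.le_iff_le,
      OrderEmbedding.lt_iff_lt, Fin.le_def, Fin.lt_def]
    simp only [Fin.val_succ, Fin.val_castSucc] at hval
    omega
  · rw [hl, weightFlag_last, eq_comm, Submodule.span_eq_bot]
    rintro _ ⟨p, hp, rfl⟩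
    obtain ⟨q, hq⟩ := exists_orderEmbOfFin_eq hS p
    have hval := congrArg Fin.val hl
    rw [Set.mem_ofPred_eq, ← hq, OrderEmbedding.lt_iff_lt, Fin.lt_def] at hp
    simp only [Fin.val_succ, Fin.val_last] at hval
    omega

theorem weightFlag_zero (hS : ∀ a, a ∈ S ↔ ∃ p, w p = a) (hne : S.Nonempty) :
    weightFlag b w S 0 = ⊤ := by
  have hzero : (0 : Fin (S.card + 1)) = (⟨0, hne.card_pos⟩ : Fin S.card).castSucc := rfl
  rw [hzero, weightFlag_castSucc, eq_top_iff, ← b.span_eq, ← Set.image_univ]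
  refine Submodule.span_mono (Set.image_mono fun p _ => ?_)
  obtain ⟨q, hq⟩ := exists_orderEmbOfFin_eq hS p
  rw [Set.mem_ofPred_eq, ← hq, OrderEmbedding.le_iff_le]
  exact Nat.zero_le _

theorem weightFlag_strictAnti (hS : ∀ a, a ∈ S ↔ ∃ p, w p = a) :
    StrictAnti (weightFlag b w S) := by
  rw [Fin.strictAnti_iff_succ_lt]
  intro j
  rw [weightFlag_succ b hS, weightFlag_castSucc]
  obtain ⟨p, hp⟩ := (hS _).mp (S.orderEmbOfFin_mem rfl j)
  have hsub : {p | S.orderEmbOfFin rfl j < w p} ⊆ {p | S.orderEmbOfFin rfl j ≤ w p} :=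
    Set.ofPred_subset_ofPred.mpr fun p => le_of_lt
  refine (Submodule.span_mono (Set.image_mono hsub)).lt_of_ne fun h => ?_
  have hbp : b p ∈ Submodule.span K (b '' {p | S.orderEmbOfFin rfl j ≤ w p}) :=
    Submodule.subset_span ⟨p, hp.ge, rfl⟩
  rw [← h, b.mem_span_image, b.repr_self, Finsupp.support_single p one_ne_zero] at hbp
  exact absurd hp (ne_of_gt (hbp (Finset.mem_singleton_self p)))

theorem quotientDim_weightFlag [Finite ι] (hS : ∀ a, a ∈ S ↔ ∃ p, w p = a) (j : Fin S.card) :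
    CurveBundle.quotientDim (weightFlag b w S j.castSucc) (weightFlag b w S j.succ) =
      {p | w p = S.orderEmbOfFin rfl j}.ncard := by
  rw [weightFlag_castSucc, weightFlag_succ b hS,
    quotientDim_span_image_basis b (Set.ofPred_subset_ofPred.mpr fun p => le_of_lt)]
  congr 1
  ext p
  exact ⟨fun hp => le_antisymm (not_lt.mp hp.2) hp.1, fun hp => ⟨hp.ge, hp.not_gt⟩⟩

theorem sum_weight_mul_quotientDim [Semiring R] [Fintype ι]
    (hS : ∀ a, a ∈ S ↔ ∃ p, w p = a) :
    ∑ j : Fin S.card, S.orderEmbOfFin rfl j *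
      (CurveBundle.quotientDim (weightFlag b w S j.castSucc) (weightFlag b w S j.succ) : R) =
      ∑ p, w p := by
  classical
  calc
    _ = ∑ j : Fin S.card, S.orderEmbOfFin rfl j *
        ((Finset.univ.filter fun p => w p = S.orderEmbOfFin rfl j).card : R) := by
      refine Finset.sum_congr rfl fun j _ => ?_
      rw [quotientDim_weightFlag b hS, ← Finset.coe_filter_univ, Set.ncard_coe_finset]
    _ = ∑ a ∈ S, a * ((Finset.univ.filter fun p => w p = a).card : R) := by
      conv_rhs => rw [← Finset.map_orderEmbOfFin_univ S rfl, Finset.sum_map]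
      rfl
    _ = ∑ a ∈ S, ∑ p with w p = a, w p := by
      refine Finset.sum_congr rfl fun a _ => ?_
      rw [Finset.sum_congr rfl fun p hp => (Finset.mem_filter.mp hp).2, Finset.sum_const,
        nsmul_eq_mul, Nat.cast_comm]
    _ = ∑ p, w p := Finset.sum_fiberwise_of_maps_to (fun p _ => (hS _).mpr ⟨p, rfl⟩) w

end WeightFlag

theorem baseChange_span_sup_smul_top {A B M : Type*} [CommRing A] [CommRing B] [Algebra A B]
    [AddCommGroup M] [Module A M] {I : Ideal A} (hI : I ≤ RingHom.ker (algebraMap A B))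
    (s : Set M) :
    (Submodule.span A s ⊔ I • (⊤ : Submodule A M)).baseChange B =
      Submodule.span B ((fun m => (1 : B) ⊗ₜ[A] m) '' s) := by
  have hbot : (I • (⊤ : Submodule A M)).map (TensorProduct.mk A B M 1) = ⊥ := by
    rw [Submodule.map_smul'', eq_bot_iff, Submodule.smul_le]
    rintro a ha _ -
    rw [Submodule.mem_bot, ← algebraMap_smul B, RingHom.mem_ker.mp (hI ha), zero_smul]
  rw [Submodule.baseChange_eq_span, Submodule.map_sup, hbot, sup_bot_eq, Submodule.map_span]
  exact Submodule.span_span_of_tower A B _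

theorem sum_fin_div (m : ℕ) : ∑ j : Fin m, (j : ℚ) / m = ((m - 1 : ℕ) : ℚ) / 2 := by
  rw [← Finset.sum_div, ← Nat.cast_sum, Fin.sum_univ_eq_sum_range fun j => j]
  obtain rfl | hm := m.eq_zero_or_pos
  · simp
  · have hgauss : ((∑ i ∈ Finset.range m, i : ℕ) : ℚ) * 2 = m * ((m - 1 : ℕ) : ℚ) := by
      exact_mod_cast Finset.sum_range_id_mul_two m
    field_simp
    linarith

namespace CurveBundle

section Weights

variable {X Y : Scheme.{u}} {f : X ⟶ Y}

theorem fiberDivisor_self (y : Y) (x : X) (j : ℕ) : fiberDivisor f y x j x = j :=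
  if_pos rfl

theorem fiberDivisor_of_ne {y : Y} {x z : X} (j : ℕ) (hzx : z ≠ x) (hz : f z = y) :
    fiberDivisor f y x j z = mult f z := by
  rw [fiberDivisor, if_neg hzx, if_pos hz]

theorem fiberDivisor_of_map_ne {y : Y} {x z : X} (j : ℕ) (hx : f x = y) (hz : f z ≠ y) :
    fiberDivisor f y x j z = 0 := by
  rw [fiberDivisor, if_neg (fun hzx : z = x => hz (hzx ▸ hx)), if_neg hz]

theorem mem_weightSet_iff (y : Y) (a : ℚ) : a ∈ weightSet f y ↔
    ∃ p : Σ x : {x : X // f x = y}, Fin (mult f x.1), (p.2 : ℚ) / mult f p.1.1 = a :=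
  ⟨fun ⟨x, j, hx, hj, h⟩ => ⟨⟨⟨x, hx⟩, ⟨j, hj⟩⟩, h.symm⟩, fun ⟨p, hp⟩ =>
    ⟨p.1.1, p.2, p.1.2, p.2.2, hp.symm⟩⟩

theorem mem_weightFinset_iff (y : Y) [Finite {x : X // f x = y}] (a : ℚ) :
    a ∈ weightFinset f y ↔
      ∃ p : Σ x : {x : X // f x = y}, Fin (mult f x.1), (p.2 : ℚ) / mult f p.1.1 = a := by
  have hrange : weightSet f y =
      Set.range fun p : Σ x : {x : X // f x = y}, Fin (mult f x.1) =>
        (p.2 : ℚ) / mult f p.1.1 := Set.ext (mem_weightSet_iff y)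
  have hfin : (weightSet f y).Finite := hrange ▸ Set.finite_range _
  rw [weightFinset, dif_pos hfin, Set.Finite.mem_toFinset]
  exact mem_weightSet_iff y a

theorem weightSubspace_eq_span {y : Y}
    (b : Module.Basis (Σ x : {x : X // f x = y}, Fin (mult f x.1)) (Kappa Y y)
      (Fiber (directImage f) y))
    (hb : ∀ (x : {x : X // f x = y}) (j : ℕ), j ≤ mult f x.1 →
      fiberSubspace f y x.1 j = Submodule.span (Kappa Y y) (b '' {p | p.1 = x ∧ j ≤ p.2}))
    (a : ℚ) : weightSubspace f y a =
      Submodule.span (Kappa Y y) (b '' {p | a ≤ (p.2 : ℚ) / mult f p.1.1}) := by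
  refine le_antisymm ?_ (Submodule.span_le.mpr ?_)
  · refine iSup₂_le fun x hx => iSup₂_le fun j hj => iSup_le fun ha => ?_
    rw [hb ⟨x, hx⟩ j hj.le]
    refine Submodule.span_mono (Set.image_mono fun ⟨p, l⟩ hp => ?_)
    obtain ⟨rfl, hjl⟩ := hp
    exact ha.trans (div_le_div_of_nonneg_right (by exact_mod_cast hjl) (Nat.cast_nonneg _))
  · rintro _ ⟨p, hp, rfl⟩
    have hbp : b p ∈ fiberSubspace f y p.1.1 p.2 := by
      rw [hb p.1 p.2 p.2.2.le]
      exact Submodule.subset_span ⟨p, ⟨rfl, le_rfl⟩, rfl⟩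
    exact Submodule.mem_iSup_of_mem p.1.1 (Submodule.mem_iSup_of_mem p.1.2
      (Submodule.mem_iSup_of_mem p.2.1 (Submodule.mem_iSup_of_mem p.2.2
        (Submodule.mem_iSup_of_mem hp hbp))))

end Weights

end CurveBundle

namespace SmoothProjectiveCurve

open CurveBundle

variable {k : Type u} [Field k] {X Y : SmoothProjectiveCurve k} {f : X.X ⟶ Y.X}

instance (y : closedPoints Y.X) : IsDiscreteValuationRing (Y.X.presheaf.stalk y.1) :=
  Y.isDiscreteValuationRing_stalk_of_ne (Y.mem_closedPoints_iff.mp y.2)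

variable [IsDominant f]

instance (y : closedPoints Y.X) (x : {x : X.X // f x = y.1}) :
    IsDiscreteValuationRing (X.X.presheaf.stalk x.1) :=
  X.isDiscreteValuationRing_stalk_of_ne
    (ne_genericPoint_of_map_ne f (x.2.trans_ne (Y.mem_closedPoints_iff.mp y.2)))

instance (y : Y.X) : FaithfulSMul (Y.X.presheaf.stalk y) (FunField f) :=
  .trans _ Y.X.functionField _

theorem isPlaceFamily_closedPoint (hf : f ≫ Y.str = X.str) (y : closedPoints Y.X) :
    IsPlaceFamily (Y.X.presheaf.stalk y.1) (FunField f)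
      fun x : {x : X.X // f x = y.1} => X.X.presheaf.stalk x.1 :=
  isPlaceFamily hf (Y.mem_closedPoints_iff.mp y.2)

section Finite

variable [FiniteDimensional Y.X.functionField (FunField f)]

instance (y : closedPoints Y.X) :
    IsFractionRing (integralClosure (Y.X.presheaf.stalk y.1) (FunField f)) (FunField f) :=
  integralClosure.isFractionRing_of_finite_extension Y.X.functionField _

variable [Algebra.IsSeparable Y.X.functionField (FunField f)]

instance (y : closedPoints Y.X) :
    IsDedekindDomain (integralClosure (Y.X.presheaf.stalk y.1) (FunField f)) :=
  integralClosure.isDedekindDomain _ Y.X.functionField _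

instance (y : closedPoints Y.X) :
    Module.Finite (Y.X.presheaf.stalk y.1)
      (integralClosure (Y.X.presheaf.stalk y.1) (FunField f)) :=
  IsIntegralClosure.finite _ Y.X.functionField (FunField f) _

theorem finite_fiber (hf : f ≫ Y.str = X.str) (y : closedPoints Y.X) :
    Finite {x : X.X // f x = y.1} :=
  (isPlaceFamily_closedPoint hf y).finite

theorem range_stalkToField (hf : f ≫ Y.str = X.str) (y : closedPoints Y.X) :
    LinearMap.range (stalkToField f y.1) =
      Subalgebra.toSubmodule (integralClosure (Y.X.presheaf.stalk y.1) (FunField f)) := by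
  ext g
  rw [mem_range_stalkToField_iff f (isClosedMap hf), Subalgebra.mem_toSubmodule,
    (isPlaceFamily_closedPoint hf y).mem_integralClosure_iff]
  exact ⟨fun h x => h x.1 x.2, fun h x hx => h ⟨x, hx⟩⟩

/-- The stalk of `f_* 𝒪_X` at a closed point `y`, identified with the integral closure of `𝒪_{Y, y}`
in the function field of `X`. -/
noncomputable def stalkEquiv (hf : f ≫ Y.str = X.str) (y : closedPoints Y.X) :
    Stalk (directImage f) y.1 ≃ₗ[Y.X.presheaf.stalk y.1]
      integralClosure (Y.X.presheaf.stalk y.1) (FunField f) :=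
  LinearEquiv.ofInjective _ (stalkToField_injective f y.1) ≪≫ₗ
    LinearEquiv.ofEq _ _ (range_stalkToField hf y)

theorem coe_stalkEquiv (hf : f ≫ Y.str = X.str) (y : closedPoints Y.X)
    (t : Stalk (directImage f) y.1) : (stalkEquiv hf y t : FunField f) = stalkToField f y.1 t :=
  rfl

theorem stalkEquiv_mem_center_pow_iff (hf : f ≫ Y.str = X.str) (y : closedPoints Y.X)
    (t : Stalk (directImage f) y.1) (x : {x : X.X // f x = y.1}) (n : ℕ) :
    stalkEquiv hf y t ∈ (isPlaceFamily_closedPoint hf y).center x ^ n ↔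
      ∃ o ∈ maximalIdeal (X.X.presheaf.stalk x.1) ^ n,
        algebraMap _ (FunField f) o = stalkToField f y.1 t := by
  have hplace := (isPlaceFamily_closedPoint hf y).algebraMap_placeMap x (stalkEquiv hf y t)
  rw [(isPlaceFamily_closedPoint hf y).mem_center_pow_iff, ← coe_stalkEquiv hf]
  exact ⟨fun h => ⟨_, h, hplace⟩, fun ⟨o, ho, hot⟩ =>
    IsFractionRing.injective (X.X.presheaf.stalk x.1) (FunField f) (hot.trans hplace.symm) ▸ ho⟩

theorem mem_stalkImage_fiberDivisor_iff (hf : f ≫ Y.str = X.str) (y : closedPoints Y.X)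
    (x : {x : X.X // f x = y.1}) (j : ℕ) (t : Stalk (directImage f) y.1) :
    t ∈ stalkImage f (fiberDivisor f y.1 x.1 j) y.1 ↔
      stalkEquiv hf y t ∈ (isPlaceFamily_closedPoint hf y).center x ^ j ∧ ∀ z, z ≠ x →
        stalkEquiv hf y t ∈ (isPlaceFamily_closedPoint hf y).center z ^ mult f z.1 := by
  rw [mem_stalkImage_iff f _ fun z => fiberDivisor_of_map_ne j x.2]
  simp_rw [stalkEquiv_mem_center_pow_iff]
  constructor
  · refine fun h => ⟨?_, fun z hz => ?_⟩
    · simpa only [fiberDivisor_self] using h x.1 x.2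
    · simpa only [fiberDivisor_of_ne j (Subtype.coe_ne_coe.mpr hz) z.2] using h z.1 z.2
  · rintro ⟨hx, hother⟩ z hz
    by_cases hzx : z = x.1
    · subst hzx
      simpa only [fiberDivisor_self] using hx
    · simpa only [fiberDivisor_of_ne j hzx hz] using
        hother ⟨z, hz⟩ fun h => hzx (congrArg Subtype.val h)

variable [IsAlgClosed k]

theorem isSplitFactorization (hf : f ≫ Y.str = X.str) (y : closedPoints Y.X)
    [Fintype {x : X.X // f x = y.1}] :
    IsSplitFactorization (Y.X.presheaf.stalk y.1) (isPlaceFamily_closedPoint hf y).center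
      fun x => mult f x.1 := by
  simp_rw [fun x : {x : X.X // f x = y.1} => mult_eq_ramIdx x.2]
  exact (isPlaceFamily_closedPoint hf y).isSplitFactorization

theorem exists_basis_stalkImage_eq (hf : f ≫ Y.str = X.str) (y : closedPoints Y.X) :
    ∃ b : Module.Basis (Σ x : {x : X.X // f x = y.1}, Fin (mult f x.1)) (Y.X.presheaf.stalk y.1)
        (Stalk (directImage f) y.1),
      ∀ (x : {x : X.X // f x = y.1}) (j : ℕ), j ≤ mult f x.1 →
        stalkImage f (fiberDivisor f y.1 x.1 j) y.1 =
          Submodule.span _ (b '' {p | p.1 = x ∧ j ≤ p.2}) ⊔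
            maximalIdeal (Y.X.presheaf.stalk y.1) • ⊤ := by
  have := finite_fiber hf y
  have := Fintype.ofFinite {x : X.X // f x = y.1}
  have hsplit := isSplitFactorization hf y
  obtain ⟨b, hb⟩ := hsplit.exists_adaptedSystem
  refine ⟨(hsplit.basis hb).map (stalkEquiv hf y).symm, fun x j hj => ?_⟩
  calc stalkImage f (fiberDivisor f y.1 x.1 j) y.1
      = (Submodule.span _ (hsplit.basis hb '' {p | p.1 = x ∧ j ≤ p.2}) ⊔
          maximalIdeal (Y.X.presheaf.stalk y.1) • ⊤).map
            (stalkEquiv hf y).symm.toLinearMap := by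
        ext t
        rw [mem_stalkImage_fiberDivisor_iff hf, hsplit.mem_pow_iff_mem_span_sup hb x j hj]
        exact (Submodule.mem_map_equiv (e := (stalkEquiv hf y).symm) _).symm
    _ = _ := by
        rw [Submodule.map_sup, Submodule.map_span, Submodule.map_smul'', Submodule.map_top,
          LinearEquiv.range, Set.image_image]
        rfl

theorem exists_basis_fiberSubspace_eq (hf : f ≫ Y.str = X.str) (y : closedPoints Y.X) :
    ∃ b : Module.Basis (Σ x : {x : X.X // f x = y.1}, Fin (mult f x.1)) (Kappa Y.X y.1)
        (Fiber (directImage f) y.1),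
      ∀ (x : {x : X.X // f x = y.1}) (j : ℕ), j ≤ mult f x.1 →
        fiberSubspace f y.1 x.1 j =
          Submodule.span (Kappa Y.X y.1) (b '' {p | p.1 = x ∧ j ≤ p.2}) := by
  obtain ⟨b, hb⟩ := exists_basis_stalkImage_eq hf y
  refine ⟨b.baseChange _, fun x j hj => ?_⟩
  have himage : b.baseChange (Kappa Y.X y.1) '' {p | p.1 = x ∧ j ≤ p.2} =
      (fun t => (1 : Kappa Y.X y.1) ⊗ₜ[Y.X.presheaf.stalk y.1] t) ''
        (b '' {p | p.1 = x ∧ j ≤ p.2}) :=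
    (Set.image_congr fun p _ => b.baseChange_apply _ p).trans (Set.image_image _ _ _).symm
  have hker : maximalIdeal (Y.X.presheaf.stalk y.1) ≤
      RingHom.ker (algebraMap (Y.X.presheaf.stalk y.1) (Kappa Y.X y.1)) := ker_residue.ge
  rw [fiberSubspace, hb x j hj, himage]
  exact baseChange_span_sup_smul_top hker _

theorem exists_basis_flag_eq_weightFlag (hf : f ≫ Y.str = X.str) (y : closedPoints Y.X) :
    ∃ b : Module.Basis (Σ x : {x : X.X // f x = y.1}, Fin (mult f x.1)) (Kappa Y.X y.1)
        (Fiber (directImage f) y.1),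
      (directImageParabolic f).flag y.1 =
        weightFlag b (fun p => (p.2 : ℚ) / mult f p.1.1) (weightFinset f y.1) := by
  obtain ⟨b, hb⟩ := exists_basis_fiberSubspace_eq hf y
  exact ⟨b, congrArg (Fin.lastCases (motive := fun _ => Submodule (Kappa Y.X y.1) _) ⊥)
    (funext fun j => weightSubspace_eq_span b hb _)⟩

theorem sum_weight_mul_multiplicity (hf : f ≫ Y.str = X.str) (y : closedPoints Y.X)
    [Fintype {x : X.X // f x = y.1}] :
    ∑ j, (directImageParabolic f).weight y.1 j *
        ((directImageParabolic f).multiplicity y.1 j : ℚ) =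
      (∑ x : {x : X.X // f x = y.1}, ((mult f x.1 - 1 : ℕ) : ℚ)) / 2 := by
  obtain ⟨b, hb⟩ := exists_basis_flag_eq_weightFlag hf y
  have hsum := sum_weight_mul_quotientDim b (mem_weightFinset_iff y.1)
  rw [← hb] at hsum
  refine hsum.trans ?_
  rw [Fintype.sum_sigma, Finset.sum_div]
  exact Finset.sum_congr rfl fun x _ => sum_fin_div _

end Finite

end SmoothProjectiveCurve

section RatFunc

variable {k K : Type*} [Field k] [Field K] [Algebra k K]

section

variable [Algebra (RatFunc k) K] [IsScalarTower k (RatFunc k) K]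

theorem span_D_X_eq_top [Algebra.IsSeparable (RatFunc k) K] :
    Submodule.span K {KaehlerDifferential.D k K (algebraMap (RatFunc k) K RatFunc.X)} = ⊤ := by
  let := ((algebraMap (RatFunc k) K).comp (algebraMap (Polynomial k) (RatFunc k))).toAlgebra
  have : IsScalarTower (Polynomial k) (RatFunc k) K := .of_algebraMap_eq fun _ => rfl
  have : IsScalarTower k (Polynomial k) K := .of_algebraMap_eq fun a => by
    rw [IsScalarTower.algebraMap_apply (Polynomial k) (RatFunc k) K,
      ← IsScalarTower.algebraMap_apply k (Polynomial k) (RatFunc k),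
      ← IsScalarTower.algebraMap_apply k (RatFunc k) K]
  have : Algebra.FormallyUnramified (Polynomial k) (RatFunc k) :=
    .of_isLocalization (nonZeroDivisors (Polynomial k))
  have : Algebra.FormallyUnramified (RatFunc k) K := .of_isSeparable _ _
  have : Algebra.FormallyUnramified (Polynomial k) K := .comp _ (RatFunc k) _
  have hsurj : LinearMap.range (KaehlerDifferential.mapBaseChange k (Polynomial k) K) = ⊤ := by
    rw [KaehlerDifferential.range_mapBaseChange, eq_top_iff]
    exact fun ω _ => Subsingleton.elim _ _
  rw [eq_top_iff, ← hsurj]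
  rintro _ ⟨ω, rfl⟩
  induction ω with
  | zero => rw [map_zero]; exact zero_mem _
  | add ω η hω hη => rw [map_add]; exact add_mem hω hη
  | tmul b ω =>
    have hω : ω = KaehlerDifferential.polynomialEquiv k ω • KaehlerDifferential.D k _ .X :=
      (KaehlerDifferential.polynomialEquiv k).injective (by simp)
    rw [KaehlerDifferential.mapBaseChange_tmul, hω, map_smul, KaehlerDifferential.map_D,
      ← algebraMap_smul K (KaehlerDifferential.polynomialEquiv k ω), smul_smul,
      ← RatFunc.algebraMap_X, ← IsScalarTower.algebraMap_apply (Polynomial k) (RatFunc k) K]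
    exact Submodule.smul_mem _ _ (Submodule.mem_span_singleton_self _)

theorem span_D_eq_top_of_ne_zero [Algebra.IsSeparable (RatFunc k) K] {g : K}
    (hg : KaehlerDifferential.D k K g ≠ 0) :
    Submodule.span K {KaehlerDifferential.D k K g} = ⊤ := by
  have hX := span_D_X_eq_top (k := k) (K := K)
  obtain ⟨c, hc⟩ := Submodule.mem_span_singleton.mp (hX.ge (Submodule.mem_top
    (x := KaehlerDifferential.D k K g)))
  have hc0 : c ≠ 0 := by
    rintro rfl
    exact hg (by rw [← hc, zero_smul])
  rw [← hc, Submodule.span_singleton_smul_eq hc0.isUnit, hX]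

theorem D_X_ne_zero [Algebra.EssFiniteType k K] [Algebra.IsSeparable (RatFunc k) K] :
    KaehlerDifferential.D k K (algebraMap (RatFunc k) K RatFunc.X) ≠ 0 := by
  intro h
  have hspan := span_D_X_eq_top (k := k) (K := K)
  rw [h, Submodule.span_zero_singleton] at hspan
  have : Algebra.FormallyUnramified k K :=
    ⟨(Submodule.subsingleton_iff K).mp (subsingleton_of_bot_eq_top hspan)⟩
  have := Algebra.FormallyUnramified.isSeparable k K
  refine RatFunc.transcendental_X (K := k) ?_
  exact (isAlgebraic_algebraMap_iff (algebraMap (RatFunc k) K).injective).mp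
    (Algebra.IsAlgebraic.isAlgebraic _)

theorem finiteDimensional_isSeparable_of_span_D_X_eq_top [Algebra.EssFiniteType k K]
    (h : Submodule.span K {KaehlerDifferential.D k K (algebraMap (RatFunc k) K RatFunc.X)} = ⊤) :
    FiniteDimensional (RatFunc k) K ∧ Algebra.IsSeparable (RatFunc k) K := by
  have : Algebra.EssFiniteType (RatFunc k) K := .of_comp k _ _
  have hzero (ω : Ω[K⁄RatFunc k]) : ω = 0 := by
    obtain ⟨η, rfl⟩ := KaehlerDifferential.map_surjective k (RatFunc k) K ω
    obtain ⟨c, rfl⟩ := Submodule.mem_span_singleton.mp (h.ge (Submodule.mem_top (x := η)))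
    rw [map_smul, KaehlerDifferential.map_D, Algebra.algebraMap_self_apply,
      Derivation.map_algebraMap, smul_zero]
  have : Algebra.FormallyUnramified (RatFunc k) K := ⟨⟨fun ω η => (hzero ω).trans (hzero η).symm⟩⟩
  exact ⟨Algebra.FormallyUnramified.finite_of_free _ _,
    Algebra.FormallyUnramified.isSeparable _ _⟩

theorem finrank_eq_finrank_adjoin_X :
    Module.finrank (RatFunc k) K =
      Module.finrank (IntermediateField.adjoin k {algebraMap (RatFunc k) K RatFunc.X}) K := by
  let φ := IsScalarTower.toAlgHom k (RatFunc k) K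
  have hrange : φ.fieldRange = IntermediateField.adjoin k {algebraMap (RatFunc k) K RatFunc.X} := by
    rw [AlgHom.fieldRange_eq_map, ← RatFunc.adjoin_X, IntermediateField.adjoin_map,
      Set.image_singleton]
    rfl
  rw [← hrange]
  exact Algebra.finrank_eq_of_equiv_equiv (AlgEquiv.ofInjectiveField φ).toRingEquiv (.refl K) rfl

end

theorem transcendental_of_D_ne_zero [IsAlgClosed k] {g : K}
    (hg : KaehlerDifferential.D k K g ≠ 0) : Transcendental k g := by
  intro h
  obtain ⟨a, rfl⟩ := h.isIntegral.mem_range_algebraMap_of_minpoly_splits (K := k)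
    (IsAlgClosed.splits _)
  exact hg (Derivation.map_algebraMap _ a)

theorem exists_finite_isSeparable_ratFunc_of_span_D_eq_top [Algebra.EssFiniteType k K] {g : K}
    (hg : Transcendental k g) (h : Submodule.span K {KaehlerDifferential.D k K g} = ⊤) :
    ∃ _ : Algebra (RatFunc k) K, IsScalarTower k (RatFunc k) K ∧
      algebraMap (RatFunc k) K RatFunc.X = g ∧ FiniteDimensional (RatFunc k) K ∧
      Algebra.IsSeparable (RatFunc k) K := by
  let φ : RatFunc k →ₐ[k] K := (IntermediateField.val _).comp
    (RatFunc.algEquivOfTranscendental g hg).toAlgHom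
  let := φ.toRingHom.toAlgebra
  have : IsScalarTower k (RatFunc k) K := .of_algebraMap_eq fun a => (φ.commutes a).symm
  have hX : algebraMap (RatFunc k) K RatFunc.X = g := RatFunc.algEquivOfTranscendental_X g hg
  exact ⟨_, this, hX, finiteDimensional_isSeparable_of_span_D_X_eq_top (hX ▸ h)⟩

end RatFunc

/-- The local ring of the affine line at the origin, as the subring of `k(X)` of the fractions whose
denominator does not vanish at `0`; it receives the local rings of a curve at the zeros of `X`. -/
noncomputable def AffineLineStalk (k : Type*) [Field k] : Subalgebra (Polynomial k) (RatFunc k) :=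
  Localization.subalgebra.ofField (RatFunc k) (Polynomial.idealX k).asIdeal.primeCompl
    (Polynomial.idealX k).asIdeal.primeCompl_le_nonZeroDivisors

namespace AffineLineStalk

variable (k : Type*) [Field k]

instance : IsLocalization.AtPrime (AffineLineStalk k) (Polynomial.idealX k).asIdeal :=
  Localization.subalgebra.isLocalization_ofField _ _ _

instance : IsFractionRing (AffineLineStalk k) (RatFunc k) :=
  Localization.subalgebra.isFractionRing_ofField _ _ _

instance : IsLocalRing (AffineLineStalk k) :=
  IsLocalization.AtPrime.isLocalRing _ (Polynomial.idealX k).asIdeal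

instance : IsDiscreteValuationRing (AffineLineStalk k) :=
  IsLocalization.AtPrime.isDiscreteValuationRing_of_dedekind_domain (Polynomial k)
    (Polynomial.idealX k).ne_bot _

instance [IsAlgClosed k] : IsAlgClosed (ResidueField (AffineLineStalk k)) := by
  have e : (Polynomial k ⧸ (Polynomial.idealX k).asIdeal) ≃+* k :=
    (Ideal.quotEquivOfEq (by simp [Polynomial.idealX_span])).trans
      (Polynomial.quotientSpanXSubCAlgEquiv (0 : k)).toRingEquiv
  have := (Polynomial.idealX k).isMaximal
  exact .of_ringEquiv k _ (e.symm.trans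
    (IsLocalization.AtPrime.equivQuotMaximalIdeal (Polynomial.idealX k).asIdeal _))

theorem maximalIdeal_eq_span : maximalIdeal (AffineLineStalk k) =
    Ideal.span {algebraMap (Polynomial k) _ Polynomial.X} := by
  rw [← IsLocalization.AtPrime.map_eq_maximalIdeal (Polynomial.idealX k).asIdeal,
    Polynomial.idealX_span, Ideal.map_span, Set.image_singleton]

theorem irreducible_X : Irreducible (algebraMap (Polynomial k) (AffineLineStalk k) Polynomial.X) :=
  (IsDiscreteValuationRing.irreducible_iff_uniformizer _).mpr (maximalIdeal_eq_span k)

variable {k} in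
theorem exists_isLocalHom {O : Type*} [CommRing O] [IsLocalRing O] [Algebra k O] {o : O}
    (ho : o ∈ maximalIdeal O) : ∃ g : AffineLineStalk k →+* O, IsLocalHom g ∧
      ∀ p, g (algebraMap (Polynomial k) _ p) = Polynomial.aeval o p := by
  have hcomap : (Polynomial.idealX k).asIdeal =
      (maximalIdeal O).comap (Polynomial.aeval (R := k) o).toRingHom := by
    refine (Polynomial.idealX k).isMaximal.eq_of_le (Ideal.IsPrime.ne_top inferInstance) ?_
    rw [Polynomial.idealX_span, Ideal.span_singleton_le_iff_mem]
    simpa using ho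
  have hunit (p : (Polynomial.idealX k).asIdeal.primeCompl) :
      IsUnit ((Polynomial.aeval (R := k) o).toRingHom p) :=
    notMem_maximalIdeal.mp fun hp => p.2 (hcomap.ge hp)
  refine ⟨IsLocalization.lift hunit, ((local_hom_TFAE _).out 0 2).mpr ?_,
    IsLocalization.lift_eq hunit⟩
  rw [maximalIdeal_eq_span, Ideal.map_span, Set.image_singleton, Ideal.span_singleton_le_iff_mem,
    IsLocalization.lift_eq]
  simpa using ho

end AffineLineStalk

theorem algebraMap_stalk_surjective_of_eq_genericPoint {X : Scheme.{u}} [IsIntegral X] {x : X}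
    (hx : x = genericPoint X) :
    Function.Surjective (algebraMap (X.presheaf.stalk x) X.functionField) := by
  have hfield : IsField (X.presheaf.stalk x) := hx ▸ Field.toIsField X.functionField
  exact (hfield.localization_map_bijective zero_notMem_nonZeroDivisors).2

namespace SmoothProjectiveCurve

variable {k : Type u} [Field k] (C : SmoothProjectiveCurve k)

instance : AlgebraicGeometry.IsNoetherian C.X where
  toCompactSpace := QuasiCompact.compactSpace_of_compactSpace C.str

theorem finite_of_isClosed {Z : Set C.X} (hZ : IsClosed Z) (hη : genericPoint C.X ∉ Z) :
    Z.Finite := by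
  obtain ⟨S, hS, hclosed, hirred, rfl⟩ :=
    TopologicalSpace.NoetherianSpace.exists_finite_set_isClosed_irreducible hZ
  refine hS.sUnion fun T hT => ?_
  obtain ⟨x, hx⟩ := QuasiSober.sober (hirred T hT) (hclosed T hT)
  have hxη : x ≠ genericPoint C.X := by
    rintro rfl
    exact hη ⟨T, hT, hx.mem⟩
  rw [← hx.def, (C.isClosed_singleton_of_ne hxη).closure_eq]
  exact Set.finite_singleton x

noncomputable instance (x : C.X) : Algebra k (C.X.presheaf.stalk x) :=
  (C.stalkHom x).toAlgebra

noncomputable instance : Algebra k C.X.functionField :=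
  C.constHom.toAlgebra

instance (x : C.X) : IsScalarTower k (C.X.presheaf.stalk x) C.X.functionField :=
  .of_algebraMap_eq fun a => (C.algebraMap_stalkHom x a).symm

instance : Algebra.EssFiniteType k C.X.functionField := by
  obtain ⟨_, hC, _, _⟩ := C.exists_finite_isSeparable_ratFunc
  have : IsScalarTower k (RatFunc k) C.X.functionField := .of_algebraMap_eq fun a => (hC a).symm
  have : Algebra.EssFiniteType (RatFunc k) C.X.functionField := inferInstance
  exact .comp k (RatFunc k) _

variable {C}

theorem finite_ord_ne_zero {g : C.X.functionField} (hg : g ≠ 0) :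
    {x ∈ closedPoints C.X | Scheme.ord g x ≠ 0}.Finite := by
  obtain ⟨U, -, s, ⟨x, hx⟩, hs, hu⟩ := exists_isUnit_germ_eq C.X g hg
  refine (C.finite_of_isClosed (Z := (U : Set C.X)ᶜ) U.isOpen.isClosed_compl fun h => h
    (((genericPoint_spec C.X).specializes trivial).mem_open U.isOpen hx)).subset ?_
  intro z ⟨hz, hord⟩ hzU
  have := C.isDiscreteValuationRing_stalk_of_ne (C.mem_closedPoints_iff.mp hz)
  rw [C.ord_eq_ordZ (C.mem_closedPoints_iff.mp hz)] at hord
  exact hord ((ordZ_eq_zero_iff hg).mpr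
    ⟨C.X.presheaf.germ U z hzU s, hu.map _, (algebraMap_germ hzU s).trans hs⟩)

theorem finite_support_ord {g : C.X.functionField} (hg : g ≠ 0) :
    (Function.support fun x : closedPoints C.X => Scheme.ord g x.1).Finite :=
  .of_finite_image (f := Subtype.val) ((finite_ord_ne_zero hg).subset
    (Set.image_subset_iff.mpr fun x hx => ⟨x.2, hx⟩)) Subtype.val_injective.injOn

theorem ord_eq_ordZ_closedPoint (g : C.X.functionField) (x : closedPoints C.X) :
    Scheme.ord g x.1 = ordZ (C.X.presheaf.stalk x.1) g :=
  C.ord_eq_ordZ (C.mem_closedPoints_iff.mp x.2) g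

theorem ord_pos_iff {g : C.X.functionField} (hg : g ≠ 0) (x : closedPoints C.X) :
    0 < Scheme.ord g x.1 ↔ ∃ o ∈ maximalIdeal (C.X.presheaf.stalk x.1), algebraMap _ _ o = g := by
  rw [ord_eq_ordZ_closedPoint, ← Int.add_one_le_iff, zero_add, ← Nat.cast_one,
    natCast_le_ordZ_iff hg, pow_one]

theorem ord_mul {g h : C.X.functionField} (hg : g ≠ 0) (hh : h ≠ 0) (x : closedPoints C.X) :
    Scheme.ord (g * h) x.1 = Scheme.ord g x.1 + Scheme.ord h x.1 := by
  simp only [ord_eq_ordZ_closedPoint, ordZ_mul hg hh]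

theorem ord_inv {g : C.X.functionField} (hg : g ≠ 0) (x : closedPoints C.X) :
    Scheme.ord g⁻¹ x.1 = - Scheme.ord g x.1 := by
  simp only [ord_eq_ordZ_closedPoint, ordZ_inv hg]

theorem exists_ord_pos_of_inv_notMem {R : ValuationSubring C.X.functionField}
    (hR : ∀ a, C.constHom a ∈ R) {g : C.X.functionField} (hg : g⁻¹ ∉ R) :
    ∃ x : closedPoints C.X, 0 < Scheme.ord g x.1 ∧
      ∀ z, z ∈ R ↔ z ∈ (algebraMap (C.X.presheaf.stalk x.1) C.X.functionField).range := by
  obtain ⟨x, φ, hφ, hφx⟩ := C.exists_isLocalHom_stalk R hR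
  have hx : x ∈ closedPoints C.X := by
    rw [C.mem_closedPoints_iff]
    intro hη
    obtain ⟨o, ho⟩ := algebraMap_stalk_surjective_of_eq_genericPoint hη g⁻¹
    exact hg (ho ▸ (hφx o).subst (φ o).2)
  have := C.isDiscreteValuationRing_stalk_of_ne (C.mem_closedPoints_iff.mp hx)
  have hmem := mem_valuationSubring_iff_of_isLocalHom φ hφx
  have hg0 : g ≠ 0 := fun h => hg (by rw [h, inv_zero]; exact zero_mem R)
  refine ⟨⟨x, hx⟩, ?_, hmem⟩
  by_contra! hord
  rw [← neg_nonneg, ← ord_inv hg0, ord_eq_ordZ_closedPoint, ordZ_nonneg_iff (inv_ne_zero hg0)]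
    at hord
  exact hg ((hmem _).mpr hord)

section Zeros

variable [Algebra (RatFunc k) C.X.functionField] [IsScalarTower k (RatFunc k) C.X.functionField]

theorem isPlaceFamily_ord_pos : IsPlaceFamily (AffineLineStalk k) C.X.functionField
    fun x : {x : closedPoints C.X //
      0 < Scheme.ord (algebraMap (RatFunc k) C.X.functionField RatFunc.X) x.1} =>
        C.X.presheaf.stalk x.1.1 where
  dominates := by
    rintro ⟨x, hx⟩
    obtain ⟨o, ho, hoX⟩ := (ord_pos_iff (by simp [RatFunc.X_ne_zero]) x).mp hx
    obtain ⟨g, hg, hgp⟩ := AffineLineStalk.exists_isLocalHom (k := k) ho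
    have hφ : ((algebraMap _ C.X.functionField).comp g).comp
        (algebraMap (Polynomial k) (AffineLineStalk k)) =
          (algebraMap _ _).comp (algebraMap (Polynomial k) (AffineLineStalk k)) := by
      ext a
      · change algebraMap _ C.X.functionField (g (algebraMap (Polynomial k) _ (.C a))) = _
        rw [hgp, Polynomial.aeval_C]
        exact (IsScalarTower.algebraMap_apply k _ C.X.functionField a).symm.trans
          (IsScalarTower.algebraMap_apply k (RatFunc k) _ a)
      · change algebraMap _ C.X.functionField (g (algebraMap (Polynomial k) _ .X)) = _
        rw [hgp, Polynomial.aeval_X, hoX]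
        rfl
    exact ⟨g, hg, DFunLike.congr_fun
      (IsLocalization.ringHom_ext (Polynomial.idealX k).asIdeal.primeCompl hφ)⟩
  injective x x' h := Subtype.ext (Subtype.ext (C.eq_of_range_algebraMap_stalk_eq h))
  exhaustive R hR hinv := by
    have hconst (a : k) : C.constHom a ∈ R := by
      have ha := hR (algebraMap (Polynomial k) _ (.C a))
      rwa [show algebraMap _ _ (algebraMap (Polynomial k) (AffineLineStalk k) (.C a)) =
        C.constHom a from (IsScalarTower.algebraMap_apply k (RatFunc k) C.X.functionField a).symm]
        at ha
    obtain ⟨x, hx, hmem⟩ := exists_ord_pos_of_inv_notMem hconst <|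
      hinv (algebraMap (Polynomial k) _ .X)
        ((mem_maximalIdeal _).mpr (AffineLineStalk.irreducible_X k).not_isUnit)
        (AffineLineStalk.irreducible_X k).ne_zero
    exact ⟨⟨x, hx⟩, hmem⟩

theorem finsum_max_ord_X [IsAlgClosed k] [FiniteDimensional (RatFunc k) C.X.functionField]
    [Algebra.IsSeparable (RatFunc k) C.X.functionField] :
    ∑ᶠ x : closedPoints C.X,
      max (Scheme.ord (algebraMap (RatFunc k) C.X.functionField RatFunc.X) x.1) 0 =
        Module.finrank (RatFunc k) C.X.functionField := by
  have hX : algebraMap (RatFunc k) C.X.functionField RatFunc.X =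
      algebraMap (AffineLineStalk k) _ (algebraMap (Polynomial k) _ .X) := rfl
  set g := algebraMap (RatFunc k) C.X.functionField RatFunc.X
  have h : IsPlaceFamily (AffineLineStalk k) C.X.functionField
      fun x : {x : closedPoints C.X // 0 < Scheme.ord g x.1} => C.X.presheaf.stalk x.1.1 :=
    isPlaceFamily_ord_pos
  have : FaithfulSMul (AffineLineStalk k) C.X.functionField := .trans _ (RatFunc k) _
  have := integralClosure.isDedekindDomain (AffineLineStalk k) (RatFunc k) C.X.functionField
  have := integralClosure.isFractionRing_of_finite_extension (A := AffineLineStalk k) (RatFunc k)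
    C.X.functionField
  have := IsIntegralClosure.finite (AffineLineStalk k) (RatFunc k) C.X.functionField
    (integralClosure (AffineLineStalk k) C.X.functionField)
  have := h.finite
  have := Fintype.ofFinite {x : closedPoints C.X // 0 < Scheme.ord g x.1}
  rw [← h.sum_ordZ_algebraMap (K := RatFunc k) (AffineLineStalk.irreducible_X k), ← hX,
    ← finsum_eq_sum_of_fintype]
  simp_rw [← ord_eq_ordZ_closedPoint]
  rw [finsum_subtype_eq_finsum_cond (f := fun x : closedPoints C.X => Scheme.ord g x.1)
    fun x => 0 < Scheme.ord g x.1]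
  refine finsum_congr fun x => ?_
  by_cases hx : 0 < Scheme.ord g x.1
  · rw [max_eq_left hx.le, finsum_eq_if, if_pos hx]
  · rw [max_eq_right (not_lt.mp hx), finsum_eq_if, if_neg hx]

end Zeros

variable [IsAlgClosed k]

theorem finsum_max_ord_eq_finrank {g : C.X.functionField} (hg : KaehlerDifferential.D k _ g ≠ 0) :
    ∑ᶠ x : closedPoints C.X, max (Scheme.ord g x.1) 0 =
      Module.finrank (IntermediateField.adjoin k {g}) C.X.functionField := by
  have hspan : Submodule.span C.X.functionField {KaehlerDifferential.D k _ g} = ⊤ := by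
    obtain ⟨_, hC, _, _⟩ := C.exists_finite_isSeparable_ratFunc
    have : IsScalarTower k (RatFunc k) C.X.functionField := .of_algebraMap_eq fun a => (hC a).symm
    exact span_D_eq_top_of_ne_zero hg
  obtain ⟨_, _, rfl, _, _⟩ :=
    exists_finite_isSeparable_ratFunc_of_span_D_eq_top (transcendental_of_D_ne_zero hg) hspan
  rw [finsum_max_ord_X, finrank_eq_finrank_adjoin_X]

theorem finsum_ord_eq_zero_of_D_ne_zero {g : C.X.functionField}
    (hg : KaehlerDifferential.D k _ g ≠ 0) : ∑ᶠ x : closedPoints C.X, Scheme.ord g x.1 = 0 := by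
  have hg0 : g ≠ 0 := by
    rintro rfl
    exact hg (map_zero _)
  have hinv : KaehlerDifferential.D k _ g⁻¹ ≠ 0 := by
    rw [Derivation.leibniz_inv]
    exact smul_ne_zero (neg_ne_zero.mpr (pow_ne_zero 2 (inv_ne_zero hg0))) hg
  have hadjoin : IntermediateField.adjoin k {g⁻¹} = IntermediateField.adjoin k {g} :=
    le_antisymm
      (IntermediateField.adjoin_simple_le_iff.mpr
        (inv_mem (IntermediateField.mem_adjoin_simple_self k g)))
      (IntermediateField.adjoin_simple_le_iff.mpr
        (inv_mem_iff.mp (IntermediateField.mem_adjoin_simple_self k g⁻¹)))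
  have hfin {h : C.X.functionField} (hh : h ≠ 0) :
      (Function.support fun x : closedPoints C.X => max (Scheme.ord h x.1) 0).Finite :=
    (finite_support_ord hh).subset fun x hx hord => hx (by simp only [hord, max_self])
  have hord (x : closedPoints C.X) :
      Scheme.ord g x.1 = max (Scheme.ord g x.1) 0 - max (Scheme.ord g⁻¹ x.1) 0 := by
    rw [ord_inv hg0]
    omega
  rw [finsum_congr hord, finsum_sub_distrib (hfin hg0) (hfin (inv_ne_zero hg0)),
    finsum_max_ord_eq_finrank hg, finsum_max_ord_eq_finrank hinv, hadjoin, sub_self]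

theorem finsum_ord_eq_zero {g : C.X.functionField} (hg : g ≠ 0) :
    ∑ᶠ x ∈ closedPoints C.X, Scheme.ord g x = 0 := by
  rw [← finsum_set_coe_eq_finsum_mem]
  by_cases hDg : KaehlerDifferential.D k _ g = 0
  swap
  · exact finsum_ord_eq_zero_of_D_ne_zero hDg
  obtain ⟨t, ht⟩ : ∃ t : C.X.functionField, KaehlerDifferential.D k _ t ≠ 0 := by
    obtain ⟨_, hC, _, _⟩ := C.exists_finite_isSeparable_ratFunc
    have : IsScalarTower k (RatFunc k) C.X.functionField := .of_algebraMap_eq fun a => (hC a).symm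
    exact ⟨_, D_X_ne_zero⟩
  have ht0 : t ≠ 0 := by
    rintro rfl
    exact ht (map_zero _)
  have hgt : KaehlerDifferential.D k _ (g * t) ≠ 0 := by
    rw [Derivation.leibniz, hDg, smul_zero, add_zero]
    exact smul_ne_zero hg ht
  have hsum := finsum_ord_eq_zero_of_D_ne_zero hgt
  rwa [finsum_congr (ord_mul hg ht0), finsum_add_distrib (finite_support_ord hg)
    (finite_support_ord ht0), finsum_ord_eq_zero_of_D_ne_zero ht, add_zero] at hsum

end SmoothProjectiveCurve

theorem discr_comp_eq_det_sq_mul {A K L M κ : Type*} [CommRing A] [CommRing K] [CommRing L]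
    [Algebra A K] [Algebra K L] [Algebra A L] [IsScalarTower A K L] [AddCommGroup M] [Module A M]
    [Fintype κ] [DecidableEq κ] (e : Module.Basis κ A M) (φ : M →ₗ[A] L) (s : κ → M) :
    Algebra.discr K (φ ∘ s) = algebraMap A K (e.det s) ^ 2 * Algebra.discr K (φ ∘ e) := by
  rw [e.det_apply, RingHom.map_det, ← Algebra.discr_of_matrix_vecMul]
  congr 1
  ext j
  rw [Function.comp_apply, ← e.sum_toMatrix_smul_self s j, map_sum]
  refine Finset.sum_congr rfl fun i _ => ?_
  rw [map_smul, Algebra.smul_def, mul_comm, Function.comp_apply,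
    IsScalarTower.algebraMap_apply A K L]
  rfl

namespace CurveBundle

/-- The sum of the numbers `m_x - 1` over the points `x` of the fibre at `y`: the exponent of `y` in
the discriminant divisor of a tame morphism, and twice the sum of the parabolic weights at `y`.  It
is a junk value if the fibre is infinite. -/
noncomputable def branchDegree {X Y : Scheme.{u}} (f : X ⟶ Y) (y : Y) : ℤ :=
  ∑ᶠ x : {x : X // f x = y}, ((mult f x.1 - 1 : ℕ) : ℤ)

theorem branchDegree_nonneg {X Y : Scheme.{u}} (f : X ⟶ Y) (y : Y) : 0 ≤ branchDegree f y :=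
  finsum_nonneg fun _ => Nat.cast_nonneg _

theorem branchDegree_ne_zero_iff {X Y : Scheme.{u}} (f : X ⟶ Y) (y : Y)
    [Finite {x : X // f x = y}] : branchDegree f y ≠ 0 ↔ ∃ x, f x = y ∧ 2 ≤ mult f x := by
  have := Fintype.ofFinite {x : X // f x = y}
  rw [branchDegree, finsum_eq_sum_of_fintype, Ne,
    Finset.sum_eq_zero_iff_of_nonneg fun _ _ => Nat.cast_nonneg _]
  simp only [Finset.mem_univ, true_imp_iff, Nat.cast_eq_zero, not_forall, Subtype.exists,
    exists_prop]
  exact exists_congr fun x => and_congr_right fun _ => by omega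

theorem exists_sections_germ_eq {Y : Scheme.{u}} (M : Y.Modules) {y : Y} {ι : Type*} [Finite ι]
    (t : ι → Stalk M y) :
    ∃ (V : Y.Opens) (hy : y ∈ V) (s : ι → Γ(M, V)), ∀ i, germ M y hy (s i) = t i := by
  choose W hW s hs using fun i => exists_germ_eq M (t i)
  let V : Y.Opens := ⟨⋂ i, W i, isOpen_iInter_of_finite fun i => (W i).isOpen⟩
  have hV (i : ι) : V ≤ W i := Set.iInter_subset (fun i => (W i : Set Y)) i
  have hy : y ∈ V := Set.mem_iInter.mpr hW
  exact ⟨V, hy, fun i => M.presheaf.map (homOfLE (hV i)).op (s i), fun i =>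
    (germ_res M (homOfLE (hV i)) hy (s i)).trans (hs i)⟩

section StalkDiscr

variable {X Y : Scheme.{u}} [IsIntegral X] [IsIntegral Y] (f : X ⟶ Y) [IsDominant f]

/-- The discriminant of a family of germs of `f_* 𝒪_X` at `y`, for the trace form of the extension
of function fields.  On a basis of the stalk it cuts out the discriminant divisor near `y`. -/
noncomputable def stalkDiscr {ι : Type*} [Fintype ι] [DecidableEq ι] (y : Y)
    (s : ι → Stalk (directImage f) y) : Y.functionField :=
  Algebra.discr Y.functionField (stalkToField f y ∘ s)

variable {ι : Type*} [Fintype ι] [DecidableEq ι]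

theorem stalkDiscr_germ {V : Y.Opens} (s : ι → Γ(directImage f, V)) {y z : Y} (hy : y ∈ V)
    (hz : z ∈ V) : stalkDiscr f y (fun i => germ _ y hy (s i)) =
      stalkDiscr f z fun i => germ _ z hz (s i) := by
  refine congrArg (Algebra.discr Y.functionField) (funext fun i => ?_)
  exact (stalkToField_germ f hy (s i)).trans (stalkToField_germ f hz (s i)).symm

theorem stalkDiscr_toGeneric {y : Y} (s : ι → Stalk (directImage f) y) :
    stalkDiscr f (genericPoint Y) (fun i => toGeneric _ y (s i)) = stalkDiscr f y s := by
  refine congrArg (Algebra.discr Y.functionField) (funext fun i => ?_)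
  exact stalkToField_toGeneric f (s i)

theorem stalkDiscr_eq_det_sq_mul {y : Y}
    (e : Module.Basis ι (Y.presheaf.stalk y) (Stalk (directImage f) y))
    (s : ι → Stalk (directImage f) y) :
    stalkDiscr f y s = algebraMap _ Y.functionField (e.det s) ^ 2 * stalkDiscr f y e :=
  discr_comp_eq_det_sq_mul e (stalkToField f y) s

theorem stalkDiscr_eq_det_toGeneric_sq_mul
    (b : Module.Basis ι Y.functionField (Stalk (directImage f) (genericPoint Y))) {y : Y}
    (s : ι → Stalk (directImage f) y) :
    stalkDiscr f y s =
      b.det (fun i => toGeneric _ y (s i)) ^ 2 * stalkDiscr f (genericPoint Y) b := by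
  rw [← stalkDiscr_toGeneric]
  have hcomp := discr_comp_eq_det_sq_mul (A := Y.functionField) (K := Y.functionField) b
    (stalkToField f (genericPoint Y)) fun i => toGeneric _ y (s i)
  rwa [Algebra.algebraMap_self, RingHom.id_apply] at hcomp

theorem stalkDiscr_ne_zero [FiniteDimensional Y.functionField (FunField f)]
    [Algebra.IsSeparable Y.functionField (FunField f)] {y : Y}
    (e : Module.Basis ι (Y.presheaf.stalk y) (Stalk (directImage f) y))
    (hcard : Fintype.card ι = mapDegree f) : stalkDiscr f y e ≠ 0 := by
  have hindep : LinearIndependent Y.functionField (stalkToField f y ∘ e) :=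
    (LinearIndependent.iff_fractionRing (Y.presheaf.stalk y) Y.functionField).mp
      (e.linearIndependent.map' _ (LinearMap.ker_eq_bot.mpr (stalkToField_injective f y)))
  have hspan : ⊤ ≤ Submodule.span Y.functionField (Set.range (stalkToField f y ∘ e)) :=
    (hindep.span_eq_top_of_card_eq_finrank' (hcard.trans (finrank_funField f).symm)).ge
  rw [stalkDiscr, ← Module.Basis.coe_mk hindep hspan]
  exact Algebra.discr_not_zero_of_basis Y.functionField (Module.Basis.mk hindep hspan)

end StalkDiscr

end CurveBundle

namespace SmoothProjectiveCurve

open CurveBundle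

variable {k : Type u} [Field k] {X Y : SmoothProjectiveCurve k} {f : X.X ⟶ Y.X}

/-- `f` is tamely ramified: the characteristic of `k` does not divide any of the multiplicities
`m_x`. -/
def IsTame (f : X.X ⟶ Y.X) : Prop :=
  ∀ x ∈ closedPoints X.X, (mult f x : k) ≠ 0

theorem map_mem_closedPoints (hf : f ≫ Y.str = X.str) {x : X.X} (hx : x ∈ closedPoints X.X) :
    f x ∈ closedPoints Y.X := by
  have himage := isClosedMap hf _ hx
  rwa [Set.image_singleton] at himage

variable [IsDominant f]

theorem mem_closedPoints_of_map (y : closedPoints Y.X) (x : {x : X.X // f x = y.1}) :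
    x.1 ∈ closedPoints X.X :=
  X.mem_closedPoints_iff.mpr
    (ne_genericPoint_of_map_ne f (x.2.trans_ne (Y.mem_closedPoints_iff.mp y.2)))

theorem IsTame.isUnit_mult (hf : IsTame f) (y : closedPoints Y.X) (x : {x : X.X // f x = y.1}) :
    IsUnit (mult f x.1 : Y.X.presheaf.stalk y.1) := by
  rw [← map_natCast (Y.stalkHom y.1)]
  exact (IsUnit.mk0 _ (hf x.1 (mem_closedPoints_of_map y x))).map _

theorem range_stalkToField_genericPoint (hf : f ≫ Y.str = X.str) :
    LinearMap.range (stalkToField f (genericPoint Y.X)) = ⊤ := by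
  refine eq_top_iff.mpr fun g _ => (mem_range_stalkToField_iff f (isClosedMap hf)).mpr ?_
  intro x hx
  refine algebraMap_stalk_surjective_of_eq_genericPoint ?_ g
  by_contra hne
  refine Y.not_isClosed_genericPoint ?_
  have hclosed := isClosedMap hf _ (X.isClosed_singleton_of_ne hne)
  rwa [Set.image_singleton, hx] at hclosed

/-- The stalk of `f_* 𝒪_X` at the generic point of `Y`, identified with the function field of
`X`. -/
noncomputable def genericStalkEquiv (hf : f ≫ Y.str = X.str) :
    Stalk (directImage f) (genericPoint Y.X) ≃ₗ[Y.X.functionField] FunField f :=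
  LinearEquiv.ofInjective _ (stalkToField_injective f _) ≪≫ₗ
    LinearEquiv.ofTop _ (range_stalkToField_genericPoint hf)

theorem finrank_stalk_genericPoint (hf : f ≫ Y.str = X.str) :
    Module.finrank Y.X.functionField (Stalk (directImage f) (genericPoint Y.X)) = mapDegree f :=
  (genericStalkEquiv hf).finrank_eq.trans (finrank_funField f)

variable [FiniteDimensional Y.X.functionField (FunField f)]
  [Algebra.IsSeparable Y.X.functionField (FunField f)]

theorem mem_branchLocus_iff (hf : f ≫ Y.str = X.str) (y : Y.X) :
    y ∈ branchLocus f ↔ y ∈ closedPoints Y.X ∧ branchDegree f y ≠ 0 := by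
  constructor
  · rintro ⟨x, ⟨hx, hx2⟩, rfl⟩
    have hclosed := map_mem_closedPoints hf hx
    have := finite_fiber hf ⟨f x, hclosed⟩
    exact ⟨hclosed, (branchDegree_ne_zero_iff f (f x)).mpr ⟨x, rfl, hx2⟩⟩
  · rintro ⟨hy, hbranch⟩
    have := finite_fiber hf ⟨y, hy⟩
    obtain ⟨x, hxy, hx2⟩ := (branchDegree_ne_zero_iff f y).mp hbranch
    exact ⟨x, ⟨mem_closedPoints_of_map ⟨y, hy⟩ ⟨x, hxy⟩, hx2⟩, hxy⟩

variable [IsAlgClosed k]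

theorem sum_mult_eq_mapDegree (hf : f ≫ Y.str = X.str) (y : closedPoints Y.X)
    [Fintype {x : X.X // f x = y.1}] :
    ∑ x : {x : X.X // f x = y.1}, mult f x.1 = mapDegree f := by
  rw [← finrank_funField,
    (isPlaceFamily_closedPoint hf y).finrank_eq_sum_ramIdx (K := Y.X.functionField)]
  exact Finset.sum_congr rfl fun x _ => mult_eq_ramIdx x.2

theorem mult_pos (hf : f ≫ Y.str = X.str) (y : closedPoints Y.X) (x : {x : X.X // f x = y.1}) :
    0 < mult f x.1 := by
  have := finite_fiber hf y
  have := Fintype.ofFinite {x : X.X // f x = y.1}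
  exact (isSplitFactorization hf y).pos x

theorem mult_le_mapDegree (hf : f ≫ Y.str = X.str) (y : closedPoints Y.X)
    (x : {x : X.X // f x = y.1}) : mult f x.1 ≤ mapDegree f := by
  have := finite_fiber hf y
  have := Fintype.ofFinite {x : X.X // f x = y.1}
  rw [← sum_mult_eq_mapDegree hf y]
  exact Finset.single_le_sum (f := fun x : {x : X.X // f x = y.1} => mult f x.1)
    (fun _ _ => Nat.zero_le _) (Finset.mem_univ x)

theorem nonempty_basis_stalk (hf : f ≫ Y.str = X.str) (y : Y.X) : Nonempty
    (Module.Basis (Fin (mapDegree f)) (Y.X.presheaf.stalk y) (Stalk (directImage f) y)) := by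
  by_cases hy : y = genericPoint Y.X
  · subst hy
    exact ⟨(Module.finBasisOfFinrankEq Y.X.functionField (FunField f) (finrank_funField f)).map
      (genericStalkEquiv hf).symm⟩
  · let y' : closedPoints Y.X := ⟨y, Y.mem_closedPoints_iff.mpr hy⟩
    have := finite_fiber hf y'
    have := Fintype.ofFinite {x : X.X // f x = y}
    obtain ⟨b, -⟩ := exists_basis_stalkImage_eq hf y'
    refine ⟨b.reindex (Fintype.equivFinOfCardEq ?_)⟩
    rw [Fintype.card_sigma]
    simp_rw [Fintype.card_fin]
    exact sum_mult_eq_mapDegree hf y'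

theorem ord_stalkDiscr_basis (hf : f ≫ Y.str = X.str) (htame : IsTame f) (y : closedPoints Y.X)
    {ι : Type*} [Fintype ι] [DecidableEq ι]
    (e : Module.Basis ι (Y.X.presheaf.stalk y.1) (Stalk (directImage f) y.1)) :
    Scheme.ord (stalkDiscr f y.1 e) y.1 = branchDegree f y.1 := by
  have := finite_fiber hf y
  have := Fintype.ofFinite {x : X.X // f x = y.1}
  have hunit (x : {x : X.X // f x = y.1}) :
      IsUnit (ramIdx (Y.X.presheaf.stalk y.1) (X.X.presheaf.stalk x.1) (FunField f) :
        Y.X.presheaf.stalk y.1) :=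
    mult_eq_ramIdx x.2 ▸ htame.isUnit_mult y x
  rw [ord_eq_ordZ_closedPoint, branchDegree, finsum_eq_sum_of_fintype]
  refine ((isPlaceFamily_closedPoint hf y).ordZ_discr (K := Y.X.functionField) hunit
    (e.map (stalkEquiv hf y))).trans ?_
  exact Finset.sum_congr rfl fun x _ => by rw [mult_eq_ramIdx x.2]

theorem ord_stalkDiscr (hf : f ≫ Y.str = X.str) (htame : IsTame f) (y : closedPoints Y.X)
    {ι : Type*} [Fintype ι] [DecidableEq ι]
    (e : Module.Basis ι (Y.X.presheaf.stalk y.1) (Stalk (directImage f) y.1))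
    {s : ι → Stalk (directImage f) y.1} (hs : stalkDiscr f y.1 s ≠ 0) :
    Scheme.ord (stalkDiscr f y.1 s) y.1 =
      2 * Scheme.ord (algebraMap _ Y.X.functionField (e.det s)) y.1 + branchDegree f y.1 := by
  rw [stalkDiscr_eq_det_sq_mul f e s] at hs ⊢
  have hdet := pow_ne_zero_iff two_ne_zero |>.mp (left_ne_zero_of_mul hs)
  rw [sq, mul_assoc, ord_mul hdet (mul_ne_zero hdet (right_ne_zero_of_mul hs)),
    ord_mul hdet (right_ne_zero_of_mul hs), ord_stalkDiscr_basis hf htame]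
  ring

theorem ord_stalkDiscr_eq_zero_iff (hf : f ≫ Y.str = X.str) (htame : IsTame f)
    (y : closedPoints Y.X) {ι : Type*} [Fintype ι] [DecidableEq ι]
    (e : Module.Basis ι (Y.X.presheaf.stalk y.1) (Stalk (directImage f) y.1))
    {s : ι → Stalk (directImage f) y.1} (hs : stalkDiscr f y.1 s ≠ 0) :
    Scheme.ord (stalkDiscr f y.1 s) y.1 = 0 ↔ IsUnit (e.det s) ∧ branchDegree f y.1 = 0 := by
  have hdet : algebraMap (Y.X.presheaf.stalk y.1) Y.X.functionField (e.det s) ≠ 0 := by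
    rw [stalkDiscr_eq_det_sq_mul f e s] at hs
    exact (pow_ne_zero_iff two_ne_zero).mp (left_ne_zero_of_mul hs)
  have hnonneg : 0 ≤ Scheme.ord (algebraMap _ Y.X.functionField (e.det s)) y.1 := by
    rw [ord_eq_ordZ_closedPoint, ordZ_nonneg_iff hdet]
    exact ⟨_, rfl⟩
  have hunit : IsUnit (e.det s) ↔
      Scheme.ord (algebraMap _ Y.X.functionField (e.det s)) y.1 = 0 := by
    rw [ord_eq_ordZ_closedPoint, ordZ_eq_zero_iff hdet]
    exact ⟨fun h => ⟨_, h, rfl⟩, fun ⟨o, ho, heq⟩ =>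
      IsFractionRing.injective (Y.X.presheaf.stalk y.1) Y.X.functionField heq ▸ ho⟩
  have hbranch := branchDegree_nonneg f y.1
  rw [ord_stalkDiscr hf htame y e hs, hunit]
  omega

theorem isBasis_of_ord_stalkDiscr_eq_zero (hf : f ≫ Y.str = X.str) (htame : IsTame f) {y : Y.X}
    {s : Fin (mapDegree f) → Stalk (directImage f) y} (hs : stalkDiscr f y s ≠ 0)
    (hord : y ∈ closedPoints Y.X → Scheme.ord (stalkDiscr f y s) y = 0) :
    LinearIndependent (Y.X.presheaf.stalk y) s ∧
      Submodule.span (Y.X.presheaf.stalk y) (Set.range s) = ⊤ := by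
  obtain ⟨e⟩ := nonempty_basis_stalk hf y
  refine e.is_basis_iff_det.mpr ?_
  by_cases hy : y = genericPoint Y.X
  · rw [stalkDiscr_eq_det_sq_mul f e s] at hs
    have hdet : e.det s ≠ 0 := fun h => hs (by rw [h, map_zero, zero_pow two_ne_zero, zero_mul])
    have hfield : IsField (Y.X.presheaf.stalk y) := hy ▸ Field.toIsField Y.X.functionField
    let := hfield.toField
    exact hdet.isUnit
  · have hclosed := Y.mem_closedPoints_iff.mpr hy
    exact ((ord_stalkDiscr_eq_zero_iff hf htame ⟨y, hclosed⟩ e hs).mp (hord hclosed)).1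

theorem finite_branchDegree_ne_zero (hf : f ≫ Y.str = X.str) (htame : IsTame f) :
    {y ∈ closedPoints Y.X | branchDegree f y ≠ 0}.Finite := by
  obtain ⟨b⟩ := nonempty_basis_stalk hf (genericPoint Y.X)
  obtain ⟨V, hη, s, hs⟩ := exists_sections_germ_eq (directImage f) b
  have hdiscr : stalkDiscr f (genericPoint Y.X) (fun i => germ _ _ hη (s i)) ≠ 0 := by
    rw [funext hs]
    exact stalkDiscr_ne_zero f b (Fintype.card_fin _)
  refine ((finite_ord_ne_zero hdiscr).union (Y.finite_of_isClosed (Z := (V : Set Y.X)ᶜ)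
    V.isOpen.isClosed_compl fun h => h hη)).subset fun y ⟨hy, hbranch⟩ => ?_
  by_cases hyV : y ∈ V
  · refine .inl ⟨hy, fun hord => hbranch ?_⟩
    obtain ⟨e⟩ := nonempty_basis_stalk hf y
    rw [stalkDiscr_germ f s hη hyV] at hdiscr hord
    exact ((ord_stalkDiscr_eq_zero_iff hf htame ⟨y, hy⟩ e hdiscr).mp hord).2
  · exact .inr hyV

theorem isVectorBundle_directImage (hf : f ≫ Y.str = X.str) (htame : IsTame f) :
    IsVectorBundle (directImage f) (mapDegree f) := by
  intro y
  obtain ⟨e⟩ := nonempty_basis_stalk hf y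
  obtain ⟨V, hy, s, hs⟩ := exists_sections_germ_eq (directImage f) e
  have hgerm : (fun i => germ (directImage f) y hy (s i)) = e := funext hs
  have hdiscr : stalkDiscr f y (fun i => germ _ y hy (s i)) ≠ 0 :=
    hgerm ▸ stalkDiscr_ne_zero f e (Fintype.card_fin _)
  let B : Set Y.X := {z ∈ closedPoints Y.X |
    Scheme.ord (stalkDiscr f y fun i => germ _ y hy (s i)) z ≠ 0} \ {y}
  have hB : IsClosed B := by
    rw [← Set.biUnion_of_singleton B]
    exact ((finite_ord_ne_zero hdiscr).subset Set.sdiff_subset).isClosed_biUnion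
      fun z hz => hz.1.1
  let W : Y.X.Opens := V ⊓ ⟨Bᶜ, hB.isOpen_compl⟩
  have hWV : W ≤ V := inf_le_left
  refine ⟨W, ⟨hy, fun h => h.2 rfl⟩, fun i => (directImage f).presheaf.map (homOfLE hWV).op (s i),
    fun z hz => ?_⟩
  have hres : (fun i => germ (directImage f) z hz
      ((directImage f).presheaf.map (homOfLE hWV).op (s i))) =
        fun i => germ (directImage f) z (hWV hz) (s i) :=
    funext fun i => germ_res (directImage f) (homOfLE hWV) hz (s i)
  rw [hres]
  by_cases hzy : z = y
  · subst hzy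
    rw [hgerm]
    exact ⟨e.linearIndependent, e.span_eq⟩
  · rw [stalkDiscr_germ f s hy (hWV hz)] at hdiscr
    refine isBasis_of_ord_stalkDiscr_eq_zero hf htame hdiscr fun hclosed => ?_
    rw [← stalkDiscr_germ f s hy (hWV hz)]
    by_contra hord
    exact hz.2 ⟨⟨hclosed, hord⟩, hzy⟩

end SmoothProjectiveCurve

namespace CurveBundle

variable {X Y : Scheme.{u}} (f : X ⟶ Y)

theorem directImageParabolic_flag_last (y : Y) :
    (directImageParabolic f).flag y (Fin.last _) = ⊥ :=
  Fin.lastCases_last (motive := fun _ => Submodule (Kappa Y y) (Fiber (directImage f) y)) ..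

theorem directImageParabolic_weight_mem_Ico (y : Y) [Finite {x : X // f x = y}]
    (j : Fin ((directImageParabolic f).n y)) :
    (directImageParabolic f).weight y j ∈ Set.Ico 0 1 := by
  obtain ⟨p, hp⟩ := (mem_weightFinset_iff y _).mp ((weightFinset f y).orderEmbOfFin_mem rfl j)
  refine (Set.mem_of_eq_of_mem hp.symm ⟨by positivity, ?_⟩ : _ ∈ Set.Ico (0 : ℚ) 1)
  rw [div_lt_one (by exact_mod_cast p.2.pos)]
  exact_mod_cast p.2.2

end CurveBundle

namespace SmoothProjectiveCurve

open CurveBundle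

variable {k : Type u} [Field k] [IsAlgClosed k] {X Y : SmoothProjectiveCurve k} {f : X.X ⟶ Y.X}
  [IsDominant f]

theorem isTame_of_mapDegree_lt (hf : f ≫ Y.str = X.str)
    (hsm : ∃ U : X.X.Opens, (U : Set X.X).Nonempty ∧ Smooth (U.ι ≫ f))
    (hchar : ringChar k ≠ 0 → mapDegree f < ringChar k) : IsTame f := by
  have := finiteDimensional_funField hf
  have := isSeparable_funField hf hsm
  intro x hx
  have hpos : 0 < mult f x := mult_pos hf ⟨f x, map_mem_closedPoints hf hx⟩ ⟨x, rfl⟩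
  have hle : mult f x ≤ mapDegree f :=
    mult_le_mapDegree hf ⟨f x, map_mem_closedPoints hf hx⟩ ⟨x, rfl⟩
  rw [Ne, ringChar.spec]
  intro hdvd
  by_cases hzero : ringChar k = 0
  · exact hpos.ne' (zero_dvd_iff.mp (hzero ▸ hdvd))
  · exact (hle.trans_lt (hchar hzero)).not_ge (Nat.le_of_dvd hpos hdvd)

variable [FiniteDimensional Y.X.functionField (FunField f)]
  [Algebra.IsSeparable Y.X.functionField (FunField f)]

theorem ord_stalkDiscr_genericPoint (hf : f ≫ Y.str = X.str) (htame : IsTame f) {n : ℕ}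
    (hn : n = mapDegree f)
    (b : Module.Basis (Fin n) Y.X.functionField (Stalk (directImage f) (genericPoint Y.X)))
    (y : closedPoints Y.X) :
    Scheme.ord (stalkDiscr f (genericPoint Y.X) b) y.1 =
      2 * detOrder (directImage f) b y.1 + branchDegree f y.1 := by
  subst hn
  rw [detOrder, dif_pos (nonempty_basis_stalk hf y.1)]
  generalize (nonempty_basis_stalk hf y.1).some = e
  have hne := stalkDiscr_ne_zero f e (Fintype.card_fin _)
  have hord := ord_stalkDiscr_basis hf htame y e
  rw [stalkDiscr_eq_det_toGeneric_sq_mul f b] at hne hord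
  have hdet := (pow_ne_zero_iff two_ne_zero).mp (left_ne_zero_of_mul hne)
  have hdiscr := right_ne_zero_of_mul hne
  rw [sq, mul_assoc, ord_mul hdet (mul_ne_zero hdet hdiscr), ord_mul hdet hdiscr] at hord
  linarith

theorem two_mul_degree_directImage (hf : f ≫ Y.str = X.str) (htame : IsTame f) :
    2 * degree (directImage f) = -∑ᶠ y ∈ closedPoints Y.X, branchDegree f y := by
  have : Module.Finite Y.X.functionField (Stalk (directImage f) (genericPoint Y.X)) :=
    .equiv (genericStalkEquiv hf).symm
  have hbasis := Nonempty.intro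
    (Module.finBasis Y.X.functionField (Stalk (directImage f) (genericPoint Y.X)))
  have hrank := finrank_stalk_genericPoint hf
  rw [degree, dif_pos hbasis]
  generalize hbasis.some = b
  have hdiscr := stalkDiscr_ne_zero f b ((Fintype.card_fin _).trans hrank)
  have hord := finsum_ord_eq_zero hdiscr
  have hdet (y : Y.X) (hy : y ∈ closedPoints Y.X) :
      Scheme.ord (stalkDiscr f (genericPoint Y.X) b) y =
        2 * detOrder (directImage f) b y + branchDegree f y :=
    ord_stalkDiscr_genericPoint hf htame hrank b ⟨y, hy⟩
  have hbranch := finite_branchDegree_ne_zero hf htame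
  have hfinite : (closedPoints Y.X ∩ Function.support fun y =>
      2 * detOrder (directImage f) b y).Finite := by
    refine ((finite_ord_ne_zero hdiscr).union hbranch).subset fun y ⟨hy, hne⟩ => ?_
    by_contra! h
    simp only [Set.mem_union, Set.mem_ofPred_eq, hy, true_and, not_or, not_not] at h
    exact hne (by linarith [hdet y hy])
  rw [finsum_mem_congr rfl hdet, finsum_mem_add_distrib' hfinite hbranch] at hord
  rw [mul_finsum_mem]
  exact eq_neg_of_add_eq_zero_left hord

theorem directImageParabolic_flag_zero (hf : f ≫ Y.str = X.str) {y : Y.X} (hy : y ∈ branchLocus f) :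
    (directImageParabolic f).flag y 0 = ⊤ := by
  have hclosed := ((mem_branchLocus_iff hf y).mp hy).1
  have := finite_fiber hf ⟨y, hclosed⟩
  obtain ⟨b, hb⟩ := exists_basis_flag_eq_weightFlag hf ⟨y, hclosed⟩
  obtain ⟨x, ⟨-, hx⟩, hxy⟩ := hy
  have hne : (weightFinset f y).Nonempty :=
    ⟨_, (mem_weightFinset_iff y _).mpr ⟨⟨⟨x, hxy⟩, ⟨0, two_pos.trans_le hx⟩⟩, rfl⟩⟩
  exact (congrFun hb 0).trans (weightFlag_zero b (mem_weightFinset_iff y) hne)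

theorem isParabolicBundle_directImageParabolic (hf : f ≫ Y.str = X.str) (htame : IsTame f) :
    (directImageParabolic f).IsParabolicBundle (mapDegree f) where
  isVectorBundle := isVectorBundle_directImage hf htame
  finite_divisor := (finite_branchDegree_ne_zero hf htame).subset fun y hy =>
    (mem_branchLocus_iff hf y).mp hy
  closed_points := fun y hy => ((mem_branchLocus_iff hf y).mp hy).1
  flag_first := fun y hy => directImageParabolic_flag_zero hf hy
  flag_last := fun y _ => directImageParabolic_flag_last f y
  flag_strictAnti := fun y hy => by
    have hclosed := ((mem_branchLocus_iff hf y).mp hy).1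
    have := finite_fiber hf ⟨y, hclosed⟩
    obtain ⟨b, hb⟩ := exists_basis_flag_eq_weightFlag hf ⟨y, hclosed⟩
    rw [hb]
    exact weightFlag_strictAnti b (mem_weightFinset_iff y)
  weight_nonneg := fun y hy j =>
    have := finite_fiber hf ⟨y, ((mem_branchLocus_iff hf y).mp hy).1⟩
    (directImageParabolic_weight_mem_Ico f y j).1
  weight_lt_one := fun y hy j =>
    have := finite_fiber hf ⟨y, ((mem_branchLocus_iff hf y).mp hy).1⟩
    (directImageParabolic_weight_mem_Ico f y j).2
  weight_strictMono := fun y _ => ((weightFinset f y).orderEmbOfFin rfl).strictMono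

theorem finsum_weight_mul_multiplicity (hf : f ≫ Y.str = X.str) (htame : IsTame f) :
    ∑ᶠ y ∈ branchLocus f, ∑ j, (directImageParabolic f).weight y j *
      ((directImageParabolic f).multiplicity y j : ℚ) =
        (∑ᶠ y ∈ closedPoints Y.X, branchDegree f y : ℤ) / 2 := by
  have hlocus : closedPoints Y.X ∩ Function.support (branchDegree f) = branchLocus f :=
    Set.ext fun y => (mem_branchLocus_iff hf y).symm
  have hfinite : (branchLocus f).Finite := hlocus ▸ finite_branchDegree_ne_zero hf htame
  rw [← finsum_mem_inter_support (branchDegree f), hlocus,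
    finsum_mem_eq_finite_toFinset_sum _ hfinite, finsum_mem_eq_finite_toFinset_sum _ hfinite,
    Int.cast_sum, Finset.sum_div]
  refine Finset.sum_congr rfl fun y hy => ?_
  have hclosed := ((mem_branchLocus_iff hf y).mp (hfinite.mem_toFinset.mp hy)).1
  have := finite_fiber hf ⟨y, hclosed⟩
  have := Fintype.ofFinite {x : X.X // f x = y}
  rw [branchDegree, finsum_eq_sum_of_fintype, Int.cast_sum]
  exact sum_weight_mul_multiplicity hf ⟨y, hclosed⟩

theorem parDeg_directImageParabolic (hf : f ≫ Y.str = X.str) (htame : IsTame f) :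
    (directImageParabolic f).parDeg = 0 := by
  have hdegree : (2 * degree (directImage f) : ℚ) =
      -(∑ᶠ y ∈ closedPoints Y.X, branchDegree f y : ℤ) := by
    exact_mod_cast two_mul_degree_directImage hf htame
  refine (congrArg (_ + ·) (finsum_weight_mul_multiplicity hf htame)).trans ?_
  change (degree (directImage f) : ℚ) + _ = 0
  linarith

end SmoothProjectiveCurve

theorem lemma1_general {k : Type u} [Field k] [IsAlgClosed k]
    (X Y : SmoothProjectiveCurve k) (f : X.X ⟶ Y.X) (hf : f ≫ Y.str = X.str)
    (hdom : IsDominant f)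
    (hsm : ∃ U : X.X.Opens, (U : Set X.X).Nonempty ∧ Smooth (U.ι ≫ f))
    (htame : SmoothProjectiveCurve.IsTame f) :
    (CurveBundle.directImageParabolic f).IsParabolicBundle (CurveBundle.mapDegree f) ∧
      (CurveBundle.directImageParabolic f).parDeg = 0 := by
  have := SmoothProjectiveCurve.finiteDimensional_funField hf
  have := SmoothProjectiveCurve.isSeparable_funField hf hsm
  exact ⟨SmoothProjectiveCurve.isParabolicBundle_directImageParabolic hf htame,
    SmoothProjectiveCurve.parDeg_directImageParabolic hf htame⟩

theorem lemma1 {k : Type u} [Field k] [IsAlgClosed k]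
    (X Y : SmoothProjectiveCurve k) (f : X.X ⟶ Y.X) (hf : f ≫ Y.str = X.str)
    (hdom : IsDominant f)
    (hsm : ∃ U : X.X.Opens, (U : Set X.X).Nonempty ∧ Smooth (U.ι ≫ f))
    (hchar : ringChar k ≠ 0 → CurveBundle.mapDegree f < ringChar k) :
    (CurveBundle.directImageParabolic f).IsParabolicBundle (CurveBundle.mapDegree f) ∧
      (CurveBundle.directImageParabolic f).parDeg = 0 :=
  lemma1_general X Y f hf hdom hsm
    (SmoothProjectiveCurve.isTame_of_mapDegree_lt hf hsm hchar)
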